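/- Let $G$ be an Abelian group and $N,D,p\in\mathbb N$. Consider a ring of $N$ sites labelled by $\mathbb Z/N$, each with Hilbert space $\mathbb C^p$ carrying a linear unitary representation $g\mapsto U(g)$ of $G$. Let $|\lambda\rangle=\sum_{k=1}^D\lambda_k|k\rangle|k\rangle\in\mathbb C^D\otimes\mathbb C^D$ with $\lambda_k>0$ and $\sum_k\lambda_k^2=1$, let $S:\mathbb C^D\otimes\mathbb C^D\to\mathbb C^p$ be an isometry, and let $|\Psi\rangle=S^{\otimes N}|\lambda\rangle^{\otimes N}$, where site $i$ has virtual sites $i_L,i_R$, the pair $(i_R,(i+1)_L)$ is in the state $|\lambda\rangle$, and $S$ maps $i_L\otimes i_R$ to the physical site $i$. Assume $U(g)^{\otimes N}|\Psi\rangle=|\Psi\rangle$ for all $g\in G$. Let $A$, $C$, $B$ be consecutive non-empty blocks of neighbouring sites of the ring, in this order, which do not exhaust the ring (so $A$ and $B$ are non-neighbouring and $C$ is the region between them). For a one-dimensional unitary representation $\kappa$ of $G$ let $\Pi^{(C)}_\kappa$ be the orthogonal projector onto the vectors on which $\bigotimes_{i\in C}U_i(g)$ acts as $\kappa(g)$ for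 all $g$, and put $$\Omega^{(AB|C)}(\Psi)=\sum_\kappa|\kappa\rangle\langle\kappa|^{(K_C)}\otimes\mathrm{tr}_{\overline{AB}}\big(\Pi^{(C)}_\kappa|\Psi\rangle\langle\Psi|\big),$$ where $\{|\kappa\rangle\}$ are orthonormal states of a register $K_C$, whose finite set of labels contains every charge $\kappa$ with $\Pi^{(C)}_\kappa\ne0$. Call a projective unitary representation $V$ of $G$ on $\mathbb C^D$, with factor system $\omega$ (that is, $V(g)V(h)=\omega(g,h)V(gh)$), a virtual representation of the symmetry if for some one-dimensional unitary representation $\chi$ of $G$ $$U(g)S=\chi(g)\,S\,[V(g)\otimes V^*(g)],\qquad [V^*(g)\otimes V(g)]|\lambda\rangle=|\lambda\rangle\qquad(g\in G),$$ where $V^*$ is the entrywise complex conjugate. Factor systems $\omega,\omega'$ are in the same class $[\omega]$ if $\omega(g,h)=\omega'(g,h)\,\theta(gh)\theta(g)^{-1}\theta(h)^{-1}$ for some phases $\theta(g)$. Then a virtual representation exists. For every virtual representation, with factor system $\omega$, there is a unique $d_{[\omega]}\ge1$ which is the dimension of every finite-dimensional projective unitary irrep of $G$ with factor system in $[\omega]$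 (and such irreps exist), and the state $\Omega^{(AB|C)}(\Psi)$ is LOCC-equivalent to the maximally entangled state $d_{[\omega]}^{-1/2}\sum_{i=1}^{d_{[\omega]}}|i\rangle|i\rangle$ of a pair of $d_{[\omega]}$-dimensional systems. That is, each of the two states can be transformed into the other exactly and deterministically by finitely many rounds of local operations and classical communication. This holds for the partition $AK_C|B$ as well as for the partition $A|K_CB$. -/

import Mathlib

open scoped Kronecker Matrix

noncomputable section

namespace SPTEnt

/-! ### LOCC transformations of bipartite states

A state of a bipartite system with finite-dimensional local Hilbert spaces `ℂ^a` (Alice) and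
`ℂ^b` (Bob) is given by its density matrix, with rows and columns indexed by `a × b`. -/

/-- Maps implementable by a finite-round protocol of local operations and classical
communication. Either nothing remains to be done, or one of the two parties applies a local
quantum instrument (with Kraus operators `E j` satisfying `∑ j, (E j)ᴴ * E j = 1`, possibly
changing the local Hilbert space), announces the outcome `j`, and the parties continue with an
LOCC protocol `Λ j` which may depend on `j`. Forgetting outcomes is the sum over `j`. -/
inductive IsLOCC {a' b' : Type} [Fintype a'] [DecidableEq a'] [Fintype b'] [DecidableEq b'] :
    ∀ {a b : Type} [Fintype a] [DecidableEq a] [Fintype b] [DecidableEq b],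
      (Matrix (a × b) (a × b) ℂ → Matrix (a' × b') (a' × b') ℂ) → Prop
  | done : IsLOCC (fun ρ : Matrix (a' × b') (a' × b') ℂ => ρ)
  | alice {a b J : Type} [Fintype a] [DecidableEq a] [Fintype b] [DecidableEq b] [Fintype J]
      (c : J → Type) [∀ j, Fintype (c j)] [∀ j, DecidableEq (c j)]
      (E : ∀ j, Matrix (c j) a ℂ) (hE : ∑ j, (E j)ᴴ * E j = 1)
      (Λ : ∀ j, Matrix (c j × b) (c j × b) ℂ → Matrix (a' × b') (a' × b') ℂ)
      (hΛ : ∀ j, IsLOCC (Λ j)) :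
      IsLOCC (fun ρ : Matrix (a × b) (a × b) ℂ =>
        ∑ j, Λ j ((E j ⊗ₖ (1 : Matrix b b ℂ)) * ρ * (E j ⊗ₖ (1 : Matrix b b ℂ))ᴴ))
  | bob {a b J : Type} [Fintype a] [DecidableEq a] [Fintype b] [DecidableEq b] [Fintype J]
      (c : J → Type) [∀ j, Fintype (c j)] [∀ j, DecidableEq (c j)]
      (E : ∀ j, Matrix (c j) b ℂ) (hE : ∑ j, (E j)ᴴ * E j = 1)
      (Λ : ∀ j, Matrix (a × c j) (a × c j) ℂ → Matrix (a' × b') (a' × b') ℂ)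
      (hΛ : ∀ j, IsLOCC (Λ j)) :
      IsLOCC (fun ρ : Matrix (a × b) (a × b) ℂ =>
        ∑ j, Λ j (((1 : Matrix a a ℂ) ⊗ₖ E j) * ρ * ((1 : Matrix a a ℂ) ⊗ₖ E j)ᴴ))

section Convert

variable {a b a' b' : Type} [Fintype a] [DecidableEq a] [Fintype b] [DecidableEq b]
  [Fintype a'] [DecidableEq a'] [Fintype b'] [DecidableEq b']

/-- `ρ` can be transformed (deterministically and exactly) into `σ` by LOCC. -/
def LOCCConvertible (ρ : Matrix (a × b) (a × b) ℂ) (σ : Matrix (a' × b') (a' × b') ℂ) : Prop :=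
  ∃ Λ : Matrix (a × b) (a × b) ℂ → Matrix (a' × b') (a' × b') ℂ, IsLOCC Λ ∧ Λ ρ = σ

/-- `ρ` and `σ` can be transformed into each other by LOCC: they have the same entanglement. -/
def LOCCEquivalent (ρ : Matrix (a × b) (a × b) ℂ) (σ : Matrix (a' × b') (a' × b') ℂ) : Prop :=
  LOCCConvertible ρ σ ∧ LOCCConvertible σ ρ

end Convert

/-- The density matrix of `d^{-1/2} ∑ i, |i⟩|i⟩`, a maximally entangled state of a pair of
`d`-dimensional systems. -/
def maxEntangled (d : ℕ) : Matrix (Fin d × Fin d) (Fin d × Fin d) ℂ :=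
  Matrix.of fun x y => if x.1 = x.2 ∧ y.1 = y.2 then (1 / d : ℂ) else 0

/-! ### Projective unitary representations -/

section Projective

variable {G : Type*} [CommGroup G]

/-- `T` is a projective unitary representation with factor system `ω`:
`T(g) T(h) = ω(g,h) T(gh)`. -/
def IsProjRep (ω : G → G → Circle) {n : ℕ} (T : G → Matrix.unitaryGroup (Fin n) ℂ) : Prop :=
  ∀ g h : G, (T g : Matrix (Fin n) (Fin n) ℂ) * (T h : Matrix (Fin n) (Fin n) ℂ)
    = (ω g h : ℂ) • (T (g * h) : Matrix (Fin n) (Fin n) ℂ)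

/-- No invariant subspaces other than the two trivial ones, on a nonzero space. -/
def IsIrred {n : ℕ} (T : G → Matrix.unitaryGroup (Fin n) ℂ) : Prop :=
  0 < n ∧ ∀ W : Submodule ℂ (Fin n → ℂ),
    (∀ g, ∀ v ∈ W, (T g : Matrix (Fin n) (Fin n) ℂ) *ᵥ v ∈ W) → W = ⊥ ∨ W = ⊤

/-- Equality of the classes `[ω]` and `[ω']`: equivalence of factor systems under gauge
transformations `T(g) ↦ θ(g) T(g)`. -/
def Cohomologous (ω ω' : G → G → Circle) : Prop :=
  ∃ θ : G → Circle, ∀ g h, ω g h = ω' g h * (θ (g * h) * (θ g)⁻¹ * (θ h)⁻¹)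

/-- The set of dimensions of the (finite-dimensional, unitary) projective irreps of `G` whose
factor system is in the class `[ω]`. -/
def irrepDims (ω : G → G → Circle) : Set ℕ :=
  {n | ∃ ω' : G → G → Circle, Cohomologous ω ω' ∧
    ∃ T : G → Matrix.unitaryGroup (Fin n) ℂ, IsProjRep ω' T ∧ IsIrred T}

end Projective

/-! ### Charge sectors -/

section Charge

variable {G : Type*} [CommGroup G] {m : Type} [Fintype m] [DecidableEq m]

/-- The subspace of vectors of charge `κ` (a one-dimensional unitary representation of `G`):
`R(g) v = κ(g) v` for all `g`. -/
def chargeSector (R : G → Matrix m m ℂ) (κ : G →* Circle) :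
    Submodule ℂ (EuclideanSpace ℂ m) :=
  ⨅ g : G, Module.End.eigenspace (Matrix.toEuclideanLin (R g)) (κ g : ℂ)

/-- The matrix of the orthogonal projector onto the subspace of charge `κ`. -/
def chargeProj (R : G → Matrix m m ℂ) (κ : G →* Circle) : Matrix m m ℂ :=
  Matrix.toEuclideanLin.symm
    ((chargeSector R κ).starProjection : EuclideanSpace ℂ m →ₗ[ℂ] EuclideanSpace ℂ m)

/-- A labelling by `K` of the orthonormal basis of a register recording the charge: the labels
stand for distinct charges, and every charge that occurs has a label. For a finite group, `K` may
be the set of all one-dimensional representations. -/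
structure ChargeRegister (R : G → Matrix m m ℂ) (K : Type) where
  charge : K → (G →* Circle)
  injective : Function.Injective charge
  complete : ∀ χ : G →* Circle, chargeSector R χ ≠ ⊥ → χ ∈ Set.range charge

/-- Only finitely many charges occur, so a finite register always exists. -/
theorem exists_chargeRegister (R : G → Matrix m m ℂ) :
    ∃ n : ℕ, Nonempty (ChargeRegister R (Fin n)) := by
  let s : Set (G →* Circle) := {χ | chargeSector R χ ≠ ⊥}
  let W : Submodule ℂ (G → ℂ) :=
    Submodule.span ℂ (Set.range fun q : m × m => fun g => R g q.1 q.2)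
  have hW : Module.Finite ℂ W := Module.Finite.span_of_finite ℂ (Set.finite_range _)
  have hmem : ∀ χ : s, (fun g => ((χ : G →* Circle) g : ℂ)) ∈ W := by
    rintro ⟨χ, hχ⟩
    obtain ⟨v, hv, hv0⟩ := Submodule.exists_mem_ne_zero_of_ne_bot hχ
    obtain ⟨i, hi⟩ : ∃ i, v i ≠ 0 := by
      by_contra! h
      exact hv0 (by ext i; simpa using h i)
    have hval : (fun g => (χ g : ℂ)) = ∑ j, (v j / v i) • (fun g => R g i j) := by
      funext g
      have h1 := (Submodule.mem_iInf _).1 hv g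
      rw [Module.End.mem_eigenspace_iff] at h1
      have h2 := congrArg (fun w : EuclideanSpace ℂ m => w i) h1
      simp only [Matrix.toLpLin_apply, PiLp.smul_apply, smul_eq_mul, Matrix.mulVec,
        dotProduct] at h2
      simp only [Finset.sum_apply, Pi.smul_apply, smul_eq_mul]
      rw [eq_comm, ← mul_left_inj' hi, ← h2, Finset.sum_mul]
      refine Finset.sum_congr rfl fun j _ => ?_
      field_simp
    change (fun g => (χ g : ℂ)) ∈ W
    rw [hval]
    exact Submodule.sum_mem _ fun j _ =>
      Submodule.smul_mem _ _ (Submodule.subset_span ⟨(i, j), rfl⟩)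
  have hinj : Function.Injective fun χ : s => Circle.coeHom.comp (χ : G →* Circle) := by
    intro χ χ' h
    apply Subtype.ext
    ext g
    exact congrArg (fun f : G →* ℂ => f g) h
  have hli := (linearIndependent_monoidHom G ℂ).comp _ hinj
  have hli' : LinearIndependent ℂ
      (fun χ : s => (⟨fun g => ((χ : G →* Circle) g : ℂ), hmem χ⟩ : W)) :=
    LinearIndependent.of_comp W.subtype hli
  have hfin : Finite s := hli'.finite
  refine ⟨Nat.card s, ⟨⟨fun k => ((Finite.equivFin s).symm k : G →* Circle), ?_, ?_⟩⟩⟩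
  · exact Subtype.val_injective.comp (Finite.equivFin s).symm.injective
  · intro χ hχ
    exact ⟨Finite.equivFin s ⟨χ, hχ⟩,
      congrArg Subtype.val ((Finite.equivFin s).symm_apply_apply ⟨χ, hχ⟩)⟩

end Charge

/-! ### Rings of sites -/

section Lattice

variable {ι : Type} [Fintype ι] [DecidableEq ι] {m n : Type} [Fintype m] [DecidableEq m]

/-- `M^{⊗ι}`. -/
def tensorPow (ι : Type) [Fintype ι] (M : Matrix m n ℂ) : Matrix (ι → m) (ι → n) ℂ :=
  Matrix.of fun x y => ∏ i, M (x i) (y i)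

/-- The operator acting as `M` on each site of `C` and trivially on the other sites. -/
def regionOp (C : Finset ι) (M : Matrix m m ℂ) : Matrix (ι → m) (ι → m) ℂ :=
  Matrix.of fun x y => ∏ i, (if i ∈ C then M else 1) (x i) (y i)

/-- The configuration equal to `x` on `A`, to `y` on `B`, and to `z` elsewhere. -/
def glue (A B : Finset ι) (x : A → m) (y : B → m) (z : {i // i ∉ A ∪ B} → m) : ι → m :=
  fun i => if hA : i ∈ A then x ⟨i, hA⟩ else if hB : i ∈ B then y ⟨i, hB⟩ else
    z ⟨i, by simp [hA, hB]⟩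

/-- The partial trace over all sites except those in `A` and `B`. -/
def reduceAB (A B : Finset ι) (ρ : Matrix (ι → m) (ι → m) ℂ) :
    Matrix ((A → m) × (B → m)) ((A → m) × (B → m)) ℂ :=
  Matrix.of fun u v => ∑ z : {i // i ∉ A ∪ B} → m,
    ρ (glue A B u.1 u.2 z) (glue A B v.1 v.2 z)

variable {G : Type*} [CommGroup G] {K : Type} [DecidableEq K]

/-- `Ω^{(AB|C)}(ρ) = ∑ κ, |κ⟩⟨κ| ⊗ tr_{complement of AB}(Π_κ^{(C)} ρ)`, with the charge
register as first tensor factor; `U` is the on-site representation. -/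
def sptOmega (U : G →* Matrix.unitaryGroup m ℂ) (A B C : Finset ι)
    (reg : ChargeRegister (fun g => regionOp C (U g : Matrix m m ℂ)) K)
    (ρ : Matrix (ι → m) (ι → m) ℂ) :
    Matrix (K × (A → m) × (B → m)) (K × (A → m) × (B → m)) ℂ :=
  Matrix.of fun u v => if u.1 = v.1 then
    reduceAB A B
      (chargeProj (fun g => regionOp C (U g : Matrix m m ℂ)) (reg.charge u.1) * ρ) u.2 v.2
    else 0

/-- A state of register, `A` and `B` as a bipartite state for the partition `A K | B`. -/
def registerWithAlice {α β : Type} (ρ : Matrix (K × α × β) (K × α × β) ℂ) :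
    Matrix ((K × α) × β) ((K × α) × β) ℂ :=
  ρ.submatrix (fun u => (u.1.1, u.1.2, u.2)) (fun u => (u.1.1, u.1.2, u.2))

/-- A state of register, `A` and `B` as a bipartite state for the partition `A | K B`. -/
def registerWithBob {α β : Type} (ρ : Matrix (K × α × β) (K × α × β) ℂ) :
    Matrix (α × (K × β)) (α × (K × β)) ℂ :=
  ρ.submatrix (fun u => (u.2.1, u.1, u.2.2)) (fun u => (u.2.1, u.1, u.2.2))

end Lattice

/-! ### Fixed-point matrix product states -/

section FixedPoint

variable {D p : ℕ}

/-- `|λ⟩ = ∑ k, λ_k |k⟩|k⟩`. -/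
def bondVec (lam : Fin D → ℝ) : Fin D × Fin D → ℂ :=
  fun q => if q.1 = q.2 then (lam q.1 : ℂ) else 0

/-- `|λ⟩^{⊗N}` on a ring of `N` sites, each consisting of a left and a right virtual site; the
right virtual site of `i` and the left virtual site of `i + 1` are in the state `|λ⟩`. -/
def bondState (N : ℕ) [NeZero N] (lam : Fin D → ℝ) : (ZMod N → Fin D × Fin D) → ℂ :=
  fun v => ∏ i, bondVec lam ((v i).2, (v (i + 1)).1)

/-- `|Ψ⟩ = S^{⊗N} |λ⟩^{⊗N}`. -/
def fixedPointState (N : ℕ) [NeZero N] (S : Matrix (Fin p) (Fin D × Fin D) ℂ)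
    (lam : Fin D → ℝ) : (ZMod N → Fin p) → ℂ :=
  tensorPow (ZMod N) S *ᵥ bondState N lam

/-- `|ψ⟩⟨ψ|`. -/
def pureState {m : Type} (ψ : m → ℂ) : Matrix m m ℂ := Matrix.vecMulVec ψ (star ψ)

/-- The block of `n` consecutive sites of the ring starting at `s`. -/
def arc {N : ℕ} (s : ZMod N) (n : ℕ) : Finset (ZMod N) :=
  (Finset.range n).image fun i : ℕ => s + (i : ZMod N)

/-- `V` is a virtual projective representation, with factor system `ω`, of the on-site symmetry
`U`: `U(g) S = χ(g) S [V(g) ⊗ V(g)^*]` and `[V(g)^* ⊗ V(g)] |λ⟩ = |λ⟩`. The one-dimensional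
representation `χ`, a uniform charge per site, is often normalized to `χ = 1`. -/
structure IsVirtualRep {G : Type*} [CommGroup G] (U : G →* Matrix.unitaryGroup (Fin p) ℂ)
    (S : Matrix (Fin p) (Fin D × Fin D) ℂ) (lam : Fin D → ℝ) (χ : G →* Circle)
    (ω : G → G → Circle) (V : G → Matrix.unitaryGroup (Fin D) ℂ) : Prop where
  projRep : IsProjRep ω V
  intertwine : ∀ g, (U g : Matrix (Fin p) (Fin p) ℂ) * S
    = (χ g : ℂ) • (S * ((V g : Matrix (Fin D) (Fin D) ℂ)
        ⊗ₖ ((V g : Matrix (Fin D) (Fin D) ℂ).map star)))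
  bond_invariant : ∀ g, (((V g : Matrix (Fin D) (Fin D) ℂ).map star)
    ⊗ₖ (V g : Matrix (Fin D) (Fin D) ℂ)) *ᵥ bondVec lam = bondVec lam

end FixedPoint

end SPTEnt

end

/-!
The state `Ψ` is a matrix product state whose site matrices `legMatrix S q * bondMatrix lam` span all
matrices, and whose block tensors are isometries from the two outer virtual sites
(`sum_star_blockTensor`).

*Existence of a virtual representation.* By the symmetry, `S` and `U(g) S` define the same state.
Contracting with the tensor of the complement of a block shows that their block tensors are related
by linear maps. For blocks of one and two sites this gives `f X * f Y = F (X * Y)`, so `f` is, up to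
a factor, an automorphism of the matrix algebra, hence inner (`exists_conj_of_mul`). The isometry
property makes the conjugating matrix unitary and lets it commute with the bonds
(`exists_virtual_unitary`), and comparing `g`, `h` and `g * h` yields the multiplication law
(`exists_isVirtualRep`).

*Irreps of abelian groups with a given factor system.* If `V` and `T` have the same factor system,
`X ↦ V(g) X T(g)ᴴ` is a representation of an abelian group, so it has common eigenvectors: `V` and
`T` are intertwined up to a character (`exists_intertwiner`). With Schur's lemma this shows that all
irreps have the same dimension `d` (`irrepDims_eq_singleton`), that `V` is a sum of copies
`θ j • T`, embedded by isometries `I j` (`exists_isotypic_decomposition`), and that the adjoint action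
of `T` on `d × d` matrices is diagonal in an orthogonal basis of unitaries `O μ` with pairwise
distinct characters (`exists_adjoint_eigenbasis`).

*The state `Ω`.* The tensor of the block `C` is expanded in the matrices `I j * O μ * (I k)ᴴ`, which
are eigenvectors of the symmetry (`trace_ring_expansion`, `IsVirtualRep.sum_trace_blockTensor`). In
the component `(j, k, μ)` the blocks `A` and `B` share the maximally entangled state of two
`d`-dimensional systems, twisted by `O μ` and embedded by isometries whose ranges for different `j`
and `k`, and for different states of the outer virtual sites, are orthogonal. The partial trace
removes the coherence between different components. Given the locally measurable `j` and `k`, the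
charge in the register determines `μ`, as the characters of the `O μ` are distinct; whichever party
holds the register can announce it, and the twist is undone by a local unitary. In the other
direction, the mixture is prepared from the maximally entangled state with shared randomness
(`loccEquivalent_maxEntangled`, `loccEquivalent_register`, `loccEquivalent_sptOmega`).
-/

noncomputable section

namespace SPTEnt

/-! ### LOCC equivalence of flagged maximally entangled states -/

section LOCC

variable {α β X Y Z : Type} [Fintype α] [DecidableEq α] [Fintype β] [DecidableEq β]
  [Fintype X] [Fintype Y] [DecidableEq Y] [Fintype Z] [DecidableEq Z] {d : ℕ}

/-- Kraus operators measuring in which of the orthogonal ranges of the isometries `P y` a vector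
lies and mapping it back to `ℂ^d`. The outcomes `Sum.inr i`, needed for completeness, send the
orthogonal complement of all ranges to a fixed vector. -/
def rangeMeasurement [NeZero d] (P : Y → Matrix α (Fin d) ℂ) : Y ⊕ α → Matrix (Fin d) α ℂ
  | .inl y => (P y)ᴴ
  | .inr i => (Matrix.single 0 i 1 : Matrix (Fin d) α ℂ) * (1 - ∑ y, P y * (P y)ᴴ)

variable [NeZero d] {P : Y → Matrix α (Fin d) ℂ}

lemma rangeMeasurement_mul (hP : ∀ y y', (P y)ᴴ * P y' = if y = y' then 1 else 0) (j : Y ⊕ α)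
    (y : Y) : rangeMeasurement P j * P y = if j = Sum.inl y then 1 else 0 := by
  rcases j with y' | i
  · simp [rangeMeasurement, hP]
  · simp only [rangeMeasurement, Matrix.mul_assoc, Matrix.sub_mul, Matrix.sum_mul, hP]
    rw [Finset.sum_eq_single y (fun y' _ h => by simp [h]) (by simp)]
    simp

lemma rangeMeasurement_complete (hP : ∀ y y', (P y)ᴴ * P y' = if y = y' then 1 else 0) :
    ∑ j, (rangeMeasurement P j)ᴴ * rangeMeasurement P j = 1 := by
  have hR : (∑ y, P y * (P y)ᴴ) * (∑ y, P y * (P y)ᴴ) = ∑ y, P y * (P y)ᴴ := by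
    rw [Matrix.sum_mul]
    refine Finset.sum_congr rfl fun y _ => ?_
    rw [Matrix.mul_sum, Finset.sum_eq_single y]
    · rw [Matrix.mul_assoc, ← Matrix.mul_assoc (P y)ᴴ, hP]; simp
    · intro y' _ h
      rw [Matrix.mul_assoc, ← Matrix.mul_assoc (P y)ᴴ, hP, if_neg h.symm]; simp
    · simp
  have hone : ∑ i : α, Matrix.single i i (1 : ℂ) = 1 := by
    ext i j; simp [Matrix.sum_apply, Matrix.single_apply, Matrix.one_apply, ite_and]
  have h2 : ∀ i : α, (rangeMeasurement P (Sum.inr i))ᴴ * rangeMeasurement P (Sum.inr i)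
      = (1 - ∑ y, P y * (P y)ᴴ) * Matrix.single i i 1 * (1 - ∑ y, P y * (P y)ᴴ) := by
    intro i
    simp only [rangeMeasurement, Matrix.conjTranspose_mul, Matrix.conjTranspose_single, star_one,
      Matrix.conjTranspose_sub, Matrix.conjTranspose_one, Matrix.conjTranspose_sum,
      Matrix.conjTranspose_conjTranspose]
    rw [Matrix.mul_assoc, ← Matrix.mul_assoc (Matrix.single i 0 1), Matrix.single_mul_single_same,
      one_mul, ← Matrix.mul_assoc]
  rw [Fintype.sum_sum_type]
  simp only [h2, ← Matrix.sum_mul, ← Matrix.mul_sum, hone]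
  simp only [rangeMeasurement, Matrix.conjTranspose_conjTranspose]
  rw [Matrix.mul_one, Matrix.sub_mul, Matrix.mul_sub, Matrix.mul_sub, hR]
  simp

/-- A random mixture of maximally entangled states, living in mutually orthogonal local subspaces
which the parties can identify by measurements, and twisted by unitaries which are determined by the
joint outcome, is a maximally entangled state as far as LOCC is concerned. Measuring the label and
undoing the unitary gives one direction; sampling the label by shared randomness gives the
other. -/
theorem loccEquivalent_maxEntangled {Q : Z → Matrix β (Fin d) ℂ}
    (hP : ∀ y y', (P y)ᴴ * P y' = if y = y' then 1 else 0)
    (hQ : ∀ z z', (Q z)ᴴ * Q z' = if z = z' then 1 else 0)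
    (O : X → Matrix (Fin d) (Fin d) ℂ) (hO : ∀ x, (O x)ᴴ * O x = 1)
    (p : X → ℝ) (hp : ∀ x, 0 ≤ p x) (hsum : ∑ x, p x = 1) (f : X → Y) (g : X → Z)
    (hfg : ∀ x x', f x = f x' → g x = g x' → x = x') :
    LOCCEquivalent (∑ x, (p x : ℂ) • ((P (f x) ⊗ₖ (Q (g x) * O x)) * maxEntangled d *
      (P (f x) ⊗ₖ (Q (g x) * O x))ᴴ)) (maxEntangled d) := by
  classical
  have hO' : ∀ x, O x * (O x)ᴴ = 1 := fun x => mul_eq_one_comm.1 (hO x)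
  have hsumC : ∑ x, (p x : ℂ) = 1 := by exact_mod_cast hsum
  constructor
  · -- `W y z` undoes the unitary belonging to the outcomes `y` and `z`, if there is one.
    let W : Y → Z → Matrix (Fin d) (Fin d) ℂ := fun y z =>
      if h : ∃ x, f x = y ∧ g x = z then O h.choose else 1
    have hW : ∀ y z, W y z * (W y z)ᴴ = 1 := by
      intro y z
      by_cases h : ∃ x, f x = y ∧ g x = z
      · simp [W, h, hO']
      · simp [W, h]
    have hWx : ∀ x, W (f x) (g x) = O x := by
      intro x
      have h : ∃ x', f x' = f x ∧ g x' = g x := ⟨x, rfl, rfl⟩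
      have := hfg _ _ h.choose_spec.1 h.choose_spec.2
      simp only [W, h, dif_pos, this]
    let F : Y ⊕ α → Z ⊕ β → Matrix (Fin d) β ℂ := fun j k =>
      match j, k with
      | .inl y, .inl z => (W y z)ᴴ * (Q z)ᴴ
      | _, k => rangeMeasurement Q k
    have hF : ∀ j, ∑ k, (F j k)ᴴ * F j k = 1 := by
      intro j
      rw [← rangeMeasurement_complete hQ]
      refine Finset.sum_congr rfl fun k _ => ?_
      rcases j with y | i <;> rcases k with z | i'
      · simp only [F, rangeMeasurement, Matrix.conjTranspose_mul,
          Matrix.conjTranspose_conjTranspose]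
        rw [Matrix.mul_assoc, ← Matrix.mul_assoc (W y z), hW, Matrix.one_mul]
      all_goals rfl
    refine ⟨_, IsLOCC.alice (fun _ => Fin d) (rangeMeasurement P) (rangeMeasurement_complete hP) _
      (fun j => IsLOCC.bob (fun _ => Fin d) (F j) (hF j) _ fun k => IsLOCC.done), ?_⟩
    have key : ∀ x j k, ((1 : Matrix (Fin d) (Fin d) ℂ) ⊗ₖ F j k) *
        ((rangeMeasurement P j ⊗ₖ (1 : Matrix β β ℂ)) * (P (f x) ⊗ₖ (Q (g x) * O x)))
        = if j = .inl (f x) ∧ k = .inl (g x) then 1 else 0 := by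
      intro x j k
      rw [← Matrix.mul_kronecker_mul, ← Matrix.mul_kronecker_mul, rangeMeasurement_mul hP]
      by_cases hj : j = .inl (f x)
      · subst hj
        rcases k with z | i
        · by_cases hz : z = g x
          · subst hz
            simp only [F, hWx, Matrix.one_mul]
            rw [Matrix.mul_assoc, ← Matrix.mul_assoc (Q (g x))ᴴ, hQ]
            simp [hO]
          · simp only [F, Matrix.one_mul]
            rw [Matrix.mul_assoc, ← Matrix.mul_assoc (Q z)ᴴ, hQ]
            simp [hz]
        · simp only [F, Matrix.one_mul]
          rw [← Matrix.mul_assoc, rangeMeasurement_mul hQ]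
          simp
      · simp [hj]
    have key2 : ∀ x j k, ((1 : Matrix (Fin d) (Fin d) ℂ) ⊗ₖ F j k) *
        ((rangeMeasurement P j ⊗ₖ (1 : Matrix β β ℂ)) *
          ((P (f x) ⊗ₖ (Q (g x) * O x)) * maxEntangled d * (P (f x) ⊗ₖ (Q (g x) * O x))ᴴ) *
          (rangeMeasurement P j ⊗ₖ (1 : Matrix β β ℂ))ᴴ) *
          ((1 : Matrix (Fin d) (Fin d) ℂ) ⊗ₖ F j k)ᴴ
        = if j = .inl (f x) ∧ k = .inl (g x) then maxEntangled d else 0 := by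
      intro x j k
      have := key x j k
      calc _ = (((1 : Matrix (Fin d) (Fin d) ℂ) ⊗ₖ F j k) *
          ((rangeMeasurement P j ⊗ₖ (1 : Matrix β β ℂ)) * (P (f x) ⊗ₖ (Q (g x) * O x)))) *
            maxEntangled d * (((1 : Matrix (Fin d) (Fin d) ℂ) ⊗ₖ F j k) *
          ((rangeMeasurement P j ⊗ₖ (1 : Matrix β β ℂ)) * (P (f x) ⊗ₖ (Q (g x) * O x))))ᴴ := by
            simp only [Matrix.conjTranspose_mul, Matrix.mul_assoc]
        _ = _ := by rw [this]; split_ifs <;> simp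
    simp only [Matrix.mul_sum, Matrix.sum_mul, Matrix.mul_smul, Matrix.smul_mul, key2]
    have h3 : ∀ j : Y ⊕ α, ∑ k : Z ⊕ β, ∑ x, (p x : ℂ) •
        (if j = .inl (f x) ∧ k = .inl (g x) then maxEntangled d else 0)
        = ∑ x, (if j = .inl (f x) then (p x : ℂ) • maxEntangled d else 0) := by
      intro j
      rw [Finset.sum_comm]
      refine Finset.sum_congr rfl fun x _ => ?_
      by_cases hj : j = .inl (f x) <;> simp [hj]
    simp only [h3]
    rw [Finset.sum_comm]
    simp only [Finset.sum_ite_eq', Finset.mem_univ, if_true]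
    rw [← Finset.sum_smul, hsumC, one_smul]
  · -- Alice samples `x`, applies `P (f x)` and announces `x`; Bob applies `Q (g x) * O x`.
    refine ⟨_, IsLOCC.alice (fun _ => α) (fun x => (Real.sqrt (p x) : ℂ) • P (f x)) ?_ _
      (fun x => IsLOCC.bob (J := Unit) (fun _ => β) (fun _ => Q (g x) * O x) ?_ _
        fun _ => IsLOCC.done), ?_⟩
    · have h : ∀ x, ((Real.sqrt (p x) : ℂ) • P (f x))ᴴ * ((Real.sqrt (p x) : ℂ) • P (f x))
          = (p x : ℂ) • (1 : Matrix (Fin d) (Fin d) ℂ) := by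
        intro x
        rw [Matrix.conjTranspose_smul, Matrix.smul_mul, Matrix.mul_smul, hP, smul_smul, if_pos rfl]
        congr 1
        rw [RCLike.star_def, Complex.conj_ofReal, ← Complex.ofReal_mul, Real.mul_self_sqrt (hp x)]
      simp only [h, ← Finset.sum_smul, hsumC, one_smul]
    · simp only [Finset.univ_unique, Finset.sum_singleton, Matrix.conjTranspose_mul]
      rw [Matrix.mul_assoc, ← Matrix.mul_assoc (Q (g x))ᴴ, hQ]
      simp [hO]
    · refine Finset.sum_congr rfl fun x _ => ?_
      have h : ((1 : Matrix α α ℂ) ⊗ₖ (Q (g x) * O x)) *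
          (((Real.sqrt (p x) : ℂ) • P (f x)) ⊗ₖ (1 : Matrix (Fin d) (Fin d) ℂ))
          = (Real.sqrt (p x) : ℂ) • (P (f x) ⊗ₖ (Q (g x) * O x)) := by
        rw [← Matrix.mul_kronecker_mul]
        simp [Matrix.smul_kronecker]
      simp only [Finset.univ_unique, Finset.sum_singleton]
      calc _ = (((1 : Matrix α α ℂ) ⊗ₖ (Q (g x) * O x)) *
          (((Real.sqrt (p x) : ℂ) • P (f x)) ⊗ₖ (1 : Matrix (Fin d) (Fin d) ℂ))) *
          maxEntangled d * (((1 : Matrix α α ℂ) ⊗ₖ (Q (g x) * O x)) *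
          (((Real.sqrt (p x) : ℂ) • P (f x)) ⊗ₖ (1 : Matrix (Fin d) (Fin d) ℂ)))ᴴ := by
            simp only [Matrix.conjTranspose_mul, Matrix.mul_assoc]
        _ = _ := by
          rw [h, Matrix.conjTranspose_smul, Matrix.smul_mul, Matrix.smul_mul, Matrix.mul_smul,
            smul_smul, RCLike.star_def, Complex.conj_ofReal, ← Complex.ofReal_mul,
            Real.mul_self_sqrt (hp x)]

end LOCC

/-! ### Projective representations of abelian groups -/

/-- A commuting family of endomorphisms has a common eigenvector in every nonzero invariant
subspace. -/
lemma exists_common_eigenvector {M ι : Type*} [AddCommGroup M] [Module ℂ M]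
    [FiniteDimensional ℂ M] (F : ι → Module.End ℂ M) (hcomm : ∀ i j v, F i (F j v) = F j (F i v))
    (H : Submodule ℂ M) (hH : H ≠ ⊥) (hinv : ∀ i, ∀ v ∈ H, F i v ∈ H) :
    ∃ v ∈ H, v ≠ 0 ∧ ∀ i, ∃ c : ℂ, F i v = c • v := by
  induction hn : Module.finrank ℂ H using Nat.strong_induction_on generalizing H with
  | _ n ih =>
    by_cases hs : ∀ i, ∃ c : ℂ, ∀ v ∈ H, F i v = c • v
    · obtain ⟨v, hv, hv0⟩ := Submodule.exists_mem_ne_zero_of_ne_bot hH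
      exact ⟨v, hv, hv0, fun i => (hs i).imp fun c hc => hc v hv⟩
    · push Not at hs
      obtain ⟨i, hi⟩ := hs
      have : Nontrivial H := Submodule.nontrivial_iff_ne_bot.2 hH
      obtain ⟨c, hc⟩ := Module.End.exists_eigenvalue ((F i).restrict (hinv i))
      obtain ⟨w, hw, hw0⟩ := hc.exists_hasEigenvector
      have hw' : F i w = c • (w : M) := by
        simpa using congrArg Subtype.val (Module.End.mem_eigenspace_iff.1 hw)
      let H' := H ⊓ Module.End.eigenspace (F i) c
      have hlt : H' < H := by
        refine lt_of_le_of_ne inf_le_left fun h => ?_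
        obtain ⟨v, hv, hne⟩ := hi c
        have : v ∈ H' := h ▸ hv
        exact hne (Module.End.mem_eigenspace_iff.1 this.2)
      have hH' : H' ≠ ⊥ := (Submodule.ne_bot_iff _).2
        ⟨w, ⟨w.2, Module.End.mem_eigenspace_iff.2 hw'⟩, fun h => hw0 (Subtype.ext h)⟩
      have hinv' : ∀ j, ∀ v ∈ H', F j v ∈ H' := by
        rintro j v ⟨hv, hv'⟩
        refine ⟨hinv j v hv, ?_⟩
        have hv'' := Module.End.mem_eigenspace_iff.1 hv'
        exact Module.End.mem_eigenspace_iff.2 (by rw [hcomm, hv'', map_smul])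
      obtain ⟨v, hv, hv0, hvF⟩ :=
        ih _ (hn ▸ Submodule.finrank_lt_finrank_of_lt hlt) H' hH' hinv' rfl
      exact ⟨v, hv.1, hv0, hvF⟩

/-- Schur's lemma. -/
lemma IsIrred.eq_smul_one {G : Type*} {d : ℕ}
    {T : G → Matrix.unitaryGroup (Fin d) ℂ} (hT : IsIrred T)
    {X : Matrix (Fin d) (Fin d) ℂ}
    (hX : ∀ g, X * (T g : Matrix (Fin d) (Fin d) ℂ) = (T g : Matrix (Fin d) (Fin d) ℂ) * X) :
    ∃ c : ℂ, X = c • 1 := by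
  have : Nonempty (Fin d) := ⟨⟨0, hT.1⟩⟩
  obtain ⟨c, hc⟩ := Module.End.exists_eigenvalue (Matrix.toLin' X)
  refine ⟨c, ?_⟩
  have hinv : ∀ g, ∀ v ∈ Module.End.eigenspace (Matrix.toLin' X) c,
      (T g : Matrix (Fin d) (Fin d) ℂ) *ᵥ v ∈ Module.End.eigenspace (Matrix.toLin' X) c := by
    intro g v hv
    rw [Module.End.mem_eigenspace_iff] at hv ⊢
    rw [Matrix.toLin'_apply] at hv ⊢
    rw [Matrix.mulVec_mulVec, hX, ← Matrix.mulVec_mulVec, hv, Matrix.mulVec_smul]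
  rcases hT.2 _ hinv with h | h
  · exact absurd h hc
  · apply Matrix.toLin'.injective
    ext1 i
    refine LinearMap.ext fun v => ?_
    have hv : Pi.single i v ∈ Module.End.eigenspace (Matrix.toLin' X) c := h ▸ trivial
    rw [Module.End.mem_eigenspace_iff] at hv
    simp [hv]

open scoped ComplexOrder in
lemma exists_smul_isometry {m k : Type*} [Fintype m] [DecidableEq k] [Nonempty k]
    {X : Matrix m k ℂ} (hX : X ≠ 0) {c : ℂ}
    (hc : Xᴴ * X = c • 1) : ∃ r : ℂ, (r • X)ᴴ * (r • X) = 1 := by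
  obtain ⟨j⟩ := ‹Nonempty k›
  have hc0 : c ≠ 0 := by
    rintro rfl
    rw [zero_smul, Matrix.conjTranspose_mul_self_eq_zero] at hc
    exact hX hc
  have h1 : c = ((∑ i, Complex.normSq (X i j) : ℝ) : ℂ) := by
    have := congrFun (congrFun hc j) j
    simp only [Matrix.mul_apply, Matrix.conjTranspose_apply, Matrix.smul_apply,
      Matrix.one_apply_eq, smul_eq_mul, mul_one] at this
    rw [← this]
    push_cast
    exact Finset.sum_congr rfl fun i _ => by
      rw [Complex.star_def, Complex.normSq_eq_conj_mul_self]
  set t : ℝ := ∑ i, Complex.normSq (X i j)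
  have ht : 0 ≤ t := Finset.sum_nonneg fun i _ => Complex.normSq_nonneg _
  refine ⟨((Real.sqrt t)⁻¹ : ℝ), ?_⟩
  rw [Matrix.conjTranspose_smul, Matrix.smul_mul, Matrix.mul_smul, hc, smul_smul, smul_smul, h1,
    Complex.star_def, Complex.conj_ofReal, ← Complex.ofReal_mul, ← Complex.ofReal_mul]
  have ht0 : t ≠ 0 := fun h => hc0 (by rw [h1, h]; simp)
  have : (Real.sqrt t)⁻¹ * (Real.sqrt t)⁻¹ * t = 1 := by
    rw [← mul_inv, Real.mul_self_sqrt ht, inv_mul_cancel₀ ht0]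
  rw [this]; simp

section Rep

open scoped ComplexOrder

variable {G : Type*} [CommGroup G] {m k : Type*} [Fintype m] [DecidableEq m] [Fintype k]
  [DecidableEq k] {d : ℕ}

/-- Projective unitary representations with factor system `ω`, on a space with an arbitrary finite
index type. -/
structure IsProjUnitary (ω : G → G → Circle) (V : G → Matrix m m ℂ) : Prop where
  unitary : ∀ g, (V g)ᴴ * V g = 1
  mul : ∀ g h, V g * V h = (ω g h : ℂ) • V (g * h)

lemma unitary_conjTranspose_mul_self (A : Matrix.unitaryGroup m ℂ) :
    (A : Matrix m m ℂ)ᴴ * (A : Matrix m m ℂ) = 1 :=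
  Matrix.UnitaryGroup.star_mul_self A

lemma IsProjRep.isProjUnitary {ω : G → G → Circle} {T : G → Matrix.unitaryGroup (Fin d) ℂ}
    (hT : IsProjRep ω T) : IsProjUnitary ω (fun g => (T g : Matrix (Fin d) (Fin d) ℂ)) :=
  ⟨fun g => unitary_conjTranspose_mul_self (T g), hT⟩

lemma IsProjUnitary.unitary' {ω : G → G → Circle} {V : G → Matrix m m ℂ}
    (hV : IsProjUnitary ω V) (g : G) : V g * (V g)ᴴ = 1 :=
  mul_eq_one_comm.1 (hV.unitary g)

lemma circle_mul_star (z : Circle) : (z : ℂ) * star (z : ℂ) = 1 := by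
  rw [Complex.star_def, Complex.mul_conj, Circle.normSq_coe]; simp

lemma circle_star_mul (z : Circle) : star (z : ℂ) * (z : ℂ) = 1 := by
  rw [mul_comm, circle_mul_star]

/-- The map `X ↦ A X B` on matrices. -/
def sandwich (A : Matrix m m ℂ) (B : Matrix k k ℂ) : Module.End ℂ (Matrix m k ℂ) where
  toFun X := A * X * B
  map_add' X Y := by rw [Matrix.mul_add, Matrix.add_mul]
  map_smul' c X := by simp

/-- The maps `X ↦ V(g) X T(g)ᴴ` form a linear representation of an abelian group, so a common
eigenvector exists: an intertwiner between `V` and the product of `T` with a linear character. It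
can be taken to be an eigenvector of a further operator `L` commuting with `V`. -/
lemma exists_intertwiner {ω : G → G → Circle} {V : G → Matrix m m ℂ} {T : G → Matrix k k ℂ}
    (hV : IsProjUnitary ω V) (hT : IsProjUnitary ω T) {L : Matrix m m ℂ}
    (hL : ∀ g, V g * L = L * V g) (H : Submodule ℂ (Matrix m k ℂ)) (hH : H ≠ ⊥)
    (hinv : ∀ g, ∀ X ∈ H, V g * X * (T g)ᴴ ∈ H) (hinvL : ∀ X ∈ H, L * X ∈ H) :
    ∃ X ∈ H, X ≠ 0 ∧ ∃ (θ : G →* Circle) (l : ℂ),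
      (∀ g, V g * X = (θ g : ℂ) • (X * T g)) ∧ L * X = l • X := by
  -- `none` stands for multiplication by `L`.
  let F : Option G → Module.End ℂ (Matrix m k ℂ) := fun o =>
    o.elim (sandwich L 1) fun g => sandwich (V g) (T g)ᴴ
  have hFmul : ∀ g h X, F (some g) (F (some h) X) = F (some (g * h)) X := by
    intro g h X
    change V g * (V h * X * (T h)ᴴ) * (T g)ᴴ = V (g * h) * X * (T (g * h))ᴴ
    calc _ = (V g * V h) * X * (T g * T h)ᴴ := by
          rw [Matrix.conjTranspose_mul]; simp only [Matrix.mul_assoc]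
      _ = _ := by
          rw [hV.mul, hT.mul, Matrix.conjTranspose_smul, Matrix.smul_mul, Matrix.smul_mul,
            Matrix.mul_smul, smul_smul, circle_mul_star, one_smul]
  have hLg : ∀ g X, F none (F (some g) X) = F (some g) (F none X) := by
    intro g X
    change L * (V g * X * (T g)ᴴ) * (1 : Matrix k k ℂ) = V g * (L * X * (1 : Matrix k k ℂ)) * (T g)ᴴ
    rw [Matrix.mul_one, Matrix.mul_one, ← Matrix.mul_assoc, ← Matrix.mul_assoc, ← hL,
      Matrix.mul_assoc (V g) L]
  have hFcomm : ∀ i j X, F i (F j X) = F j (F i X) := by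
    rintro (_ | g) (_ | h) X
    · rfl
    · exact hLg h X
    · exact (hLg g X).symm
    · rw [hFmul, hFmul, mul_comm]
  have hFinv : ∀ i, ∀ X ∈ H, F i X ∈ H := by
    rintro (_ | g) X hX
    · simpa [F, sandwich] using hinvL X hX
    · exact hinv g X hX
  obtain ⟨X, hX, hX0, hXF⟩ := exists_common_eigenvector F hFcomm H hH hFinv
  refine ⟨X, hX, hX0, ?_⟩
  obtain ⟨l, hl⟩ := hXF none
  choose c hc using fun g => hXF (some g)
  have hc' : ∀ g, V g * X * (T g)ᴴ = c g • X := hc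
  have hnorm : ∀ g, star (c g) * c g = 1 := by
    intro g
    have h1 : (V g * X * (T g)ᴴ)ᴴ * (V g * X * (T g)ᴴ) = T g * (Xᴴ * X) * (T g)ᴴ := by
      calc _ = T g * (Xᴴ * ((V g)ᴴ * V g) * X) * (T g)ᴴ := by
            simp only [Matrix.conjTranspose_mul, Matrix.conjTranspose_conjTranspose,
              Matrix.mul_assoc]
        _ = _ := by rw [hV.unitary, Matrix.mul_one]
    rw [hc', Matrix.conjTranspose_smul, Matrix.smul_mul, Matrix.mul_smul, smul_smul] at h1
    have h2 := congrArg Matrix.trace h1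
    rw [Matrix.trace_mul_comm, ← Matrix.mul_assoc, hT.unitary, Matrix.one_mul,
      Matrix.trace_smul, smul_eq_mul] at h2
    have h3 : (Xᴴ * X).trace ≠ 0 := by
      rwa [Ne, Matrix.trace_conjTranspose_mul_self_eq_zero_iff]
    exact mul_right_cancel₀ h3 (by rw [h2, one_mul])
  have hmul : ∀ g h, c (g * h) = c g * c h := by
    intro g h
    have := hFmul g h X
    rw [hc, map_smul, hc, hc, smul_smul] at this
    have h0 := sub_eq_zero.2 this
    rw [← sub_smul, smul_eq_zero, or_iff_left hX0, sub_eq_zero] at h0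
    rw [← h0, mul_comm]
  have hcircle : ∀ g, c g ∈ Submonoid.unitSphere ℂ := by
    intro g
    refine mem_sphere_zero_iff_norm.2 ?_
    have := hnorm g
    rw [Complex.star_def, ← Complex.normSq_eq_conj_mul_self] at this
    have h' : Complex.normSq (c g) = 1 := by exact_mod_cast this
    rw [Complex.normSq_eq_norm_sq] at h'
    nlinarith [norm_nonneg (c g)]
  refine ⟨MonoidHom.mk' (fun g => (⟨c g, hcircle g⟩ : Circle)) fun g h => ?_, l, fun g => ?_, ?_⟩
  · exact Circle.ext (hmul g h)
  · change V g * X = c g • (X * T g)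
    rw [← Matrix.smul_mul, ← hc', Matrix.mul_assoc _ _ (T g), hT.unitary, Matrix.mul_one]
  · simpa [F, sandwich] using hl

/-- The Gram matrix of two intertwiners with the same character commutes with `T`; it is a scalar by
Schur's lemma if `T` is irreducible. -/
lemma gram_commute {ω : G → G → Circle} {V : G → Matrix m m ℂ} {T : G → Matrix k k ℂ}
    (hV : IsProjUnitary ω V) (hT : IsProjUnitary ω T) {X Y : Matrix m k ℂ} {θ : G →* Circle}
    (hX : ∀ g, V g * X = (θ g : ℂ) • (X * T g)) (hY : ∀ g, V g * Y = (θ g : ℂ) • (Y * T g))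
    (g : G) : Xᴴ * Y * T g = T g * (Xᴴ * Y) := by
  have h1 : (T g)ᴴ * (Xᴴ * Y) * T g = Xᴴ * Y := by
    have h2 : (V g * X)ᴴ * (V g * Y) = Xᴴ * Y := by
      rw [Matrix.conjTranspose_mul, Matrix.mul_assoc, ← Matrix.mul_assoc (V g)ᴴ, hV.unitary,
        Matrix.one_mul]
    rw [hX, hY, Matrix.conjTranspose_smul, Matrix.smul_mul, Matrix.mul_smul, smul_smul,
      circle_star_mul, one_smul, Matrix.conjTranspose_mul] at h2
    simpa only [Matrix.mul_assoc] using h2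
  calc _ = (T g * (T g)ᴴ) * (Xᴴ * Y * T g) := by rw [hT.unitary', Matrix.one_mul]
    _ = T g * ((T g)ᴴ * (Xᴴ * Y) * T g) := by simp only [Matrix.mul_assoc]
    _ = _ := by rw [h1]

lemma IsProjUnitary.mul_conjTranspose {ω : G → G → Circle} {V : G → Matrix m m ℂ}
    {T : G → Matrix k k ℂ} (hV : IsProjUnitary ω V) (hT : IsProjUnitary ω T) {X : Matrix m k ℂ}
    {g : G} {z : ℂ} (hX : V g * X = z • (X * T g)) : T g * Xᴴ = star z • (Xᴴ * V g) := by
  have h1 : (V g)ᴴ * (V g * X) * (T g)ᴴ = z • ((V g)ᴴ * X) := by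
    rw [hX, Matrix.mul_smul, Matrix.smul_mul, Matrix.mul_assoc, Matrix.mul_assoc X, hT.unitary',
      Matrix.mul_one]
  rw [← Matrix.mul_assoc, hV.unitary, Matrix.one_mul] at h1
  have h2 := congrArg Matrix.conjTranspose h1
  rwa [Matrix.conjTranspose_mul, Matrix.conjTranspose_conjTranspose, Matrix.conjTranspose_smul,
    Matrix.conjTranspose_mul, Matrix.conjTranspose_conjTranspose] at h2

/-- Two irreps with the same factor system have the same dimension: a nonzero intertwiner `X` (up
to a character) satisfies `XᴴX ∝ 1` and `XXᴴ ∝ 1` by Schur's lemma. -/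
lemma dim_eq_of_irred {ω : G → G → Circle} {n : ℕ} {T : G → Matrix.unitaryGroup (Fin d) ℂ}
    {T' : G → Matrix.unitaryGroup (Fin n) ℂ} (hT : IsProjRep ω T) (hTi : IsIrred T)
    (hT' : IsProjRep ω T') (hTi' : IsIrred T') : d = n := by
  have h1 := hT.isProjUnitary
  have h2 := hT'.isProjUnitary
  have hd : Nonempty (Fin d) := ⟨⟨0, hTi.1⟩⟩
  have hn : Nonempty (Fin n) := ⟨⟨0, hTi'.1⟩⟩
  obtain ⟨X, -, hX0, θ, -, hX, -⟩ := exists_intertwiner h1 h2 (L := 1) (by simp) ⊤ top_ne_bot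
    (by simp) (by simp)
  have hX' : ∀ g, (T' g : Matrix (Fin n) (Fin n) ℂ) * Xᴴ
      = ((θ⁻¹ g : Circle) : ℂ) • (Xᴴ * (T g : Matrix (Fin d) (Fin d) ℂ)) := by
    intro g
    rw [h1.mul_conjTranspose h2 (hX g), MonoidHom.inv_apply, Circle.coe_inv_eq_conj,
      Complex.star_def]
  obtain ⟨a, ha⟩ := hTi'.eq_smul_one (gram_commute h1 h2 hX hX)
  obtain ⟨b, hb⟩ := hTi.eq_smul_one (gram_commute h2 h1 hX' hX')
  rw [Matrix.conjTranspose_conjTranspose] at hb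
  have ha0 : a ≠ 0 := by
    rintro rfl
    rw [zero_smul, Matrix.conjTranspose_mul_self_eq_zero] at ha
    exact hX0 ha
  have hab : a = b := by
    have h3 : X * Xᴴ * X = a • X := by rw [Matrix.mul_assoc, ha, Matrix.mul_smul, Matrix.mul_one]
    rw [hb, Matrix.smul_mul, Matrix.one_mul] at h3
    have h0 := sub_eq_zero.2 h3
    rw [← sub_smul, smul_eq_zero, or_iff_left hX0, sub_eq_zero] at h0
    exact h0.symm
  have htr : (Xᴴ * X).trace = (X * Xᴴ).trace := Matrix.trace_mul_comm _ _
  rw [ha, hb, ← hab, Matrix.trace_smul, Matrix.trace_smul, Matrix.trace_one, Matrix.trace_one,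
    smul_eq_mul, smul_eq_mul, Fintype.card_fin, Fintype.card_fin] at htr
  exact_mod_cast (mul_left_cancel₀ ha0 htr).symm

/-- A projective representation of minimal positive dimension is irreducible. -/
lemma exists_irred {ω : G → G → Circle} (hd : 0 < d) {V : G → Matrix.unitaryGroup (Fin d) ℂ}
    (hV : IsProjRep ω V) :
    ∃ (n : ℕ) (T : G → Matrix.unitaryGroup (Fin n) ℂ), IsProjRep ω T ∧ IsIrred T := by
  classical
  have hex : ∃ n, 0 < n ∧ ∃ T : G → Matrix.unitaryGroup (Fin n) ℂ, IsProjRep ω T := ⟨d, hd, V, hV⟩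
  obtain ⟨n, ⟨hn, T, hT⟩, hmin⟩ : ∃ n, (0 < n ∧ ∃ T : G → Matrix.unitaryGroup (Fin n) ℂ,
      IsProjRep ω T) ∧ ∀ r < n, ¬ (0 < r ∧ ∃ T : G → Matrix.unitaryGroup (Fin r) ℂ,
      IsProjRep ω T) := ⟨_, Nat.find_spec hex, fun _ => Nat.find_min hex⟩
  refine ⟨n, T, hT, hn, fun W hW => ?_⟩
  by_contra! hcon
  obtain ⟨hbot, htop⟩ := hcon
  -- The columns of `J` form an orthonormal basis of the invariant subspace `W`; the compression
  -- `Jᴴ T(g) J` is a projective representation of smaller dimension.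
  let e : EuclideanSpace ℂ (Fin n) ≃ₗ[ℂ] (Fin n → ℂ) := WithLp.linearEquiv 2 ℂ (Fin n → ℂ)
  let W' : Submodule ℂ (EuclideanSpace ℂ (Fin n)) := W.map e.symm.toLinearMap
  have hfin : Module.finrank ℂ W' = Module.finrank ℂ W := LinearEquiv.finrank_map_eq e.symm W
  let b := stdOrthonormalBasis ℂ W'
  set r := Module.finrank ℂ W' with hr
  have hr0 : 0 < r := by
    rw [hfin, Module.finrank_pos_iff]
    exact Submodule.nontrivial_iff_ne_bot.2 hbot
  have hrn : r < n := by
    have := Submodule.finrank_lt htop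
    rw [hfin]
    simpa using this
  let J : Matrix (Fin n) (Fin r) ℂ := Matrix.of fun i j => (b j : EuclideanSpace ℂ (Fin n)) i
  have hJ : Jᴴ * J = 1 := by
    ext i j
    have h := (orthonormal_iff_ite.1 b.orthonormal) i j
    rw [Submodule.coe_inner, EuclideanSpace.inner_eq_star_dotProduct] at h
    simp only [Matrix.mul_apply, Matrix.conjTranspose_apply, Matrix.one_apply, ← h, J,
      Matrix.of_apply, dotProduct, Pi.star_apply]
    exact Finset.sum_congr rfl fun _ _ => mul_comm _ _
  have hJW : ∀ j, J.col j ∈ W := by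
    intro j
    obtain ⟨w, hw, hwb⟩ := (b j).2
    have : J.col j = w := by
      ext i
      simp only [J, Matrix.col_apply, Matrix.of_apply, ← hwb]
      rfl
    rw [this]; exact hw
  have hproj : ∀ w ∈ W, J *ᵥ (Jᴴ *ᵥ w) = w := by
    intro w hw
    have hw' : e.symm w ∈ W' := ⟨w, hw, rfl⟩
    have h := congrArg Subtype.val (b.sum_repr' ⟨e.symm w, hw'⟩)
    ext i
    have h2 := congrArg (fun v : EuclideanSpace ℂ (Fin n) => v i) h
    simp only [Submodule.coe_sum, Submodule.coe_smul, Submodule.coe_inner,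
      EuclideanSpace.inner_eq_star_dotProduct, WithLp.ofLp_sum, WithLp.ofLp_smul,
      Finset.sum_apply, Pi.smul_apply, smul_eq_mul] at h2
    refine Eq.trans ?_ h2
    simp only [Matrix.mulVec, dotProduct, Matrix.conjTranspose_apply, J, Matrix.of_apply]
    refine Finset.sum_congr rfl fun j _ => ?_
    rw [mul_comm]
    congr 1
    exact Finset.sum_congr rfl fun _ _ => mul_comm _ _
  have hprojT : ∀ g, J * (Jᴴ * ((T g : Matrix (Fin n) (Fin n) ℂ) * J))
      = (T g : Matrix (Fin n) (Fin n) ℂ) * J := by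
    intro g
    ext i j
    have h := congrFun (hproj _ (hW g _ (hJW j))) i
    rw [Matrix.mulVec_mulVec] at h
    rw [← Matrix.mul_assoc]
    simpa [Matrix.mul_apply, Matrix.mulVec, dotProduct] using h
  have hTu := hT.isProjUnitary
  let T' : G → Matrix.unitaryGroup (Fin r) ℂ := fun g =>
    ⟨Jᴴ * ((T g : Matrix (Fin n) (Fin n) ℂ) * J), by
      rw [Matrix.mem_unitaryGroup_iff', Matrix.star_eq_conjTranspose, Matrix.conjTranspose_mul,
        Matrix.conjTranspose_conjTranspose, Matrix.mul_assoc, hprojT, Matrix.conjTranspose_mul,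
        Matrix.mul_assoc, ← Matrix.mul_assoc (T g : Matrix (Fin n) (Fin n) ℂ)ᴴ, hTu.unitary,
        Matrix.one_mul, hJ]⟩
  refine hmin r hrn ⟨hr0, T', fun g h => ?_⟩
  change Jᴴ * ((T g : Matrix (Fin n) (Fin n) ℂ) * J) * (Jᴴ * ((T h : Matrix (Fin n) (Fin n) ℂ) * J))
    = (ω g h : ℂ) • (Jᴴ * ((T (g * h) : Matrix (Fin n) (Fin n) ℂ) * J))
  rw [Matrix.mul_assoc, Matrix.mul_assoc, hprojT,
    ← Matrix.mul_assoc (T g : Matrix (Fin n) (Fin n) ℂ), hT, Matrix.smul_mul, Matrix.mul_smul]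

/-- Gauge transformations do not affect irreducibility, so the dimensions of irreps depend only on
the class of the factor system. -/
lemma irrepDims_eq_singleton {ω : G → G → Circle} {T : G → Matrix.unitaryGroup (Fin d) ℂ}
    (hT : IsProjRep ω T) (hTi : IsIrred T) : irrepDims ω = {d} := by
  ext n
  rw [Set.mem_singleton_iff]
  constructor
  · rintro ⟨ω', ⟨θ, hθ⟩, T', hT', hn, hTi'⟩
    let T'' : G → Matrix.unitaryGroup (Fin n) ℂ := fun g =>
      ⟨((θ g)⁻¹ : Circle) • (T' g : Matrix (Fin n) (Fin n) ℂ), by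
        have h := unitary_conjTranspose_mul_self (T' g)
        rw [Matrix.mem_unitaryGroup_iff', Matrix.star_eq_conjTranspose, Circle.smul_def,
          Matrix.conjTranspose_smul, Matrix.smul_mul, Matrix.mul_smul, smul_smul, h,
          circle_star_mul, one_smul]⟩
    have hT''c : ∀ g, (T'' g : Matrix (Fin n) (Fin n) ℂ)
        = (((θ g)⁻¹ : Circle) : ℂ) • (T' g : Matrix (Fin n) (Fin n) ℂ) := fun g => rfl
    refine (dim_eq_of_irred hT hTi (T' := T'') ?_ ⟨hn, fun W hW => hTi' W fun g v hv => ?_⟩).symm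
    · intro g h
      rw [hT''c, hT''c, hT''c, Matrix.smul_mul, Matrix.mul_smul, hT', smul_smul, smul_smul,
        smul_smul, hθ]
      congr 1
      have h0 : (θ (g * h) : ℂ) ≠ 0 := Circle.coe_ne_zero _
      push_cast
      field_simp
    · have := W.smul_mem (θ g : ℂ) (hW g v hv)
      rw [hT''c, Matrix.smul_mulVec, smul_smul] at this
      simpa using this
  · rintro rfl
    exact ⟨ω, ⟨1, fun g h => by simp⟩, T, hT, hTi⟩

end Rep

/-! ### Decomposition into copies of one irrep -/

lemma isIrred_one {G : Type*} : IsIrred (fun _ : G => (1 : Matrix.unitaryGroup (Fin 1) ℂ)) := by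
  refine ⟨one_pos, fun W _ => ?_⟩
  have : IsSimpleModule ℂ (Fin 1 → ℂ) := isSimpleModule_iff_finrank_eq_one.2 (by simp)
  exact eq_bot_or_eq_top W

section Decomposition

variable {m : Type*} [Fintype m] [DecidableEq m] {d : ℕ}

open scoped ComplexOrder in
lemma card_le_of_orthonormal_isometries (hd : 0 < d) {n : ℕ} {I : Fin n → Matrix m (Fin d) ℂ}
    (hI : ∀ j j', (I j)ᴴ * I j' = if j = j' then 1 else 0) : n ≤ Fintype.card m := by
  set R : Matrix m m ℂ := ∑ j, I j * (I j)ᴴ with hR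
  have hRI : ∀ j, R * I j = I j := by
    intro j
    rw [hR, Matrix.sum_mul, Finset.sum_eq_single j]
    · rw [Matrix.mul_assoc, hI, if_pos rfl, Matrix.mul_one]
    · intro j' _ h
      rw [Matrix.mul_assoc, hI, if_neg h, Matrix.mul_zero]
    · simp
  have hRR : R * R = R := by
    conv_lhs => rw [hR, Matrix.mul_sum]
    simp only [← Matrix.mul_assoc, ← hR, hRI]
  have hRh : Rᴴ = R := by simp [hR, Matrix.conjTranspose_sum]
  have hps := (Matrix.posSemidef_conjTranspose_mul_self (1 - R)).trace_nonneg
  have h1 : (1 - R)ᴴ * (1 - R) = 1 - R := by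
    rw [Matrix.conjTranspose_sub, Matrix.conjTranspose_one, hRh, Matrix.sub_mul, Matrix.mul_sub,
      Matrix.mul_sub, hRR]
    simp
  have h2 : R.trace = (n * d : ℕ) := by
    rw [hR, Matrix.trace_sum]
    simp only [Matrix.trace_mul_comm (I _), hI, if_true, Matrix.trace_one, Fintype.card_fin]
    simp
  rw [h1, Matrix.trace_sub, Matrix.trace_one, h2, sub_nonneg] at hps
  have h3 : n * d ≤ Fintype.card m := by exact_mod_cast hps
  nlinarith

variable {G : Type*} [CommGroup G]

/-- A projective unitary representation `V` of an abelian group decomposes into copies of any single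
irrep `T` with the same factor system, up to multiplication of `T` with linear characters `θ j`.
The embeddings `I j` of the copies can be chosen as eigenvectors of a Hermitian operator `L`
commuting with `V`. As long as the copies do not exhaust the space, `exists_intertwiner` on their
orthogonal complement provides a further one. -/
theorem exists_isotypic_decomposition {ω : G → G → Circle} {V : G → Matrix m m ℂ}
    {T : G → Matrix.unitaryGroup (Fin d) ℂ} (hV : IsProjUnitary ω V) (hT : IsProjRep ω T)
    (hTi : IsIrred T) {L : Matrix m m ℂ} (hLh : Lᴴ = L) (hL : ∀ g, V g * L = L * V g) :
    ∃ (n : ℕ) (I : Fin n → Matrix m (Fin d) ℂ) (θ : Fin n → (G →* Circle)) (l : Fin n → ℂ),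
      (∀ j j', (I j)ᴴ * I j' = if j = j' then 1 else 0) ∧ ∑ j, I j * (I j)ᴴ = 1 ∧
      (∀ j g, V g * I j = (θ j g : ℂ) • (I j * (T g : Matrix (Fin d) (Fin d) ℂ))) ∧
      ∀ j, L * I j = l j • I j := by
  have hTu := hT.isProjUnitary
  have hd : Nonempty (Fin d) := ⟨⟨0, hTi.1⟩⟩
  by_contra hcon
  -- Without a complete decomposition, arbitrarily many mutually orthogonal copies exist.
  have hall : ∀ n : ℕ, ∃ (I : Fin n → Matrix m (Fin d) ℂ) (θ : Fin n → (G →* Circle))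
      (l : Fin n → ℂ), (∀ j j', (I j)ᴴ * I j' = if j = j' then 1 else 0) ∧
      (∀ j g, V g * I j = (θ j g : ℂ) • (I j * (T g : Matrix (Fin d) (Fin d) ℂ))) ∧
      ∀ j, L * I j = l j • I j := by
    intro n
    induction n with
    | zero => exact ⟨fun _ => 0, fun _ => 1, fun _ => 0, fun j => j.elim0, fun j => j.elim0,
        fun j => j.elim0⟩
    | succ n ih =>
      obtain ⟨I, θ, l, hI, hIV, hIL⟩ := ih
      have hne : (1 : Matrix m m ℂ) - ∑ j, I j * (I j)ᴴ ≠ 0 := fun h =>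
        hcon ⟨n, I, θ, l, hI, (sub_eq_zero.1 h).symm, hIV, hIL⟩
      have hIR : ∀ j, (I j)ᴴ * (1 - ∑ j, I j * (I j)ᴴ) = 0 := by
        intro j
        rw [Matrix.mul_sub, Matrix.mul_sum, Finset.sum_eq_single j]
        · rw [← Matrix.mul_assoc, hI, if_pos rfl, Matrix.one_mul, Matrix.mul_one, sub_self]
        · intro j' _ h
          rw [← Matrix.mul_assoc, hI, if_neg h.symm, Matrix.zero_mul]
        · simp
      let H : Submodule ℂ (Matrix m (Fin d) ℂ) :=
        { carrier := {X | ∀ j, (I j)ᴴ * X = 0}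
          add_mem' := fun hX hY j => by rw [Matrix.mul_add, hX j, hY j, add_zero]
          zero_mem' := fun j => Matrix.mul_zero _
          smul_mem' := fun c X hX j => by rw [Matrix.mul_smul, hX j, smul_zero] }
      have hH : H ≠ ⊥ := by
        obtain ⟨i, i', hii⟩ : ∃ i i', ((1 : Matrix m m ℂ) - ∑ j, I j * (I j)ᴴ) i i' ≠ 0 := by
          by_contra! h
          exact hne (Matrix.ext h)
        obtain ⟨k⟩ := hd
        refine (Submodule.ne_bot_iff _).2
          ⟨(1 - ∑ j, I j * (I j)ᴴ) * (Matrix.single i' k 1 : Matrix m (Fin d) ℂ), fun j => ?_,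
            fun h => hii ?_⟩
        · rw [← Matrix.mul_assoc, hIR, Matrix.zero_mul]
        · have := congrFun (congrFun h i) k
          rwa [Matrix.mul_single_apply_same, mul_one, Matrix.zero_apply] at this
      have hVI : ∀ j g, (I j)ᴴ * V g
          = (θ j g : ℂ) • ((T g : Matrix (Fin d) (Fin d) ℂ) * (I j)ᴴ) := by
        intro j g
        rw [hV.mul_conjTranspose hTu (hIV j g), smul_smul, circle_mul_star, one_smul]
      have hinv : ∀ g, ∀ X ∈ H, V g * X * (T g : Matrix (Fin d) (Fin d) ℂ)ᴴ ∈ H := by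
        intro g X hX j
        rw [← Matrix.mul_assoc, ← Matrix.mul_assoc, hVI, Matrix.smul_mul, Matrix.mul_assoc _ _ X,
          hX j]
        simp
      have hinvL : ∀ X ∈ H, L * X ∈ H := by
        intro X hX j
        have h := congrArg Matrix.conjTranspose (hIL j)
        rw [Matrix.conjTranspose_mul, hLh, Matrix.conjTranspose_smul] at h
        rw [← Matrix.mul_assoc, h, Matrix.smul_mul, hX j, smul_zero]
      obtain ⟨X, hXH, hX0, θ', l', hX, hXL⟩ := exists_intertwiner hV hTu hL H hH hinv hinvL
      obtain ⟨c, hc⟩ := hTi.eq_smul_one (gram_commute hV hTu hX hX)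
      obtain ⟨r, hr⟩ := exists_smul_isometry hX0 hc
      have hIX : ∀ j, (I j)ᴴ * (r • X) = 0 := fun j => by
        rw [Matrix.mul_smul, hXH j, smul_zero]
      have hXI : ∀ j, (r • X)ᴴ * I j = 0 := fun j => by
        have := congrArg Matrix.conjTranspose (hIX j)
        rwa [Matrix.conjTranspose_mul, Matrix.conjTranspose_conjTranspose,
          Matrix.conjTranspose_zero] at this
      refine ⟨Fin.cons (r • X) I, Fin.cons θ' θ, Fin.cons l' l, ?_, ?_, ?_⟩
      · intro j j'
        refine Fin.cases ?_ (fun j => ?_) j <;> refine Fin.cases ?_ (fun j' => ?_) j'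
        · simpa using hr
        · simpa [Fin.succ_ne_zero, (Fin.succ_ne_zero _).symm] using hXI j'
        · simpa [Fin.succ_ne_zero] using hIX j
        · simpa using hI j j'
      · intro j g
        refine Fin.cases ?_ (fun j => ?_) j
        · simp only [Fin.cons_zero]
          rw [Matrix.mul_smul, hX, Matrix.smul_mul, smul_comm]
        · simpa using hIV j g
      · intro j
        refine Fin.cases ?_ (fun j => ?_) j
        · simp only [Fin.cons_zero]
          rw [Matrix.mul_smul, hXL, smul_comm]
        · simpa using hIL j
  obtain ⟨I, -, -, hI, -⟩ := hall (Fintype.card m + 1)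
  exact absurd (card_le_of_orthonormal_isometries hTi.1 hI) (by omega)

/-- For an irrep `T` with a factor system, the adjoint action `X ↦ T(g) X T(g)ᴴ` on `d × d` matrices
is diagonal in an orthogonal basis of unitary matrices `O μ`, with pairwise distinct characters
`κ μ`. -/
theorem exists_adjoint_eigenbasis {ω : G → G → Circle} {T : G → Matrix.unitaryGroup (Fin d) ℂ}
    (hT : IsProjRep ω T) (hTi : IsIrred T) :
    ∃ (n : ℕ) (O : Fin n → Matrix (Fin d) (Fin d) ℂ) (κ : Fin n → (G →* Circle)),
      Function.Injective κ ∧ (∀ μ, (O μ)ᴴ * O μ = 1) ∧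
      (∀ μ ν, ∑ i, ∑ j, star (O μ i j) * O ν i j = if μ = ν then (d : ℂ) else 0) ∧
      (∀ i j i' j', ∑ μ, O μ i j * star (O μ i' j') = if i = i' ∧ j = j' then (d : ℂ) else 0) ∧
      ∀ μ g, (T g : Matrix (Fin d) (Fin d) ℂ) * O μ
        = (κ μ g : ℂ) • (O μ * (T g : Matrix (Fin d) (Fin d) ℂ)) := by
  have hTu := hT.isProjUnitary
  have hd0 : (d : ℂ) ≠ 0 := by exact_mod_cast hTi.1.ne'
  have hV : IsProjUnitary (1 : G → G → Circle) (fun g => (T g : Matrix (Fin d) (Fin d) ℂ) ⊗ₖ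
      (T g : Matrix (Fin d) (Fin d) ℂ).map star) := by
    have hmap : ∀ A B : Matrix (Fin d) (Fin d) ℂ, A.map star * B.map star = (A * B).map star := by
      intro A B
      ext i j
      simp [Matrix.mul_apply]
    refine ⟨fun g => ?_, fun g h => ?_⟩
    · have h1 : ((T g : Matrix (Fin d) (Fin d) ℂ).map star)ᴴ
          = ((T g : Matrix (Fin d) (Fin d) ℂ)ᴴ).map star := by
        ext i j; simp
      rw [Matrix.conjTranspose_kronecker, ← Matrix.mul_kronecker_mul, h1, hmap, hTu.unitary]
      simp
    · rw [← Matrix.mul_kronecker_mul, hmap, hTu.mul]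
      ext ⟨i, j⟩ ⟨i', j'⟩
      have := circle_mul_star (ω g h)
      simp only [Matrix.kroneckerMap_apply, Matrix.map_apply, Matrix.smul_apply, smul_eq_mul,
        star_mul', Pi.one_apply, Circle.coe_one, one_mul]
      linear_combination ((T (g * h) : Matrix (Fin d) (Fin d) ℂ) i i' *
        star ((T (g * h) : Matrix (Fin d) (Fin d) ℂ) j j')) * this
  -- `T ⊗ T^*` on `ℂ^d ⊗ ℂ^d` is the adjoint action; it is a sum of copies of the trivial
  -- representation twisted by characters.
  have h1 : IsProjRep (1 : G → G → Circle) (fun _ : G => (1 : Matrix.unitaryGroup (Fin 1) ℂ)) := by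
    intro g h; simp
  obtain ⟨n, I, κ, -, hI, hI1, hIV, -⟩ := exists_isotypic_decomposition hV h1 isIrred_one
    (L := 1) (by simp) (by simp)
  let s : ℂ := (Real.sqrt d : ℝ)
  have hss : s * star s = d := by
    simp only [s, Complex.star_def, Complex.conj_ofReal]
    rw [← Complex.ofReal_mul, Real.mul_self_sqrt (Nat.cast_nonneg d)]; simp
  let O : Fin n → Matrix (Fin d) (Fin d) ℂ := fun μ => Matrix.of fun i j => s * I μ (i, j) 0
  have horth : ∀ μ ν, ∑ i, ∑ j, star (O μ i j) * O ν i j = if μ = ν then (d : ℂ) else 0 := by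
    intro μ ν
    have h := congrFun (congrFun (hI μ ν) 0) 0
    rw [Matrix.mul_apply, Fintype.sum_prod_type] at h
    simp only [Matrix.conjTranspose_apply] at h
    have h2 : ∑ i, ∑ j, star (O μ i j) * O ν i j
        = (d : ℂ) * ∑ i, ∑ j, star (I μ (i, j) 0) * I ν (i, j) 0 := by
      simp only [Finset.mul_sum, O, Matrix.of_apply, star_mul', ← hss]
      exact Finset.sum_congr rfl fun i _ => Finset.sum_congr rfl fun j _ => by ring
    rw [h2, h]
    split_ifs <;> simp
  have hOT : ∀ μ g, (T g : Matrix (Fin d) (Fin d) ℂ) * O μ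
        = (κ μ g : ℂ) • (O μ * (T g : Matrix (Fin d) (Fin d) ℂ)) := by
    intro μ g
    have h2 : (T g : Matrix (Fin d) (Fin d) ℂ) * O μ * (T g : Matrix (Fin d) (Fin d) ℂ)ᴴ
        = (κ μ g : ℂ) • O μ := by
      ext i j
      have h := congrFun (congrFun (hIV μ g) (i, j)) 0
      simp only [Matrix.mul_apply, Fintype.sum_prod_type, Matrix.kroneckerMap_apply,
        Matrix.map_apply, Matrix.smul_apply, smul_eq_mul, OneMemClass.coe_one,
        Matrix.one_apply_eq, Finset.univ_unique, Finset.sum_singleton, Fin.default_eq_zero,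
        mul_one] at h
      simp only [Matrix.mul_apply, Matrix.smul_apply, smul_eq_mul, O, Matrix.of_apply,
        Matrix.conjTranspose_apply, Finset.sum_mul]
      rw [mul_left_comm, ← h, Finset.mul_sum, Finset.sum_comm]
      refine Finset.sum_congr rfl fun a _ => ?_
      rw [Finset.mul_sum]
      exact Finset.sum_congr rfl fun b _ => by ring
    rw [← Matrix.smul_mul, ← h2, Matrix.mul_assoc _ _ (T g : Matrix (Fin d) (Fin d) ℂ),
      hTu.unitary, Matrix.mul_one]
  have htr : ∀ μ ν, ((O μ)ᴴ * O ν).trace = if μ = ν then (d : ℂ) else 0 := by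
    intro μ ν
    rw [← horth, Finset.sum_comm]
    simp [Matrix.trace, Matrix.mul_apply]
  have hun : ∀ μ, (O μ)ᴴ * O μ = 1 := by
    intro μ
    obtain ⟨c, hc⟩ := hTi.eq_smul_one (gram_commute hTu hTu (hOT μ) (hOT μ))
    have h := htr μ μ
    rw [hc, Matrix.trace_smul, Matrix.trace_one, Fintype.card_fin, if_pos rfl, smul_eq_mul] at h
    have hc1 : c = 1 := mul_right_cancel₀ hd0 (by rw [h, one_mul])
    rw [hc, hc1, one_smul]
  refine ⟨n, O, κ, fun μ ν hμν => ?_, hun, horth, fun i j i' j' => ?_, hOT⟩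
  · by_contra hne
    obtain ⟨c, hc⟩ := hTi.eq_smul_one (gram_commute hTu hTu (hOT μ) (hμν ▸ hOT ν))
    have h := htr μ ν
    rw [hc, Matrix.trace_smul, Matrix.trace_one, Fintype.card_fin, if_neg hne, smul_eq_mul,
      mul_eq_zero, or_iff_left hd0] at h
    rw [h, zero_smul] at hc
    have h2 : O ν = 0 := by
      rw [← Matrix.one_mul (O ν), ← mul_eq_one_comm.1 (hun μ), Matrix.mul_assoc, hc,
        Matrix.mul_zero]
    have h3 := htr ν ν
    rw [h2, if_pos rfl] at h3
    simp only [Matrix.mul_zero, Matrix.trace_zero] at h3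
    exact hd0 h3.symm
  · have h := congrFun (congrFun hI1 (i, j)) (i', j')
    simp only [Matrix.sum_apply, Matrix.mul_apply, Finset.univ_unique, Finset.sum_singleton,
      Fin.default_eq_zero, Matrix.conjTranspose_apply, Matrix.one_apply, Prod.mk.injEq] at h
    have h2 : ∑ μ, O μ i j * star (O μ i' j')
        = (d : ℂ) * ∑ μ, I μ (i, j) 0 * star (I μ (i', j') 0) := by
      simp only [Finset.mul_sum, O, Matrix.of_apply, star_mul', ← hss]
      exact Finset.sum_congr rfl fun i _ => by ring
    rw [h2, h]
    split_ifs <;> simp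

end Decomposition

/-! ### Matrix product form of the fixed-point state -/

section MatrixProduct

variable {D p : ℕ}

/-- The ordered product `A 0 * A 1 * ⋯ * A (n - 1)`. -/
def chainProd {n : ℕ} (A : Fin n → Matrix (Fin D) (Fin D) ℂ) : Matrix (Fin D) (Fin D) ℂ :=
  (List.ofFn A).prod

lemma chainProd_zero (A : Fin 0 → Matrix (Fin D) (Fin D) ℂ) : chainProd A = 1 := by
  simp [chainProd]

lemma chainProd_succ {n : ℕ} (A : Fin (n + 1) → Matrix (Fin D) (Fin D) ℂ) :
    chainProd A = A 0 * chainProd (fun i => A i.succ) := by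
  simp [chainProd, List.ofFn_succ]

lemma chainProd_add {m n : ℕ} (A : Fin (m + n) → Matrix (Fin D) (Fin D) ℂ) :
    chainProd A = chainProd (fun i => A (Fin.castAdd n i)) *
      chainProd (fun i => A (Fin.natAdd m i)) := by
  simp only [chainProd, List.ofFn_add, List.prod_append]
  rfl

lemma sum_fin_cons {n : ℕ} {X : Type*} [Fintype X] {M : Type*} [AddCommMonoid M]
    (f : (Fin (n + 1) → X) → M) : ∑ k, f k = ∑ a, ∑ k : Fin n → X, f (Fin.cons a k) := by
  rw [← (Fin.consEquiv fun _ => X).sum_comp, Fintype.sum_prod_type]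
  rfl

/-- Sum over paths `k 0, …, k n` of the product of the matrix elements along the path. -/
lemma sum_path_eq {n : ℕ} (A : Fin n → Matrix (Fin D) (Fin D) ℂ) (F : Fin D → Fin D → ℂ) :
    ∑ k : Fin (n + 1) → Fin D, F (k 0) (k (Fin.last n)) * ∏ i, A i (k i.castSucc) (k i.succ)
      = ∑ i, ∑ j, F i j * chainProd A i j := by
  induction n generalizing F with
  | zero =>
    rw [sum_fin_cons]
    refine Finset.sum_congr rfl fun a _ => ?_
    rw [Finset.sum_eq_single a]
    · simp [chainProd_zero]
    · intro b _ h
      simp [chainProd_zero, Matrix.one_apply_ne h.symm]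
    · simp
  | succ n ih =>
    rw [sum_fin_cons]
    have h1 : ∀ (a : Fin D) (k : Fin (n + 1) → Fin D),
        F ((Fin.cons a k : Fin (n + 2) → Fin D) 0)
          ((Fin.cons a k : Fin (n + 2) → Fin D) (Fin.last (n + 1))) *
        ∏ i : Fin (n + 1), A i ((Fin.cons a k : Fin (n + 2) → Fin D) i.castSucc)
          ((Fin.cons a k : Fin (n + 2) → Fin D) i.succ)
        = (F a (k (Fin.last n)) * A 0 a (k 0)) *
          ∏ i : Fin n, A i.succ (k i.castSucc) (k i.succ) := by
      intro a k
      rw [Fin.prod_univ_succ, ← Fin.succ_last]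
      simp only [Fin.cons_zero, Fin.cons_succ, Fin.castSucc_zero, ← Fin.succ_castSucc]
      ring
    simp only [h1]
    refine Finset.sum_congr rfl fun a _ => ?_
    refine (ih (fun i => A i.succ) (fun b c => F a c * A 0 a b)).trans ?_
    rw [Finset.sum_comm]
    refine Finset.sum_congr rfl fun c _ => ?_
    rw [chainProd_succ, Matrix.mul_apply, Finset.mul_sum]
    exact Finset.sum_congr rfl fun b _ => by ring

/-- Sum over closed paths on a ring: a trace. The starting point `s` of the ordered product is
arbitrary. -/
lemma sum_cycle_eq_trace {N : ℕ} [NeZero N] (A : ZMod N → Matrix (Fin D) (Fin D) ℂ) (s : ZMod N) :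
    ∑ k : ZMod N → Fin D, ∏ i, A i (k i) (k (i + 1))
      = (chainProd fun t : Fin N => A (s + (t : ℕ))).trace := by
  have hshift : ∑ k : ZMod N → Fin D, ∏ i, A i (k i) (k (i + 1))
      = ∑ k : ZMod N → Fin D, ∏ i, A (s + i) (k i) (k (i + 1)) := by
    rw [← (Equiv.arrowCongr (Equiv.addLeft s) (Equiv.refl (Fin D))).sum_comp]
    refine Finset.sum_congr rfl fun k _ => ?_
    rw [← Equiv.prod_comp (Equiv.addLeft s)]
    refine Finset.prod_congr rfl fun i _ => ?_
    simp [Equiv.arrowCongr, add_assoc]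
  rw [hshift]
  obtain ⟨n, rfl⟩ := Nat.exists_eq_succ_of_ne_zero (NeZero.ne N)
  have key : ∀ B : Fin (n + 1) → Matrix (Fin D) (Fin D) ℂ,
      ∑ k : Fin (n + 1) → Fin D, ∏ i, B i (k i) (k (i + 1)) = (chainProd B).trace := by
    intro B
    have h1 : ∀ k : Fin (n + 1) → Fin D, ∏ i, B i (k i) (k (i + 1))
        = B (Fin.last n) (k (Fin.last n)) (k 0) *
          ∏ i : Fin n, B i.castSucc (k i.castSucc) (k i.succ) := by
      intro k
      rw [Fin.prod_univ_castSucc, mul_comm]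
      simp [Fin.last_add_one, Fin.coeSucc_eq_succ]
    simp only [h1]
    rw [sum_path_eq (fun i => B i.castSucc) (fun a b => B (Fin.last n) b a), chainProd_add]
    simp only [Matrix.trace, Matrix.diag, Matrix.mul_apply]
    refine Finset.sum_congr rfl fun i _ => Finset.sum_congr rfl fun j _ => ?_
    rw [mul_comm, chainProd_succ, chainProd_zero, Matrix.mul_one]
    rfl
  have h2 := key (fun i => A (s + (show ZMod (n + 1) from i)))
  refine Eq.trans h2 ?_
  congr 2
  funext t
  congr 2
  exact (ZMod.natCast_zmod_val (n := n + 1) (show ZMod (n + 1) from t)).symm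

/-- The `D × D` matrix formed by the components of `S` belonging to the physical basis vector
`q`. -/
def legMatrix (S : Matrix (Fin p) (Fin D × Fin D) ℂ) (q : Fin p) : Matrix (Fin D) (Fin D) ℂ :=
  Matrix.of fun i j => S q (i, j)

/-- The diagonal matrix of the Schmidt coefficients of a bond. -/
def bondMatrix (lam : Fin D → ℝ) : Matrix (Fin D) (Fin D) ℂ :=
  Matrix.diagonal fun k => (lam k : ℂ)

/-- The matrix product tensor of one site together with the bond to its right. -/
def siteMatrix (S : Matrix (Fin p) (Fin D × Fin D) ℂ) (lam : Fin D → ℝ) (q : Fin p) :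
    Matrix (Fin D) (Fin D) ℂ :=
  legMatrix S q * bondMatrix lam

/-- The fixed-point state in matrix product form. -/
lemma fixedPointState_eq_trace {N : ℕ} [NeZero N] (S : Matrix (Fin p) (Fin D × Fin D) ℂ)
    (lam : Fin D → ℝ) (s : ZMod N) (x : ZMod N → Fin p) :
    fixedPointState N S lam x
      = (chainProd fun t : Fin N => siteMatrix S lam (x (s + (t : ℕ)))).trace := by
  rw [← sum_cycle_eq_trace (fun i => siteMatrix S lam (x i))]
  have h1 : ∀ (q : Fin p) (i j : Fin D), siteMatrix S lam q i j
      = ∑ l, S q (i, l) * bondVec lam (l, j) := by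
    intro q i j
    rw [siteMatrix, Matrix.mul_apply]
    refine Finset.sum_congr rfl fun l _ => ?_
    simp only [legMatrix, bondMatrix, Matrix.of_apply, bondVec, Matrix.diagonal_apply]
  simp only [h1, Finset.prod_univ_sum, Fintype.piFinset_univ]
  rw [← Fintype.sum_prod_type', ← (Equiv.arrowProdEquivProdArrow _ _ _).sum_comp]
  simp only [fixedPointState, Matrix.mulVec, dotProduct, tensorPow, Matrix.of_apply, bondState,
    ← Finset.prod_mul_distrib]
  rfl

lemma sum_star_legMatrix {S : Matrix (Fin p) (Fin D × Fin D) ℂ} (hS : Sᴴ * S = 1)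
    (i j i' j' : Fin D) : ∑ q, star (legMatrix S q i j) * legMatrix S q i' j'
      = if i = i' ∧ j = j' then 1 else 0 := by
  have h := congrFun (congrFun hS (i, j)) (i', j')
  simpa [Matrix.mul_apply, Matrix.one_apply, legMatrix] using h

lemma siteMatrix_apply (S : Matrix (Fin p) (Fin D × Fin D) ℂ) (lam : Fin D → ℝ) (q : Fin p)
    (i j : Fin D) : siteMatrix S lam q i j = legMatrix S q i j * lam j := by
  simp [siteMatrix, bondMatrix, Matrix.mul_diagonal]

/-- The tensor of a block of sites is, up to the weights of the last bond, an isometry from the two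
outer virtual sites. The interior bonds contribute their norm `∑ λ² = 1`. -/
lemma sum_star_chainProd {S : Matrix (Fin p) (Fin D × Fin D) ℂ} (hS : Sᴴ * S = 1)
    {lam : Fin D → ℝ} (hlam : ∑ k, lam k ^ 2 = 1) {n : ℕ} (hn : 0 < n) (i j i' j' : Fin D) :
    ∑ u : Fin n → Fin p, star (chainProd (fun t => siteMatrix S lam (u t)) i j) *
        chainProd (fun t => siteMatrix S lam (u t)) i' j'
      = if i = i' ∧ j = j' then (lam j : ℂ) ^ 2 else 0 := by
  have hlamC : ∑ k, (lam k : ℂ) ^ 2 = 1 := by exact_mod_cast hlam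
  have step : ∀ n : ℕ, ∀ i j i' j' : Fin D,
      ∑ u : Fin (n + 1) → Fin p, star (chainProd (fun t => siteMatrix S lam (u t)) i j) *
        chainProd (fun t => siteMatrix S lam (u t)) i' j'
      = if i = i' then ∑ k, (lam k : ℂ) ^ 2 * ∑ u : Fin n → Fin p,
          star (chainProd (fun t => siteMatrix S lam (u t)) k j) *
          chainProd (fun t => siteMatrix S lam (u t)) k j' else 0 := by
    intro n i j i' j'
    have h0 : ∀ u : Fin (n + 1) → Fin p,
        star (chainProd (fun t => siteMatrix S lam (u t)) i j) *
        chainProd (fun t => siteMatrix S lam (u t)) i' j'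
        = ∑ k, ∑ k', (star (legMatrix S (u 0) i k) * legMatrix S (u 0) i' k') * (lam k * lam k' *
          (star (chainProd (fun t : Fin n => siteMatrix S lam (u t.succ)) k j) *
          chainProd (fun t : Fin n => siteMatrix S lam (u t.succ)) k' j')) := by
      intro u
      rw [chainProd_succ, Matrix.mul_apply, Matrix.mul_apply, star_sum, Finset.sum_mul_sum]
      refine Finset.sum_congr rfl fun k _ => Finset.sum_congr rfl fun k' _ => ?_
      rw [siteMatrix_apply, siteMatrix_apply, star_mul', star_mul', Complex.star_def,
        Complex.conj_ofReal]
      ring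
    simp only [h0]
    rw [sum_fin_cons]
    simp only [Fin.cons_zero, Fin.cons_succ]
    have h1 : ∀ (F : Fin D → Fin D → (Fin n → Fin p) → ℂ),
        ∑ q, ∑ u : Fin n → Fin p, ∑ k, ∑ k',
          (star (legMatrix S q i k) * legMatrix S q i' k') * F k k' u
        = ∑ k, ∑ k', (∑ q, star (legMatrix S q i k) * legMatrix S q i' k') * ∑ u, F k k' u := by
      intro F
      simp only [Finset.sum_mul_sum]
      rw [Finset.sum_comm]
      simp only [Finset.sum_comm (s := (Finset.univ : Finset (Fin p)))
        (t := (Finset.univ : Finset (Fin D)))]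
      rw [Finset.sum_comm]
      refine Finset.sum_congr rfl fun k _ => ?_
      rw [Finset.sum_comm]
      refine Finset.sum_congr rfl fun k' _ => ?_
      rw [Finset.sum_comm]
    rw [h1]
    simp only [sum_star_legMatrix hS]
    by_cases hi : i = i'
    · simp only [hi, true_and, if_true, ite_mul, one_mul, zero_mul, Finset.sum_ite_eq,
        Finset.mem_univ]
      exact Finset.sum_congr rfl fun k _ => by rw [← Finset.mul_sum, sq]
    · simp [hi]
  induction n, hn using Nat.le_induction generalizing i j i' j' with
  | base =>
    rw [step]
    have h2 : ∀ k, ∑ u : Fin 0 → Fin p, star (chainProd (fun t => siteMatrix S lam (u t)) k j) *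
          chainProd (fun t => siteMatrix S lam (u t)) k j' = if k = j ∧ j = j' then 1 else 0 := by
      intro k
      simp only [Finset.univ_unique, Finset.sum_singleton, chainProd_zero, Matrix.one_apply]
      by_cases hk : k = j
      · subst hk; simp
      · simp [hk]
    simp only [h2]
    by_cases hi : i = i'
    · by_cases hj : j = j'
      · simp [hi, hj]
      · simp [hj]
    · simp [hi]
  | succ n _ ih =>
    rw [step]
    simp only [ih]
    by_cases hi : i = i'
    · by_cases hj : j = j'
      · simp only [hi, hj, and_self, if_true]
        rw [← Finset.sum_mul, hlamC, one_mul]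
      · simp [hj]
    · simp [hi]

end MatrixProduct

/-! ### Isometries defining the same state -/

section Virtual

variable {D p : ℕ}

/-- Linear maps on matrices with `f X * f Y = h (X * Y)` are conjugations up to a factor: `f 1` is
central, hence a scalar, and `f` is an algebra automorphism up to this scalar. The conjugating
matrix has the columns `f (|i⟩⟨k|) z`, for suitable `k` and `z`. -/
lemma exists_conj_of_mul (f h : Matrix (Fin D) (Fin D) ℂ →ₗ[ℂ] Matrix (Fin D) (Fin D) ℂ)
    (hD : 0 < D) (hf : Function.Surjective f) (hfh : ∀ X Y, f X * f Y = h (X * Y)) :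
    ∃ (c : ℂ) (R : Matrix (Fin D) (Fin D) ℂ), IsUnit R ∧ ∀ X, f X * R = c • (R * X) := by
  have hcentral : ∀ X, f 1 * X = X * f 1 := by
    intro X
    obtain ⟨Y, rfl⟩ := hf X
    rw [hfh, hfh, Matrix.one_mul, Matrix.mul_one]
  obtain ⟨c, hc⟩ : ∃ c : ℂ, f 1 = c • 1 := by
    obtain ⟨c, hc⟩ := Matrix.mem_range_scalar_iff_commute_single'.mpr
      fun i j => (hcentral (Matrix.single i j 1)).symm
    refine ⟨c, ?_⟩
    rw [← hc]
    ext i j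
    simp [Matrix.scalar_apply, Matrix.diagonal_apply, Matrix.one_apply]
  have hch : ∀ X, h X = c • f X := fun X => by
    rw [← Matrix.mul_one X, ← hfh, hc, Matrix.mul_smul, Matrix.mul_one, Matrix.mul_one]
  have hone : (1 : Matrix (Fin D) (Fin D) ℂ) ≠ 0 := by
    intro h
    have := congrFun (congrFun h ⟨0, hD⟩) ⟨0, hD⟩
    simp at this
  have hc0 : c ≠ 0 := by
    rintro rfl
    obtain ⟨Y, hY⟩ := hf 1
    have := hfh Y Y
    rw [hY, hch, zero_smul, Matrix.one_mul] at this
    exact hone this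
  obtain ⟨i₀, k, b, b', hne⟩ : ∃ i k b b', f (Matrix.single i k 1) b' b ≠ 0 := by
    by_contra! hcon
    obtain ⟨Y, hY⟩ := hf 1
    apply hone
    rw [← hY, Matrix.matrix_eq_sum_single Y, map_sum]
    refine Finset.sum_eq_zero fun i _ => ?_
    rw [map_sum]
    refine Finset.sum_eq_zero fun j _ => ?_
    have h1 : Matrix.single i j (Y i j) = Y i j • Matrix.single i j (1 : ℂ) := by simp
    have h2 : f (Matrix.single i j 1) = 0 := Matrix.ext fun a a' => hcon i j a' a
    rw [h1, map_smul, h2, smul_zero]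
  let R : Matrix (Fin D) (Fin D) ℂ := Matrix.of fun a i => f (Matrix.single i k 1) a b
  have hR : ∀ X, f X * R = c • (R * X) := by
    intro X
    ext a i
    have h1 : f X * f (Matrix.single i k 1) = c • ∑ l, X l i • f (Matrix.single l k 1) := by
      rw [hfh, hch]
      have : X * Matrix.single i k 1 = ∑ l, X l i • Matrix.single l k (1 : ℂ) := by
        ext a a'
        rw [Matrix.sum_apply]
        by_cases ha : k = a' <;> simp [Matrix.mul_apply, Matrix.single_apply, ha]
      rw [this, map_sum]
      simp only [map_smul]
    have h2 := congrFun (congrFun h1 a) b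
    simp only [Matrix.mul_apply, Matrix.smul_apply, Matrix.sum_apply, smul_eq_mul] at h2 ⊢
    simp only [R, Matrix.of_apply]
    rw [h2]
    congr 1
    exact Finset.sum_congr rfl fun _ _ => mul_comm _ _
  refine ⟨c, R, Matrix.mulVec_surjective_iff_isUnit.1 fun w => ?_, hR⟩
  -- The range of `R` is nonzero and, by `hR`, invariant under every matrix.
  obtain ⟨X, hX⟩ := hf (Matrix.of fun a a' => if a' = b' then w a / R b' i₀ else 0)
  have hu : R b' i₀ ≠ 0 := hne
  refine ⟨c • (X *ᵥ Pi.single i₀ 1), ?_⟩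
  rw [Matrix.mulVec_smul, Matrix.mulVec_mulVec, ← Matrix.smul_mulVec, ← hR, hX]
  ext a
  simp [Matrix.mul_apply, hu]

lemma kronecker_eq_one {A B : Matrix (Fin D) (Fin D) ℂ} (hD : 0 < D) (h : A ⊗ₖ B = 1) :
    ∃ t : ℂ, A = t • 1 := by
  have h1 : ∀ i i' j j', A i i' * B j j' = if i = i' ∧ j = j' then 1 else 0 := by
    intro i i' j j'
    have := congrFun (congrFun h (i, j)) (i', j')
    simpa [Matrix.one_apply] using this
  have hB : A ⟨0, hD⟩ ⟨0, hD⟩ * B ⟨0, hD⟩ ⟨0, hD⟩ = 1 := by simp [h1]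
  refine ⟨A ⟨0, hD⟩ ⟨0, hD⟩, ?_⟩
  ext i i'
  have h2 := h1 i i' ⟨0, hD⟩ ⟨0, hD⟩
  have hB0 := right_ne_zero_of_mul_eq_one hB
  refine mul_right_cancel₀ hB0 ?_
  rw [h2, Matrix.smul_apply, Matrix.one_apply, smul_eq_mul, mul_assoc, mul_comm _ (B _ _),
    ← mul_assoc, hB]
  simp

section Peel

variable {S S' : Matrix (Fin p) (Fin D × Fin D) ℂ} {lam : Fin D → ℝ}

/-- If two isometries define the same state on a ring, then their tensors of a block of `r` sites
are related by a linear map, provided that the block is not the whole ring: contract with the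
conjugate of the tensor of the remaining sites. -/
lemma exists_linearMap_chainProd (hS' : S'ᴴ * S' = 1) (hpos : ∀ k, 0 < lam k)
    (hlam : ∑ k, lam k ^ 2 = 1) {r n : ℕ} (hn : 0 < n)
    (h : ∀ u : Fin (r + n) → Fin p, (chainProd fun t => siteMatrix S' lam (u t)).trace
      = (chainProd fun t => siteMatrix S lam (u t)).trace) :
    ∃ F : Matrix (Fin D) (Fin D) ℂ →ₗ[ℂ] Matrix (Fin D) (Fin D) ℂ, ∀ u : Fin r → Fin p,
      (chainProd fun t => siteMatrix S' lam (u t))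
        = F (chainProd fun t => siteMatrix S lam (u t)) := by
  let Y : Fin D → Fin D → Matrix (Fin D) (Fin D) ℂ := fun i j =>
    ∑ v : Fin n → Fin p, star (chainProd (fun t => siteMatrix S' lam (v t)) i j) •
      chainProd (fun t => siteMatrix S lam (v t))
  refine ⟨{ toFun := fun X => Matrix.of fun j i => ((lam j : ℂ) ^ 2)⁻¹ * (X * Y i j).trace
            map_add' := fun X X' => ?_
            map_smul' := fun c X => ?_ }, fun u => ?_⟩
  · ext j i
    simp [Matrix.add_mul, mul_add]
  · ext j i
    simp [mul_left_comm]
  · ext j i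
    have hl : (lam j : ℂ) ≠ 0 := by exact_mod_cast (hpos j).ne'
    have h1 : (chainProd (fun t => siteMatrix S lam (u t)) * Y i j).trace
        = ∑ v : Fin n → Fin p, star (chainProd (fun t => siteMatrix S' lam (v t)) i j) *
          (chainProd (fun t => siteMatrix S' lam (u t)) *
            chainProd (fun t => siteMatrix S' lam (v t))).trace := by
      simp only [Y, Matrix.mul_sum, Matrix.trace_sum, Matrix.mul_smul, Matrix.trace_smul,
        smul_eq_mul]
      refine Finset.sum_congr rfl fun v _ => ?_
      have h2 := h (Fin.append u v)
      rw [chainProd_add, chainProd_add] at h2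
      simp only [Fin.append_left, Fin.append_right] at h2
      rw [h2]
    have h3 : ∑ v : Fin n → Fin p, star (chainProd (fun t => siteMatrix S' lam (v t)) i j) *
          (chainProd (fun t => siteMatrix S' lam (u t)) *
            chainProd (fun t => siteMatrix S' lam (v t))).trace
        = (lam j : ℂ) ^ 2 * chainProd (fun t => siteMatrix S' lam (u t)) j i := by
      simp only [Matrix.trace, Matrix.diag, Matrix.mul_apply, Finset.mul_sum]
      rw [Finset.sum_comm]
      have h4 : ∀ a : Fin D, ∑ v : Fin n → Fin p, ∑ b,
          star (chainProd (fun t => siteMatrix S' lam (v t)) i j) *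
          (chainProd (fun t => siteMatrix S' lam (u t)) a b *
            chainProd (fun t => siteMatrix S' lam (v t)) b a)
          = ∑ b, chainProd (fun t => siteMatrix S' lam (u t)) a b *
            if i = b ∧ j = a then (lam j : ℂ) ^ 2 else 0 := by
        intro a
        rw [Finset.sum_comm]
        refine Finset.sum_congr rfl fun b _ => ?_
        rw [← sum_star_chainProd hS' hlam hn i j b a, Finset.mul_sum]
        exact Finset.sum_congr rfl fun v _ => by ring
      simp only [h4, ite_and]
      simp [mul_comm]
    change _ = ((lam j : ℂ) ^ 2)⁻¹ * (chainProd (fun t => siteMatrix S lam (u t)) * Y i j).trace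
    rw [h1, h3]
    field_simp

/-- The site matrices span all matrices, because `S` is injective. -/
lemma exists_eq_sum_siteMatrix (hS : Sᴴ * S = 1) (hpos : ∀ k, 0 < lam k)
    (X : Matrix (Fin D) (Fin D) ℂ) : ∃ c : Fin p → ℂ, X = ∑ q, c q • siteMatrix S lam q := by
  refine ⟨fun q => ∑ i, ∑ j, X i j * (lam j : ℂ)⁻¹ * star (legMatrix S q i j), ?_⟩
  ext a b
  have hl : (lam b : ℂ) ≠ 0 := by exact_mod_cast (hpos b).ne'
  rw [Matrix.sum_apply]
  simp only [Matrix.smul_apply, smul_eq_mul, siteMatrix_apply, Finset.sum_mul]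
  rw [Finset.sum_comm]
  have h1 : ∀ i, ∑ q, ∑ j, X i j * (lam j : ℂ)⁻¹ * star (legMatrix S q i j) *
      (legMatrix S q a b * lam b)
      = ∑ j, X i j * (lam j : ℂ)⁻¹ * lam b * if i = a ∧ j = b then 1 else 0 := by
    intro i
    rw [Finset.sum_comm]
    refine Finset.sum_congr rfl fun j _ => ?_
    rw [← sum_star_legMatrix hS i j a b, Finset.mul_sum]
    exact Finset.sum_congr rfl fun q _ => by ring
  simp only [h1, ite_and]
  simp [hl]

/-- Two isometries defining the same state have site matrices which are conjugate up to a factor. On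
a ring of at least three sites, blocks of one and of two sites have a nonempty complement, so the
site matrices and the products of two of them are related by linear maps `f` and `F`. As the site
matrices span, `f X * f Y = F (X * Y)` for all matrices. -/
lemma siteMatrix_eq_conj (hS : Sᴴ * S = 1) (hS' : S'ᴴ * S' = 1) (hpos : ∀ k, 0 < lam k)
    (hlam : ∑ k, lam k ^ 2 = 1) {N : ℕ} [NeZero N] (hN : 3 ≤ N)
    (h : fixedPointState N S' lam = fixedPointState N S lam) :
    ∃ (c : ℂ) (R : Matrix (Fin D) (Fin D) ℂ), IsUnit R ∧
      ∀ q, siteMatrix S' lam q * R = c • (R * siteMatrix S lam q) := by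
  have hD : 0 < D := by
    rcases Nat.eq_zero_or_pos D with rfl | hD
    · simp at hlam
    · exact hD
  have htr : ∀ u : Fin N → Fin p, (chainProd fun t => siteMatrix S' lam (u t)).trace
      = (chainProd fun t => siteMatrix S lam (u t)).trace := by
    intro u
    have h1 := congrFun h fun i => u ⟨i.val, i.val_lt⟩
    rw [fixedPointState_eq_trace _ _ 0, fixedPointState_eq_trace _ _ 0] at h1
    have h2 : ∀ t : Fin N, (⟨(0 + ((t : ℕ) : ZMod N)).val, ZMod.val_lt _⟩ : Fin N) = t := by
      intro t
      apply Fin.ext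
      simp [ZMod.val_natCast_of_lt t.2]
    simpa only [h2] using h1
  have h1 : ∃ n, N = 1 + n ∧ 0 < n := ⟨N - 1, by omega, by omega⟩
  have h2 : ∃ n, N = 2 + n ∧ 0 < n := ⟨N - 2, by omega, by omega⟩
  obtain ⟨n₁, hN₁, hn₁⟩ := h1
  obtain ⟨n₂, hN₂, hn₂⟩ := h2
  obtain ⟨f, hf⟩ := exists_linearMap_chainProd (S := S) hS' hpos hlam hn₁ (hN₁ ▸ htr)
  obtain ⟨F, hF⟩ := exists_linearMap_chainProd (S := S) hS' hpos hlam hn₂ (hN₂ ▸ htr)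
  have hf' : ∀ q, siteMatrix S' lam q = f (siteMatrix S lam q) := by
    intro q
    have := hf fun _ => q
    simpa only [chainProd_succ, chainProd_zero, Matrix.mul_one] using this
  have hF' : ∀ q q', siteMatrix S' lam q * siteMatrix S' lam q'
      = F (siteMatrix S lam q * siteMatrix S lam q') := by
    intro q q'
    have := hF ![q, q']
    simpa only [chainProd_succ, chainProd_zero, Matrix.mul_one, Matrix.cons_val_zero,
      Matrix.cons_val_succ] using this
  have hsurj : Function.Surjective f := by
    intro X
    obtain ⟨c, rfl⟩ := exists_eq_sum_siteMatrix hS' hpos X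
    exact ⟨∑ q, c q • siteMatrix S lam q, by simp only [map_sum, map_smul, hf']⟩
  obtain ⟨c, R, hR, hfR⟩ := exists_conj_of_mul f F hD hsurj fun X Y => by
    obtain ⟨a, rfl⟩ := exists_eq_sum_siteMatrix hS hpos X
    obtain ⟨b, rfl⟩ := exists_eq_sum_siteMatrix hS hpos Y
    simp only [map_sum, map_smul, ← hf', Finset.sum_mul, Finset.mul_sum, Matrix.smul_mul,
      Matrix.mul_smul, hF']
  exact ⟨c, R, hR, fun q => by rw [hf', hfR]⟩

end Peel

end Virtual

/-! ### Existence of the virtual representation -/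

section Virtual

variable {D p : ℕ}

lemma conj_mulVec_bondVec (A B : Matrix (Fin D) (Fin D) ℂ) (lam : Fin D → ℝ) (i j : Fin D) :
    ((A ⊗ₖ B) *ᵥ bondVec lam) (i, j) = (A * bondMatrix lam * Bᵀ) i j := by
  simp [Matrix.mulVec, dotProduct, Fintype.sum_prod_type, bondVec, bondMatrix, Matrix.mul_apply,
    Matrix.diagonal_apply, mul_right_comm]

lemma map_star_mul (A B : Matrix (Fin D) (Fin D) ℂ) :
    A.map star * B.map star = (A * B).map star := by
  ext i j
  simp [Matrix.mul_apply]

lemma bondMatrix_conjTranspose (lam : Fin D → ℝ) : (bondMatrix lam)ᴴ = bondMatrix lam := by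
  rw [bondMatrix, Matrix.diagonal_conjTranspose]
  congr 1
  funext i
  simp

lemma trace_bondMatrix_sq {lam : Fin D → ℝ} (hlam : ∑ k, lam k ^ 2 = 1) :
    (bondMatrix lam * bondMatrix lam).trace = 1 := by
  rw [bondMatrix, Matrix.diagonal_mul_diagonal, Matrix.trace_diagonal]
  have : ∑ k, (lam k : ℂ) ^ 2 = 1 := by exact_mod_cast hlam
  simpa [sq] using this

lemma commute_bondMatrix_of_sq {lam : Fin D → ℝ} (hpos : ∀ k, 0 < lam k)
    {W : Matrix (Fin D) (Fin D) ℂ}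
    (h : W * (bondMatrix lam * bondMatrix lam) = bondMatrix lam * bondMatrix lam * W) :
    W * bondMatrix lam = bondMatrix lam * W := by
  ext i j
  have h1 := congrFun (congrFun h i) j
  rw [bondMatrix, Matrix.diagonal_mul_diagonal, Matrix.mul_diagonal, Matrix.diagonal_mul] at h1
  rw [bondMatrix, Matrix.mul_diagonal, Matrix.diagonal_mul]
  by_cases hij : lam i = lam j
  · rw [hij, mul_comm]
  · have h2 : W i j * ((lam j : ℂ) * lam j - lam i * lam i) = 0 := by linear_combination h1
    have h3 : (lam j : ℂ) * lam j - lam i * lam i ≠ 0 := by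
      intro h0
      have h4 : lam j * lam j - lam i * lam i = 0 := by exact_mod_cast h0
      apply hij
      nlinarith [hpos i, hpos j, mul_self_eq_mul_self_iff.1 (sub_eq_zero.1 h4)]
    rw [(mul_eq_zero.1 h2).resolve_right h3]
    simp

/-- Two isometries defining the same state on a ring differ by a unitary `V ⊗ V^*` which preserves
the bonds, and a phase. By `siteMatrix_eq_conj`, `S' = S (V ⊗ c Λ V^* Λ⁻¹)` with an invertible `V`;
both tensor factors are unitary when scaled appropriately, and unitarity of the second one forces
`V` to commute with `Λ`. -/
theorem exists_virtual_unitary {S S' : Matrix (Fin p) (Fin D × Fin D) ℂ} (hS : Sᴴ * S = 1)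
    (hS' : S'ᴴ * S' = 1) {lam : Fin D → ℝ} (hpos : ∀ k, 0 < lam k) (hlam : ∑ k, lam k ^ 2 = 1)
    {N : ℕ} [NeZero N] (hN : 3 ≤ N) (h : fixedPointState N S' lam = fixedPointState N S lam) :
    ∃ (c : Circle) (V : Matrix.unitaryGroup (Fin D) ℂ),
      S' = (c : ℂ) • (S * ((V : Matrix (Fin D) (Fin D) ℂ) ⊗ₖ
        ((V : Matrix (Fin D) (Fin D) ℂ).map star))) ∧
      ((V : Matrix (Fin D) (Fin D) ℂ).map star ⊗ₖ (V : Matrix (Fin D) (Fin D) ℂ)) *ᵥ bondVec lam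
        = bondVec lam := by
  have hD : 0 < D := by
    rcases Nat.eq_zero_or_pos D with rfl | hD
    · simp at hlam
    · exact hD
  have : Nonempty (Fin D) := ⟨⟨0, hD⟩⟩
  obtain ⟨c, R, hRu, hR⟩ := siteMatrix_eq_conj hS hS' hpos hlam hN h
  have hRdet : IsUnit R.det := (Matrix.isUnit_iff_isUnit_det R).1 hRu
  set Λ := bondMatrix lam with hΛ
  let Λi : Matrix (Fin D) (Fin D) ℂ := Matrix.diagonal fun k => (lam k : ℂ)⁻¹
  have hl : ∀ k, (lam k : ℂ) ≠ 0 := fun k => by exact_mod_cast (hpos k).ne'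
  have hΛΛi : Λ * Λi = 1 := by
    simp only [hΛ, bondMatrix, Λi, Matrix.diagonal_mul_diagonal, mul_inv_cancel₀ (hl _)]
    exact Matrix.diagonal_one
  have hΛiΛ : Λi * Λ = 1 := mul_eq_one_comm.1 hΛΛi
  let Q : Matrix (Fin D) (Fin D) ℂ := c • (Λ * R⁻¹ * Λi)
  have hleg : ∀ q, legMatrix S' q = R * legMatrix S q * Q := by
    intro q
    have h1 := hR q
    rw [siteMatrix, siteMatrix] at h1
    calc legMatrix S' q = legMatrix S' q * Λ * R * (R⁻¹ * Λi) := by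
          rw [Matrix.mul_assoc _ R, ← Matrix.mul_assoc R, Matrix.mul_nonsing_inv _ hRdet,
            Matrix.one_mul, Matrix.mul_assoc, hΛΛi, Matrix.mul_one]
      _ = _ := by
          rw [h1]
          simp only [Q, Matrix.smul_mul, Matrix.mul_smul, Matrix.mul_assoc, hΛ]
  have hS'eq : S' = S * (Rᵀ ⊗ₖ Q) := by
    ext q ⟨i, j⟩
    have h1 := congrFun (congrFun (hleg q) i) j
    change S' q (i, j) = _ at h1
    rw [h1]
    simp only [Matrix.mul_apply, Fintype.sum_prod_type, Matrix.kroneckerMap_apply,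
      Matrix.transpose_apply, legMatrix, Matrix.of_apply, Finset.sum_mul]
    rw [Finset.sum_comm]
    exact Finset.sum_congr rfl fun a _ => Finset.sum_congr rfl fun b _ => by ring
  have hkron : (Rᵀᴴ * Rᵀ) ⊗ₖ (Qᴴ * Q) = 1 := by
    rw [hS'eq, Matrix.conjTranspose_mul, Matrix.mul_assoc, ← Matrix.mul_assoc Sᴴ, hS,
      Matrix.one_mul, Matrix.conjTranspose_kronecker, ← Matrix.mul_kronecker_mul] at hS'
    exact hS'
  obtain ⟨t, ht⟩ := kronecker_eq_one hD hkron
  have hRT0 : Rᵀ ≠ 0 := by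
    intro h0
    have : R = 0 := by rw [← Matrix.transpose_transpose R, h0, Matrix.transpose_zero]
    rw [this, Matrix.det_zero] at hRdet
    simp at hRdet
  obtain ⟨r, hr⟩ := exists_smul_isometry hRT0 ht
  set V : Matrix (Fin D) (Fin D) ℂ := r • Rᵀ with hV
  have hr0 : r ≠ 0 := by
    rintro rfl
    have := congrFun (congrFun hr ⟨0, hD⟩) ⟨0, hD⟩
    simp [hV] at this
  let W : Matrix (Fin D) (Fin D) ℂ := r⁻¹ • Q
  have hVW : V ⊗ₖ W = Rᵀ ⊗ₖ Q := by
    simp only [hV, W, Matrix.smul_kronecker, Matrix.kronecker_smul, smul_smul]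
    rw [inv_mul_cancel₀ hr0, one_smul]
  have hW : Wᴴ * W = 1 := by
    have h1 : (Vᴴ * V) ⊗ₖ (Wᴴ * W) = 1 := by
      rw [Matrix.mul_kronecker_mul, ← Matrix.conjTranspose_kronecker, hVW,
        Matrix.conjTranspose_kronecker, ← Matrix.mul_kronecker_mul, hkron]
    rw [hr] at h1
    ext i j
    have h2 := congrFun (congrFun h1 (⟨0, hD⟩, i)) (⟨0, hD⟩, j)
    simpa [Matrix.one_apply] using h2
  have hVV : V.map star * Vᵀ = 1 := by
    have h1 := congrArg Matrix.transpose hr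
    rw [Matrix.transpose_mul, Matrix.transpose_one] at h1
    exact mul_eq_one_comm.1 h1
  have hWΛ : W * Λ = c • (Λ * V.map star) := by
    have h1 : R⁻¹ = r • V.map star := by
      apply Matrix.inv_eq_left_inv
      rw [← hVV, hV, Matrix.smul_mul, Matrix.transpose_smul, Matrix.transpose_transpose,
        Matrix.mul_smul]
    simp only [W, Q, h1, Matrix.smul_mul, Matrix.mul_smul, smul_smul, Matrix.mul_assoc, hΛiΛ,
      Matrix.mul_one]
    congr 1
    field_simp
  have hΛh : Λᴴ = Λ := bondMatrix_conjTranspose lam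
  have hVsVs : V.map star * (V.map star)ᴴ = 1 := by
    have h1 : (V.map star)ᴴ = Vᵀ := by ext i j; simp
    rw [h1, hVV]
  have hW2 : W * (Λ * Λ) * Wᴴ = (c * star c) • (Λ * Λ) := by
    calc W * (Λ * Λ) * Wᴴ = (W * Λ) * (W * Λ)ᴴ := by
          rw [Matrix.conjTranspose_mul, hΛh]; simp only [Matrix.mul_assoc]
      _ = (c * star c) • (Λ * (V.map star * (V.map star)ᴴ) * Λ) := by
          rw [hWΛ, Matrix.conjTranspose_smul, Matrix.conjTranspose_mul, hΛh, Matrix.smul_mul,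
            Matrix.mul_smul, smul_smul]
          simp only [Matrix.mul_assoc]
      _ = _ := by rw [hVsVs, Matrix.mul_one]
  -- Both sides of `hW2` have the same trace as multiples of `Λ * Λ`.
  have hcc : c * star c = 1 := by
    have h1 := congrArg Matrix.trace hW2
    rw [Matrix.trace_mul_comm, ← Matrix.mul_assoc, hW, Matrix.one_mul, Matrix.trace_smul,
      trace_bondMatrix_sq hlam, smul_eq_mul, mul_one] at h1
    exact h1.symm
  have hcomm : W * Λ = Λ * W := by
    refine commute_bondMatrix_of_sq hpos ?_
    rw [hcc, one_smul] at hW2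
    calc W * (Λ * Λ) = W * (Λ * Λ) * (Wᴴ * W) := by rw [hW, Matrix.mul_one]
      _ = W * (Λ * Λ) * Wᴴ * W := by rw [Matrix.mul_assoc _ Wᴴ W]
      _ = _ := by rw [hW2]
  have hWV : W = c • V.map star := by
    calc W = Λi * (Λ * W) := by rw [← Matrix.mul_assoc, hΛiΛ, Matrix.one_mul]
      _ = Λi * (c • (Λ * V.map star)) := by rw [← hcomm, hWΛ]
      _ = _ := by rw [Matrix.mul_smul, ← Matrix.mul_assoc, hΛiΛ, Matrix.one_mul]
  have hc1 : c ∈ Submonoid.unitSphere ℂ := by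
    refine mem_sphere_zero_iff_norm.2 ?_
    rw [Complex.star_def, Complex.mul_conj] at hcc
    have h' : Complex.normSq c = 1 := by exact_mod_cast hcc
    rw [Complex.normSq_eq_norm_sq] at h'
    nlinarith [norm_nonneg c]
  have hc0 : c ≠ 0 := left_ne_zero_of_mul_eq_one hcc
  have hVΛ : V.map star * Λ = Λ * V.map star := by
    have h1 := hWΛ
    rw [hWV, Matrix.smul_mul] at h1
    exact smul_right_injective _ hc0 h1
  refine ⟨⟨c, hc1⟩, ⟨V, Matrix.mem_unitaryGroup_iff'.2 hr⟩, ?_, ?_⟩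
  · change S' = c • (S * (V ⊗ₖ V.map star))
    rw [hS'eq, ← hVW, hWV, Matrix.kronecker_smul, Matrix.mul_smul]
  · ext ⟨i, j⟩
    rw [conj_mulVec_bondVec]
    change (V.map star * Λ * Vᵀ) i j = _
    rw [hVΛ, Matrix.mul_assoc, hVV, Matrix.mul_one, hΛ, bondMatrix, Matrix.diagonal_apply, bondVec]

/-- A unitary is determined up to a phase by `X ⊗ X^*`, and unitaries of this form which are
proportional are equal. -/
lemma kronecker_star_eq_smul {X Y : Matrix (Fin D) (Fin D) ℂ} (hD : 0 < D) (hX : Xᴴ * X = 1)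
    (hY : Yᴴ * Y = 1) {a : ℂ} (h : X ⊗ₖ X.map star = a • (Y ⊗ₖ Y.map star)) :
    a = 1 ∧ ∃ w : Circle, X = (w : ℂ) • Y := by
  have hX' : X * Xᴴ = 1 := mul_eq_one_comm.1 hX
  have hY' : Y * Yᴴ = 1 := mul_eq_one_comm.1 hY
  have h1 : ∀ i j k l, X i j * star (X k l) = a * (Y i j * star (Y k l)) := by
    intro i j k l
    simpa using congrFun (congrFun h (i, k)) (j, l)
  have ha : a = 1 := by
    have h2 := congrFun (congrFun hX' ⟨0, hD⟩) ⟨0, hD⟩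
    have h3 := congrFun (congrFun hY' ⟨0, hD⟩) ⟨0, hD⟩
    simp only [Matrix.mul_apply, Matrix.conjTranspose_apply, Matrix.one_apply_eq] at h2 h3
    simp only [h1, ← Finset.mul_sum, h3, mul_one] at h2
    exact h2
  subst ha
  refine ⟨rfl, ?_⟩
  obtain ⟨k, l, hkl⟩ : ∃ k l, Y k l ≠ 0 := by
    by_contra! hcon
    have h0 : Y = 0 := Matrix.ext hcon
    rw [h0] at hY
    have := congrFun (congrFun hY ⟨0, hD⟩) ⟨0, hD⟩
    simp at this
  have hkk := h1 k l k l
  rw [one_mul] at hkk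
  have hXkl : X k l ≠ 0 := by
    intro h0
    rw [h0, zero_mul, eq_comm] at hkk
    simp [hkl] at hkk
  have hnorm : ‖X k l / Y k l‖ = 1 := by
    have h2 := congrArg norm hkk
    rw [norm_mul, norm_mul, norm_star, norm_star] at h2
    have h3 : ‖X k l‖ = ‖Y k l‖ := (mul_self_inj (norm_nonneg _) (norm_nonneg _)).1 h2
    rw [norm_div, h3, div_self (norm_ne_zero_iff.2 hkl)]
  refine ⟨⟨X k l / Y k l, mem_sphere_zero_iff_norm.2 hnorm⟩, ?_⟩
  ext i j
  change X i j = X k l / Y k l * Y i j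
  have h2 := h1 i j k l
  rw [one_mul] at h2
  have h3 : star (X k l) ≠ 0 := star_ne_zero.2 hXkl
  refine mul_right_cancel₀ h3 ?_
  rw [h2]
  field_simp
  linear_combination (-Y i j) * hkk

/-- By the symmetry, `U(g) S` defines the same state as `S`, so `exists_virtual_unitary` provides
`V(g)` and a phase `χ(g)`. As `S` is injective, `χ(g) [V(g) ⊗ V^*(g)]` is multiplicative in `g`, and
`kronecker_star_eq_smul` separates the two factors. -/
theorem exists_isVirtualRep {G : Type*} [CommGroup G] {S : Matrix (Fin p) (Fin D × Fin D) ℂ}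
    (hS : Sᴴ * S = 1) {lam : Fin D → ℝ} (hpos : ∀ k, 0 < lam k) (hlam : ∑ k, lam k ^ 2 = 1)
    {N : ℕ} [NeZero N] (hN : 3 ≤ N) (U : G →* Matrix.unitaryGroup (Fin p) ℂ)
    (hsymm : ∀ g, tensorPow (ZMod N) (U g : Matrix (Fin p) (Fin p) ℂ) *ᵥ fixedPointState N S lam
      = fixedPointState N S lam) :
    ∃ (χ : G →* Circle) (ω : G → G → Circle) (V : G → Matrix.unitaryGroup (Fin D) ℂ),
      IsVirtualRep U S lam χ ω V := by
  have hD : 0 < D := by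
    rcases Nat.eq_zero_or_pos D with rfl | hD
    · simp at hlam
    · exact hD
  have htensor : ∀ M : Matrix (Fin p) (Fin p) ℂ,
      tensorPow (ZMod N) M *ᵥ fixedPointState N S lam = fixedPointState N (M * S) lam := by
    intro M
    rw [fixedPointState, fixedPointState, Matrix.mulVec_mulVec]
    congr 1
    ext x y
    simp only [tensorPow, Matrix.mul_apply, Matrix.of_apply, Finset.prod_univ_sum,
      Fintype.piFinset_univ, Finset.prod_mul_distrib]
  have hloc : ∀ g, _ := fun g => exists_virtual_unitary hS
    (S' := (U g : Matrix (Fin p) (Fin p) ℂ) * S)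
    (by rw [Matrix.conjTranspose_mul, Matrix.mul_assoc,
          ← Matrix.mul_assoc (U g : Matrix (Fin p) (Fin p) ℂ)ᴴ,
          unitary_conjTranspose_mul_self, Matrix.one_mul, hS]) hpos hlam hN
    (by rw [← htensor, hsymm])
  choose c V hSV hbond using hloc
  have hmul : ∀ g h, ((c g * c h * (c (g * h))⁻¹ : Circle) : ℂ) = 1 ∧
      ∃ w : Circle, (V g : Matrix (Fin D) (Fin D) ℂ) * (V h : Matrix (Fin D) (Fin D) ℂ)
        = (w : ℂ) • (V (g * h) : Matrix (Fin D) (Fin D) ℂ) := by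
    intro g h
    have h1 : S * ((c (g * h) : ℂ) • ((V (g * h) : Matrix (Fin D) (Fin D) ℂ) ⊗ₖ
        (V (g * h) : Matrix (Fin D) (Fin D) ℂ).map star))
        = S * (((c g : ℂ) * c h) • (((V g : Matrix (Fin D) (Fin D) ℂ) *
          (V h : Matrix (Fin D) (Fin D) ℂ)) ⊗ₖ
          ((V g : Matrix (Fin D) (Fin D) ℂ) * (V h : Matrix (Fin D) (Fin D) ℂ)).map star)) := by
      rw [Matrix.mul_smul, ← hSV, map_mul, Matrix.UnitaryGroup.mul_val, Matrix.mul_assoc, hSV h,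
        Matrix.mul_smul, ← Matrix.mul_assoc, hSV g, ← map_star_mul, Matrix.mul_kronecker_mul,
        Matrix.smul_mul, Matrix.mul_smul, smul_smul, mul_comm (c g : ℂ), Matrix.mul_assoc]
    have h2 := congrArg (fun M => Sᴴ * M) h1
    simp only [← Matrix.mul_assoc, hS, Matrix.one_mul] at h2
    have hu : ∀ g, (V g : Matrix (Fin D) (Fin D) ℂ)ᴴ * (V g : Matrix (Fin D) (Fin D) ℂ) = 1 :=
      fun g => unitary_conjTranspose_mul_self (V g)
    obtain ⟨h3, w, hw⟩ := kronecker_star_eq_smul hD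
      (X := (V g : Matrix (Fin D) (Fin D) ℂ) * (V h : Matrix (Fin D) (Fin D) ℂ))
      (Y := (V (g * h) : Matrix (Fin D) (Fin D) ℂ))
      (a := (c (g * h) : ℂ) * ((c g : ℂ) * c h)⁻¹)
      (by rw [Matrix.conjTranspose_mul, Matrix.mul_assoc,
            ← Matrix.mul_assoc (V g : Matrix (Fin D) (Fin D) ℂ)ᴴ,
            hu, Matrix.one_mul, hu]) (hu _)
      (by
        have h0 : (c g : ℂ) * c h ≠ 0 := mul_ne_zero (Circle.coe_ne_zero _) (Circle.coe_ne_zero _)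
        rw [mul_comm, ← smul_smul, h2, smul_smul, inv_mul_cancel₀ h0, one_smul])
    refine ⟨?_, w, hw⟩
    have h4 := inv_eq_one.2 h3
    rw [mul_inv, inv_inv, mul_comm] at h4
    push_cast
    exact h4
  choose hc ω hω using hmul
  refine ⟨MonoidHom.mk' c fun g h => ?_, ω, V, hω, fun g => hSV g, hbond⟩
  have h1 : c g * c h * (c (g * h))⁻¹ = 1 := Circle.ext (by rw [hc]; simp)
  exact (mul_inv_eq_one.1 h1).symm

end Virtual

/-! ### Registers and charges -/

section Register

variable {α β K X Y Z : Type} [Fintype α] [DecidableEq α] [Fintype β] [DecidableEq β]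
  [Fintype K] [DecidableEq K] [Fintype X] [Fintype Y] [DecidableEq Y] [Fintype Z] [DecidableEq Z]
  {d : ℕ}

/-- `|κ⟩ ⊗ P`, an operator on `ℂ^d` which also writes `κ` into a register. -/
def withRegister (P : Matrix α (Fin d) ℂ) (κ : K) : Matrix (K × α) (Fin d) ℂ :=
  Matrix.of fun u i => if κ = u.1 then P u.2 i else 0

omit [DecidableEq α] [Fintype Y] in
lemma withRegister_orthonormal {P : Y → Matrix α (Fin d) ℂ}
    (hP : ∀ y y', (P y)ᴴ * P y' = if y = y' then 1 else 0) (y y' : K × Y) :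
    (withRegister (P y.2) y.1)ᴴ * withRegister (P y'.2) y'.1 = if y = y' then 1 else 0 := by
  ext i j
  have h := congrFun (congrFun (hP y.2 y'.2) i) j
  simp only [Matrix.mul_apply, Matrix.conjTranspose_apply] at h
  simp only [Matrix.mul_apply, Matrix.conjTranspose_apply, withRegister, Matrix.of_apply,
    Fintype.sum_prod_type, Prod.ext_iff]
  by_cases hy : y.1 = y'.1
  · rw [Finset.sum_eq_single y'.1]
    · simpa [hy] using h
    · intro κ _ hκ
      simp [hκ.symm]
    · simp
  · rw [Finset.sum_eq_zero]
    · simp [hy]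
    · intro κ _
      refine Finset.sum_eq_zero fun a _ => ?_
      by_cases h1 : y.1 = κ
      · simp [← h1, Ne.symm hy]
      · simp [h1]

omit [Fintype α] [DecidableEq α] [Fintype β] [DecidableEq β] in
lemma kronecker_maxEntangled_apply (M : Matrix α (Fin d) ℂ)
    (M' : Matrix β (Fin d) ℂ) (u v : α × β) :
    ((M ⊗ₖ M') * maxEntangled d * (M ⊗ₖ M')ᴴ) u v
      = (d : ℂ)⁻¹ * (M * M'ᵀ) u.1 u.2 * star ((M * M'ᵀ) v.1 v.2) := by
  have h1 : ∀ x : Fin d × Fin d, ((M ⊗ₖ M') * maxEntangled d) u x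
      = if x.1 = x.2 then (d : ℂ)⁻¹ * (M * M'ᵀ) u.1 u.2 else 0 := by
    intro x
    simp only [Matrix.mul_apply, Fintype.sum_prod_type, maxEntangled, Matrix.of_apply,
      Matrix.kroneckerMap_apply, Matrix.transpose_apply, ite_and]
    by_cases hx : x.1 = x.2
    · simp [hx, Finset.mul_sum, mul_comm]
    · simp [hx]
  rw [Matrix.mul_apply]
  simp only [h1, Matrix.conjTranspose_apply, Matrix.kroneckerMap_apply, Fintype.sum_prod_type]
  simp [Matrix.mul_apply, Finset.mul_sum]

/-- `loccEquivalent_maxEntangled` for states with a classical register held by either of the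
parties. -/
theorem loccEquivalent_register [NeZero d] {P : Y → Matrix α (Fin d) ℂ} {Q : Z → Matrix β (Fin d) ℂ}
    (hP : ∀ y y', (P y)ᴴ * P y' = if y = y' then 1 else 0)
    (hQ : ∀ z z', (Q z)ᴴ * Q z' = if z = z' then 1 else 0)
    (O : X → Matrix (Fin d) (Fin d) ℂ) (hO : ∀ x, (O x)ᴴ * O x = 1)
    (p : X → ℝ) (hp : ∀ x, 0 ≤ p x) (hsum : ∑ x, p x = 1) (f : X → Y) (g : X → Z) (k : X → K)
    (hfg : ∀ x x', f x = f x' → g x = g x' → k x = k x' → x = x')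
    (ρ : Matrix (K × α × β) (K × α × β) ℂ)
    (hρ : ∀ u v, ρ u v = ∑ x, if k x = u.1 ∧ k x = v.1 then (p x : ℂ) * ((d : ℂ)⁻¹ *
      (P (f x) * (Q (g x) * O x)ᵀ) u.2.1 u.2.2 *
      star ((P (f x) * (Q (g x) * O x)ᵀ) v.2.1 v.2.2)) else 0) :
    LOCCEquivalent (registerWithAlice ρ) (maxEntangled d) ∧
      LOCCEquivalent (registerWithBob ρ) (maxEntangled d) := by
  constructor
  · have h1 : registerWithAlice ρ = ∑ x, (p x : ℂ) •
        ((withRegister (P (f x)) (k x) ⊗ₖ (Q (g x) * O x)) * maxEntangled d *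
          (withRegister (P (f x)) (k x) ⊗ₖ (Q (g x) * O x))ᴴ) := by
      ext u v
      rw [Matrix.sum_apply, registerWithAlice, Matrix.submatrix_apply, hρ]
      refine Finset.sum_congr rfl fun x _ => ?_
      rw [Matrix.smul_apply, kronecker_maxEntangled_apply, smul_eq_mul]
      have h2 : ∀ w : (K × α) × β, (withRegister (P (f x)) (k x) * (Q (g x) * O x)ᵀ) w.1 w.2
          = if k x = w.1.1 then (P (f x) * (Q (g x) * O x)ᵀ) w.1.2 w.2 else 0 := by
        intro w
        rw [Matrix.mul_apply, Matrix.mul_apply]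
        split_ifs with hk <;> simp [withRegister, hk]
      rw [h2, h2]
      by_cases h : k x = u.1.1 ∧ k x = v.1.1
      · rw [if_pos h, if_pos h.1, if_pos h.2]
      · rw [if_neg h]
        rcases not_and_or.1 h with h | h <;> simp [h]
    rw [h1]
    exact loccEquivalent_maxEntangled (withRegister_orthonormal hP) hQ O hO p hp hsum
      (fun x => (k x, f x)) g fun x x' h h' =>
        hfg x x' (Prod.ext_iff.1 h).2 h' (Prod.ext_iff.1 h).1
  · have h1 : registerWithBob ρ = ∑ x, (p x : ℂ) •
        ((P (f x) ⊗ₖ (withRegister (Q (g x)) (k x) * O x)) * maxEntangled d *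
          (P (f x) ⊗ₖ (withRegister (Q (g x)) (k x) * O x))ᴴ) := by
      ext u v
      rw [Matrix.sum_apply, registerWithBob, Matrix.submatrix_apply, hρ]
      refine Finset.sum_congr rfl fun x _ => ?_
      rw [Matrix.smul_apply, kronecker_maxEntangled_apply, smul_eq_mul]
      have h2 : ∀ w : α × (K × β), (P (f x) * (withRegister (Q (g x)) (k x) * O x)ᵀ) w.1 w.2
          = if k x = w.2.1 then (P (f x) * (Q (g x) * O x)ᵀ) w.1 w.2.2 else 0 := by
        intro w
        simp only [Matrix.mul_apply, Matrix.transpose_apply]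
        split_ifs with hk <;> simp [withRegister, hk]
      rw [h2, h2]
      by_cases h : k x = u.2.1 ∧ k x = v.2.1
      · rw [if_pos h, if_pos h.1, if_pos h.2]
      · rw [if_neg h]
        rcases not_and_or.1 h with h | h <;> simp [h]
    rw [h1]
    exact loccEquivalent_maxEntangled hP (withRegister_orthonormal hQ) O hO p hp hsum
      f (fun x => (k x, g x)) fun x x' h h' =>
        hfg x x' h (Prod.ext_iff.1 h').2 (Prod.ext_iff.1 h').1

end Register

section Charge

variable {G : Type*} [CommGroup G] {m : Type} [Fintype m] [DecidableEq m]

/-- Vectors of distinct charges are orthogonal, so the projection of a sum of charged vectors onto a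
charge sector collects the terms of this charge. -/
lemma chargeProj_mulVec_sum {R : G → Matrix m m ℂ} (hR : ∀ g, (R g)ᴴ * R g = 1) {W : Type*}
    [Fintype W] [DecidableEq (G →* Circle)] (v : W → m → ℂ) (κ : W → (G →* Circle))
    (hv : ∀ w g, R g *ᵥ v w = (κ w g : ℂ) • v w) (κ₀ : G →* Circle) :
    chargeProj R κ₀ *ᵥ (∑ w, v w) = ∑ w, if κ w = κ₀ then v w else 0 := by
  have hproj : ∀ x : m → ℂ, chargeProj R κ₀ *ᵥ x
      = WithLp.ofLp ((chargeSector R κ₀).starProjection (WithLp.toLp 2 x)) := by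
    intro x
    have h : Matrix.toEuclideanLin (chargeProj R κ₀) = ((chargeSector R κ₀).starProjection :
        EuclideanSpace ℂ m →ₗ[ℂ] EuclideanSpace ℂ m) := by
      rw [chargeProj, LinearEquiv.apply_symm_apply]
    have h2 := LinearMap.congr_fun h (WithLp.toLp 2 x)
    exact congrArg WithLp.ofLp h2
  have hmem : ∀ (κ : G →* Circle) (x : EuclideanSpace ℂ m), x ∈ chargeSector R κ ↔
      ∀ g, R g *ᵥ WithLp.ofLp x = (κ g : ℂ) • WithLp.ofLp x := by
    intro κ x
    rw [chargeSector, Submodule.mem_iInf]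
    refine forall_congr' fun g => ?_
    rw [Module.End.mem_eigenspace_iff]
    constructor
    · intro h; exact congrArg WithLp.ofLp h
    · intro h; exact (WithLp.ofLp_injective 2) h
  rw [Matrix.mulVec_sum]
  refine Finset.sum_congr rfl fun w _ => ?_
  rw [hproj]
  split_ifs with hw
  · subst hw
    rw [Submodule.starProjection_eq_self_iff.2 ((hmem _ _).2 (hv w))]
  · have horth : WithLp.toLp 2 (v w) ∈ (chargeSector R κ₀)ᗮ := by
      rw [Submodule.mem_orthogonal]
      intro x hx
      rw [hmem] at hx
      obtain ⟨g, hg⟩ : ∃ g, κ w g ≠ κ₀ g := by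
        by_contra! h
        exact hw (MonoidHom.ext h)
      rw [EuclideanSpace.inner_eq_star_dotProduct]
      set y := WithLp.ofLp x
      change v w ⬝ᵥ star y = 0
      have h1 : (R g *ᵥ v w) ⬝ᵥ star (R g *ᵥ y) = v w ⬝ᵥ star y := by
        rw [Matrix.star_mulVec, dotProduct_comm, ← Matrix.dotProduct_mulVec, Matrix.mulVec_mulVec,
          hR, Matrix.one_mulVec, dotProduct_comm]
      rw [hv, hx, star_smul, smul_dotProduct, dotProduct_smul, smul_smul, smul_eq_mul] at h1
      have h2 : ((κ w g : ℂ) * star (κ₀ g : ℂ) - 1) * (v w ⬝ᵥ star y) = 0 := by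
        rw [sub_mul, one_mul, h1, sub_self]
      refine (mul_eq_zero.1 h2).resolve_left fun h3 => hg (Circle.ext ?_)
      calc (κ w g : ℂ) = (κ w g : ℂ) * star (κ₀ g : ℂ) * κ₀ g := by
            rw [mul_assoc, circle_star_mul, mul_one]
        _ = _ := by rw [sub_eq_zero.1 h3, one_mul]
    rw [(Submodule.starProjection_apply_eq_zero_iff _).2 horth]
    rfl

lemma mem_range_charge {R : G → Matrix m m ℂ} {K : Type} (reg : ChargeRegister R K) {v : m → ℂ}
    (hv0 : v ≠ 0) {κ : G →* Circle} (hv : ∀ g, R g *ᵥ v = (κ g : ℂ) • v) :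
    κ ∈ Set.range reg.charge := by
  refine reg.complete κ ((Submodule.ne_bot_iff _).2 ⟨WithLp.toLp 2 v, ?_, ?_⟩)
  · rw [chargeSector, Submodule.mem_iInf]
    intro g
    rw [Module.End.mem_eigenspace_iff]
    exact (WithLp.ofLp_injective 2) (hv g)
  · intro h
    exact hv0 (congrArg WithLp.ofLp h)

end Charge

section Region

variable {ι : Type} [Fintype ι] [DecidableEq ι] {m : Type} [Fintype m] [DecidableEq m]

lemma regionOp_unitary (C : Finset ι) {M : Matrix m m ℂ} (hM : Mᴴ * M = 1) :
    (regionOp C M)ᴴ * regionOp C M = 1 := by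
  have hi : ∀ i : ι, (if i ∈ C then M else 1)ᴴ * (if i ∈ C then M else 1) = 1 := by
    intro i
    split_ifs
    · exact hM
    · simp
  ext x y
  have h1 : ∀ i, ∑ q, star ((if i ∈ C then M else 1) q (x i)) * (if i ∈ C then M else 1) q (y i)
      = if x i = y i then 1 else 0 := by
    intro i
    have := congrFun (congrFun (hi i) (x i)) (y i)
    simpa [Matrix.mul_apply, Matrix.one_apply] using this
  simp only [Matrix.mul_apply, Matrix.conjTranspose_apply, regionOp, Matrix.of_apply, star_prod,
    ← Finset.prod_mul_distrib]
  rw [← Fintype.piFinset_univ, ← Finset.prod_univ_sum (fun _ => Finset.univ)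
    (fun i q => star ((if i ∈ C then M else 1) q (x i)) * (if i ∈ C then M else 1) q (y i))]
  simp only [h1, Matrix.one_apply, Finset.prod_ite_zero, Finset.prod_const_one, funext_iff,
    Finset.mem_univ, true_imp_iff]

/-- The action of an on-site operator on a region enumerated by `e`, on a function which depends on
the configuration of the region through the factor `b` only. -/
lemma regionOp_mulVec {C : Finset ι} {n : ℕ} {e : Fin n → ι} (he : Function.Injective e)
    (hC : ∀ i, i ∈ C ↔ i ∈ Set.range e) (M : Matrix m m ℂ) (b : (Fin n → m) → ℂ)
    (h : (ι → m) → ℂ) (hh : ∀ x y : ι → m, (∀ i ∉ C, x i = y i) → h x = h y) (x : ι → m) :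
    (regionOp C M *ᵥ fun y => b (fun t => y (e t)) * h y) x
      = (∑ u : Fin n → m, (∏ t, M (x (e t)) (u t)) * b u) * h x := by
  rw [Finset.sum_mul]
  symm
  refine Fintype.sum_of_injective (fun u : Fin n → m => Function.extend e u x) ?_ _ _ ?_ ?_
  · intro u u' huu
    funext t
    have := congrFun huu (e t)
    simpa [he.extend_apply] using this
  · intro y hy
    have : ∃ i, i ∉ C ∧ x i ≠ y i := by
      by_contra! hcon
      refine hy ⟨fun t => y (e t), ?_⟩
      funext i
      by_cases hi : i ∈ C
      · obtain ⟨t, rfl⟩ := (hC i).1 hi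
        simp [he.extend_apply]
      · have hi' : ¬ ∃ t, e t = i := fun ht => hi ((hC i).2 ht)
        simp only [Function.extend_apply' _ _ _ hi']
        exact hcon i hi
    obtain ⟨i, hi, hne⟩ := this
    have h0 : (regionOp C M) x y = 0 := by
      rw [regionOp, Matrix.of_apply]
      exact Finset.prod_eq_zero (Finset.mem_univ i) (by simp [hi, hne])
    exact (congrArg (· * _) h0).trans (zero_mul _)
  · intro u
    have h1 : (regionOp C M) x (Function.extend e u x) = ∏ t, M (x (e t)) (u t) := by
      rw [regionOp, Matrix.of_apply]
      symm
      refine Fintype.prod_of_injective e he _ _ ?_ ?_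
      · intro i hi
        have hiC : i ∉ C := fun h => hi ((hC i).1 h)
        rw [Function.extend_apply' _ _ _ hi]
        simp [hiC]
      · intro t
        have : e t ∈ C := (hC _).2 ⟨t, rfl⟩
        rw [he.extend_apply]
        simp [this]
    have h2 : h (Function.extend e u x) = h x := by
      refine hh _ _ fun i hi => ?_
      exact Function.extend_apply' _ _ _ fun ht => hi ((hC i).2 ht)
    have h3 : (fun t => Function.extend e u x (e t)) = u := funext fun t => he.extend_apply _ _ t
    change _ = regionOp C M x (Function.extend e u x) * (b (fun t => Function.extend e u x (e t)) *
      h (Function.extend e u x))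
    rw [h1, h2, h3, mul_assoc]

end Region

/-! ### Block tensors and their charges -/

section Block

variable {D p : ℕ}

/-- The tensor of a block of sites, with the two outermost virtual sites as indices. Since the site
matrices include the bond to their right, the weights of the last bond are divided out. -/
def blockTensor (S : Matrix (Fin p) (Fin D × Fin D) ℂ) (lam : Fin D → ℝ) {n : ℕ}
    (u : Fin n → Fin p) : Matrix (Fin D) (Fin D) ℂ :=
  chainProd (fun t => siteMatrix S lam (u t)) * Matrix.diagonal fun k => (lam k : ℂ)⁻¹

variable {S : Matrix (Fin p) (Fin D × Fin D) ℂ} {lam : Fin D → ℝ}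

lemma chainProd_eq_blockTensor_mul (hpos : ∀ k, 0 < lam k) {n : ℕ} (u : Fin n → Fin p) :
    chainProd (fun t => siteMatrix S lam (u t)) = blockTensor S lam u * bondMatrix lam := by
  have hl : ∀ k, (lam k : ℂ) ≠ 0 := fun k => by exact_mod_cast (hpos k).ne'
  have h : (Matrix.diagonal fun k => (lam k : ℂ)⁻¹) * bondMatrix lam = 1 := by
    simp only [bondMatrix, Matrix.diagonal_mul_diagonal, inv_mul_cancel₀ (hl _)]
    exact Matrix.diagonal_one
  rw [blockTensor, Matrix.mul_assoc, h, Matrix.mul_one]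

/-- The block tensor is an isometry from the two outer virtual sites to the sites of the block. -/
lemma sum_star_blockTensor (hS : Sᴴ * S = 1) (hpos : ∀ k, 0 < lam k)
    (hlam : ∑ k, lam k ^ 2 = 1) {n : ℕ} (hn : 0 < n) (i j i' j' : Fin D) :
    ∑ u : Fin n → Fin p, star (blockTensor S lam u i j) * blockTensor S lam u i' j'
      = if i = i' ∧ j = j' then 1 else 0 := by
  have hl : ∀ k, (lam k : ℂ) ≠ 0 := fun k => by exact_mod_cast (hpos k).ne'
  have h1 : ∀ u : Fin n → Fin p, star (blockTensor S lam u i j) * blockTensor S lam u i' j'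
      = ((lam j : ℂ)⁻¹ * (lam j' : ℂ)⁻¹) *
        (star (chainProd (fun t => siteMatrix S lam (u t)) i j) *
        chainProd (fun t => siteMatrix S lam (u t)) i' j') := by
    intro u
    rw [blockTensor, Matrix.mul_diagonal, Matrix.mul_diagonal, star_mul', star_inv₀]
    simp only [Complex.star_def, Complex.conj_ofReal]
    ring
  simp only [h1, ← Finset.mul_sum, sum_star_chainProd hS hlam hn]
  split_ifs with h
  · rw [← h.2]
    have := hl j
    field_simp
  · simp

lemma trace_transpose_mul (B Z : Matrix (Fin D) (Fin D) ℂ) :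
    (Bᵀ * Z).trace = ∑ q : Fin D × Fin D, B q.1 q.2 * Z q.1 q.2 := by
  rw [Fintype.sum_prod_type, Finset.sum_comm]
  simp [Matrix.trace, Matrix.mul_apply]

lemma sum_trace_blockTensor (hS : Sᴴ * S = 1) (hpos : ∀ k, 0 < lam k)
    (hlam : ∑ k, lam k ^ 2 = 1) {n : ℕ} (hn : 0 < n) (Z Z' : Matrix (Fin D) (Fin D) ℂ) :
    ∑ u : Fin n → Fin p, ((blockTensor S lam u)ᵀ * Z).trace *
      star ((blockTensor S lam u)ᵀ * Z').trace = (Z'ᴴ * Z).trace := by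
  have h0 : (Z'ᴴ * Z).trace = ∑ q : Fin D × Fin D, star (Z' q.1 q.2) * Z q.1 q.2 := by
    rw [Fintype.sum_prod_type, Finset.sum_comm]
    simp [Matrix.trace, Matrix.mul_apply]
  have h1 : ∀ q q' : Fin D × Fin D, ∑ u : Fin n → Fin p,
      (blockTensor S lam u q.1 q.2 * Z q.1 q.2) *
        star (blockTensor S lam u q'.1 q'.2 * Z' q'.1 q'.2)
      = if q' = q then star (Z' q'.1 q'.2) * Z q.1 q.2 else 0 := by
    intro q q'
    have h2 : ∀ u : Fin n → Fin p, (blockTensor S lam u q.1 q.2 * Z q.1 q.2) *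
        star (blockTensor S lam u q'.1 q'.2 * Z' q'.1 q'.2)
        = (star (Z' q'.1 q'.2) * Z q.1 q.2) *
          (star (blockTensor S lam u q'.1 q'.2) * blockTensor S lam u q.1 q.2) := by
      intro u
      rw [star_mul']
      ring
    simp only [h2, ← Finset.mul_sum, sum_star_blockTensor hS hpos hlam hn, Prod.ext_iff]
    split_ifs <;> simp
  simp only [trace_transpose_mul, star_sum, Finset.sum_mul_sum]
  rw [Finset.sum_comm, h0]
  refine Finset.sum_congr rfl fun q _ => ?_
  rw [Finset.sum_comm]
  simp only [h1, Finset.sum_ite_eq', Finset.mem_univ, if_true]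

lemma sum_prod_smul_chainProd {n : ℕ} (M : Matrix (Fin p) (Fin p) ℂ)
    (A : Fin p → Matrix (Fin D) (Fin D) ℂ) (x : Fin n → Fin p) :
    ∑ y : Fin n → Fin p, (∏ t, M (x t) (y t)) • chainProd (fun t => A (y t))
      = chainProd fun t => ∑ q, M (x t) q • A q := by
  induction n with
  | zero => simp [chainProd_zero]
  | succ n ih =>
    rw [sum_fin_cons, chainProd_succ, ← ih, Finset.sum_mul_sum]
    refine Finset.sum_congr rfl fun q _ => Finset.sum_congr rfl fun y _ => ?_
    rw [Fin.prod_univ_succ, chainProd_succ]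
    simp only [Fin.cons_zero, Fin.cons_succ, Matrix.smul_mul, Matrix.mul_smul, smul_smul]
    rw [mul_comm (M (x 0) q)]

lemma chainProd_conj {n : ℕ} (A : Fin n → Matrix (Fin D) (Fin D) ℂ) {c : ℂ}
    {R R' : Matrix (Fin D) (Fin D) ℂ} (hR : R' * R = 1) :
    chainProd (fun t => c • (R * A t * R')) = c ^ n • (R * chainProd A * R') := by
  induction n with
  | zero => simp [chainProd_zero, mul_eq_one_comm.1 hR]
  | succ n ih =>
    rw [chainProd_succ, ih, chainProd_succ, Matrix.smul_mul, Matrix.mul_smul, smul_smul, pow_succ']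
    congr 1
    calc _ = R * A 0 * (R' * R) * chainProd (fun i => A i.succ) * R' := by
          simp only [Matrix.mul_assoc]
      _ = _ := by rw [hR, Matrix.mul_one, Matrix.mul_assoc R (A 0)]

variable {G : Type*} [CommGroup G] {U : G →* Matrix.unitaryGroup (Fin p) ℂ} {χ : G →* Circle}
  {ω : G → G → Circle} {V : G → Matrix.unitaryGroup (Fin D) ℂ}

lemma star_mul_transpose_eq_one (A : Matrix.unitaryGroup (Fin D) ℂ) :
    (A : Matrix (Fin D) (Fin D) ℂ).map star * (A : Matrix (Fin D) (Fin D) ℂ)ᵀ = 1 := by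
  have h1 := congrArg Matrix.transpose (unitary_conjTranspose_mul_self A)
  rw [Matrix.transpose_mul, Matrix.transpose_one] at h1
  exact mul_eq_one_comm.1 h1

lemma IsVirtualRep.map_star_commute (h : IsVirtualRep U S lam χ ω V) (g : G) :
    (V g : Matrix (Fin D) (Fin D) ℂ).map star * bondMatrix lam
      = bondMatrix lam * (V g : Matrix (Fin D) (Fin D) ℂ).map star := by
  have h1 : (V g : Matrix (Fin D) (Fin D) ℂ).map star * bondMatrix lam *
      (V g : Matrix (Fin D) (Fin D) ℂ)ᵀ = bondMatrix lam := by
    ext i j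
    rw [← conj_mulVec_bondVec, h.bond_invariant, bondVec, bondMatrix, Matrix.diagonal_apply]
  have h2 := congrArg (· * (V g : Matrix (Fin D) (Fin D) ℂ).map star) h1
  simpa only [Matrix.mul_assoc, mul_eq_one_comm.1 (star_mul_transpose_eq_one (V g)),
    Matrix.mul_one] using h2

lemma IsVirtualRep.commute (h : IsVirtualRep U S lam χ ω V) (g : G) :
    (V g : Matrix (Fin D) (Fin D) ℂ) * bondMatrix lam
      = bondMatrix lam * (V g : Matrix (Fin D) (Fin D) ℂ) := by
  have h1 := congrArg (fun M => M.map star) (h.map_star_commute g)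
  simp only [← map_star_mul] at h1
  have h2 : (bondMatrix lam).map star = bondMatrix lam := by
    ext i j
    by_cases hij : i = j <;> simp [bondMatrix, hij]
  have h3 : ((V g : Matrix (Fin D) (Fin D) ℂ).map star).map star = V g := by
    ext i j
    exact star_star _
  rwa [h2, h3] at h1

lemma IsVirtualRep.sum_siteMatrix (h : IsVirtualRep U S lam χ ω V) (g : G) (q : Fin p) :
    ∑ q', (U g : Matrix (Fin p) (Fin p) ℂ) q q' • siteMatrix S lam q'
      = (χ g : ℂ) • ((V g : Matrix (Fin D) (Fin D) ℂ)ᵀ * siteMatrix S lam q *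
        (V g : Matrix (Fin D) (Fin D) ℂ).map star) := by
  have h1 : ∑ q', (U g : Matrix (Fin p) (Fin p) ℂ) q q' • legMatrix S q'
      = (χ g : ℂ) • ((V g : Matrix (Fin D) (Fin D) ℂ)ᵀ * legMatrix S q *
        (V g : Matrix (Fin D) (Fin D) ℂ).map star) := by
    ext i j
    have h2 := congrFun (congrFun (h.intertwine g) q) (i, j)
    simp only [Matrix.mul_apply, Matrix.smul_apply, smul_eq_mul, Fintype.sum_prod_type,
      Matrix.kroneckerMap_apply] at h2
    simp only [Matrix.sum_apply, Matrix.smul_apply, smul_eq_mul, legMatrix, Matrix.of_apply,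
      Matrix.mul_apply, Matrix.transpose_apply, Finset.sum_mul]
    rw [h2, Finset.sum_comm]
    congr 1
    exact Finset.sum_congr rfl fun a _ => Finset.sum_congr rfl fun b _ => by ring
  simp only [siteMatrix, ← Matrix.smul_mul, ← Finset.sum_mul, h1]
  rw [Matrix.smul_mul, Matrix.mul_assoc _ _ (bondMatrix lam), h.map_star_commute]
  simp only [Matrix.mul_assoc, Matrix.smul_mul]

/-- A block tensor contracted with an eigenvector `Z` of `X ↦ V(g) X V(g)ᴴ` is a vector of definite
charge. -/
lemma IsVirtualRep.sum_trace_blockTensor (h : IsVirtualRep U S lam χ ω V) (hpos : ∀ k, 0 < lam k)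
    {n : ℕ} (g : G) {Z : Matrix (Fin D) (Fin D) ℂ} {ζ : ℂ}
    (hZ : (V g : Matrix (Fin D) (Fin D) ℂ) * Z = ζ • (Z * (V g : Matrix (Fin D) (Fin D) ℂ)))
    (x : Fin n → Fin p) :
    ∑ y : Fin n → Fin p, (∏ t, (U g : Matrix (Fin p) (Fin p) ℂ) (x t) (y t)) *
        ((blockTensor S lam y)ᵀ * Z).trace
      = (χ g : ℂ) ^ n * ζ * ((blockTensor S lam x)ᵀ * Z).trace := by
  set Vg := (V g : Matrix (Fin D) (Fin D) ℂ) with hVg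
  set Λi : Matrix (Fin D) (Fin D) ℂ := Matrix.diagonal fun k => (lam k : ℂ)⁻¹ with hΛi
  have hl : ∀ k, (lam k : ℂ) ≠ 0 := fun k => by exact_mod_cast (hpos k).ne'
  have hΛΛi : bondMatrix lam * Λi = 1 := by
    simp only [bondMatrix, hΛi, Matrix.diagonal_mul_diagonal, mul_inv_cancel₀ (hl _)]
    exact Matrix.diagonal_one
  have hcomm : Vg.map star * Λi = Λi * Vg.map star := by
    calc _ = Λi * (bondMatrix lam * Vg.map star) * Λi := by
          rw [← Matrix.mul_assoc Λi, mul_eq_one_comm.1 hΛΛi, Matrix.one_mul]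
      _ = _ := by
          rw [← h.map_star_commute, Matrix.mul_assoc, Matrix.mul_assoc, hΛΛi, Matrix.mul_one]
  have h1 : ∑ y : Fin n → Fin p, (∏ t, (U g : Matrix (Fin p) (Fin p) ℂ) (x t) (y t)) •
      blockTensor S lam y = (χ g : ℂ) ^ n • (Vgᵀ * blockTensor S lam x * Vg.map star) := by
    simp only [blockTensor, ← hΛi, ← Matrix.smul_mul, ← Finset.sum_mul]
    rw [sum_prod_smul_chainProd]
    simp only [h.sum_siteMatrix]
    rw [chainProd_conj _ (star_mul_transpose_eq_one (V g)), ← hVg, Matrix.smul_mul,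
      Matrix.mul_assoc _ _ Λi, hcomm]
    simp only [Matrix.mul_assoc, Matrix.smul_mul]
  have h2 : ∑ y : Fin n → Fin p, (∏ t, (U g : Matrix (Fin p) (Fin p) ℂ) (x t) (y t)) *
        ((blockTensor S lam y)ᵀ * Z).trace
      = ((∑ y : Fin n → Fin p, (∏ t, (U g : Matrix (Fin p) (Fin p) ℂ) (x t) (y t)) •
        blockTensor S lam y)ᵀ * Z).trace := by
    rw [Matrix.transpose_sum, Matrix.sum_mul, Matrix.trace_sum]
    simp only [Matrix.transpose_smul, Matrix.smul_mul, Matrix.trace_smul, smul_eq_mul]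
  have h3 : (Vg.map star)ᵀ * Vg = 1 := unitary_conjTranspose_mul_self (V g)
  have h4 : Vg * (Vg.map star)ᵀ = 1 := mul_eq_one_comm.1 h3
  rw [h2, h1, Matrix.transpose_smul, Matrix.smul_mul, Matrix.trace_smul, smul_eq_mul,
    mul_assoc ((χ g : ℂ) ^ n)]
  congr 1
  calc _ = ((Vg.map star)ᵀ * ((blockTensor S lam x)ᵀ * (Vg * Z))).trace := by
        simp only [Matrix.transpose_mul, Matrix.transpose_transpose, Matrix.mul_assoc]
    _ = ζ * ((blockTensor S lam x)ᵀ * Z * (Vg * (Vg.map star)ᵀ)).trace := by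
        rw [hZ, Matrix.trace_mul_comm]
        simp only [Matrix.mul_smul, Matrix.smul_mul, Matrix.trace_smul, smul_eq_mul,
          Matrix.mul_assoc]
    _ = _ := by rw [h4, Matrix.mul_one]

end Block

section Bases

variable {D d n M : ℕ} {I : Fin n → Matrix (Fin D) (Fin d) ℂ}
  {O : Fin M → Matrix (Fin d) (Fin d) ℂ}

/-- Expansion of a `D × D` matrix in the orthogonal basis `I j * O μ * (I k)ᴴ`. -/
lemma smul_eq_sum_trace_smul (hI : ∑ j, I j * (I j)ᴴ = 1)
    (hO : ∀ i j i' j', ∑ μ, O μ i j * star (O μ i' j') = if i = i' ∧ j = j' then (d : ℂ) else 0)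
    (B : Matrix (Fin D) (Fin D) ℂ) :
    (d : ℂ) • B = ∑ j, ∑ k, ∑ μ, (Bᵀ * (I j * O μ * (I k)ᴴ)).trace •
      ((I j).map star * (O μ).map star * (I k)ᵀ) := by
  have hO' : ∀ Y : Matrix (Fin d) (Fin d) ℂ, ∑ μ, (Yᵀ * O μ).trace • (O μ).map star
      = (d : ℂ) • Y := by
    intro Y
    ext a b
    simp only [trace_transpose_mul, Matrix.sum_apply, Matrix.smul_apply, smul_eq_mul,
      Matrix.map_apply, Finset.sum_mul]
    rw [Finset.sum_comm]
    simp only [mul_assoc, ← Finset.mul_sum, hO, Fintype.sum_prod_type, ite_and]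
    simp [mul_comm]
  have hI' : ∑ j, (I j).map star * (I j)ᵀ = 1 := by
    have h1 := congrArg (fun M => Mᵀ) hI
    simp only [Matrix.transpose_sum, Matrix.transpose_mul, Matrix.transpose_one] at h1
    exact h1
  have h1 : ∀ j k, ∑ μ, (Bᵀ * (I j * O μ * (I k)ᴴ)).trace •
      ((I j).map star * (O μ).map star * (I k)ᵀ)
      = (d : ℂ) • (((I j).map star * (I j)ᵀ) * B * ((I k).map star * (I k)ᵀ)) := by
    intro j k
    have h2 : ∀ μ, (Bᵀ * (I j * O μ * (I k)ᴴ)).trace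
        = (((I j)ᵀ * B * (I k).map star)ᵀ * O μ).trace := by
      intro μ
      rw [← Matrix.mul_assoc, ← Matrix.mul_assoc, Matrix.trace_mul_comm]
      simp only [Matrix.transpose_mul, Matrix.transpose_transpose, Matrix.mul_assoc]
      rfl
    have h3 := congrArg (fun Y => (I j).map star * Y * (I k)ᵀ)
      (hO' ((I j)ᵀ * B * (I k).map star))
    simp only [Matrix.mul_sum, Matrix.sum_mul, Matrix.mul_smul, Matrix.smul_mul] at h3
    simp only [h2]
    rw [h3]
    simp only [Matrix.mul_assoc]
  simp only [h1, ← Finset.smul_sum, ← Matrix.mul_sum, hI', Matrix.mul_one, ← Matrix.sum_mul,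
    Matrix.one_mul]

lemma trace_basis_orthogonal (hI : ∀ j j', (I j)ᴴ * I j' = if j = j' then 1 else 0)
    (hO : ∀ μ ν, ∑ i, ∑ j, star (O μ i j) * O ν i j = if μ = ν then (d : ℂ) else 0)
    (j k j' k' : Fin n) (μ μ' : Fin M) :
    ((I j' * O μ' * (I k')ᴴ)ᴴ * (I j * O μ * (I k)ᴴ)).trace
      = if j' = j ∧ k' = k ∧ μ' = μ then (d : ℂ) else 0 := by
  have hO' : ((O μ')ᴴ * O μ).trace = if μ' = μ then (d : ℂ) else 0 := by
    rw [← hO, Finset.sum_comm]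
    simp [Matrix.trace, Matrix.mul_apply]
  have h1 : ((I j' * O μ' * (I k')ᴴ)ᴴ * (I j * O μ * (I k)ᴴ)).trace
      = ((O μ')ᴴ * ((I j')ᴴ * I j) * O μ * ((I k)ᴴ * I k')).trace := by
    rw [Matrix.conjTranspose_mul, Matrix.conjTranspose_mul, Matrix.conjTranspose_conjTranspose,
      Matrix.mul_assoc, Matrix.trace_mul_comm]
    simp only [Matrix.mul_assoc]
  rw [h1, hI, hI]
  by_cases hj : j' = j
  · by_cases hk : k' = k
    · simp [hj, hk, hO']
    · simp [hk, Ne.symm hk]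
  · simp [hj]

end Bases

/-! ### The state of register, `A` and `B` -/

section Glue

variable {ι : Type} [DecidableEq ι] {m : Type} {A B : Finset ι}

lemma glue_left (u : A → m) (v : B → m) (z : {i // i ∉ A ∪ B} → m) (i : A) :
    glue A B u v z i = u i := by
  simp [glue]

lemma glue_right (hAB : Disjoint A B) (u : A → m) (v : B → m) (z : {i // i ∉ A ∪ B} → m) (i : B) :
    glue A B u v z i = v i := by
  have h : (i : ι) ∉ A := fun hi => Finset.disjoint_left.1 hAB hi i.2
  simp [glue, h]

lemma glue_rest (u : A → m) (v : B → m) (z : {i // i ∉ A ∪ B} → m) (i : {i // i ∉ A ∪ B}) :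
    glue A B u v z i = z i := by
  have h := i.2
  rw [Finset.mem_union, not_or] at h
  simp [glue, h.1, h.2]

/-- The state `Ω` of a sum of vectors of definite charge on `C`, which are products of orthogonal
vectors `ε w` on the complement of `AB` and vectors `φ w` on `AB`. -/
lemma sptOmega_apply [Fintype ι] [Fintype m] [DecidableEq m] {G : Type*} [CommGroup G] {K : Type}
    [DecidableEq K] {U : G →* Matrix.unitaryGroup m ℂ} {C : Finset ι}
    (reg : ChargeRegister (fun g => regionOp C (U g : Matrix m m ℂ)) K)
    {W : Type*} [Fintype W] [DecidableEq W] (v : W → (ι → m) → ℂ) (κ : W → (G →* Circle))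
    (hv : ∀ w g, regionOp C (U g : Matrix m m ℂ) *ᵥ v w = (κ w g : ℂ) • v w) (k : W → K)
    (hk : ∀ w, reg.charge (k w) = κ w)
    (ε : W → ({i // i ∉ A ∪ B} → m) → ℂ) (φ : W → (A → m) → (B → m) → ℂ)
    (hfac : ∀ w u u' z, v w (glue A B u u' z) = ε w z * φ w u u') (c : W → ℂ)
    (horth : ∀ w w', ∑ z, ε w z * star (ε w' z) = if w = w' then c w else 0)
    (x y : K × (A → m) × (B → m)) :
    sptOmega U A B C reg (pureState (∑ w, v w)) x y
      = ∑ w, if k w = x.1 ∧ k w = y.1 then c w * φ w x.2.1 x.2.2 * star (φ w y.2.1 y.2.2) else 0 := by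
  classical
  rw [sptOmega, Matrix.of_apply]
  by_cases hxy : x.1 = y.1
  · rw [if_pos hxy, pureState, reduceAB, Matrix.of_apply]
    have hku : ∀ w, (κ w = reg.charge x.1) = (k w = x.1 ∧ k w = y.1) := by
      intro w
      rw [← hk, reg.injective.eq_iff, ← hxy, and_self]
    have h1 : ∀ z, (chargeProj (fun g => regionOp C (U g : Matrix m m ℂ)) (reg.charge x.1) *
        Matrix.vecMulVec (∑ w, v w) (star (∑ w, v w))) (glue A B x.2.1 x.2.2 z)
          (glue A B y.2.1 y.2.2 z)
        = ∑ w, ∑ w', (if κ w = reg.charge x.1 then φ w x.2.1 x.2.2 else 0) *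
          star (φ w' y.2.1 y.2.2) * (ε w z * star (ε w' z)) := by
      intro z
      rw [Matrix.mul_vecMulVec, chargeProj_mulVec_sum
        (fun g => regionOp_unitary C (unitary_conjTranspose_mul_self (U g))) v κ hv,
        Matrix.vecMulVec_apply, Pi.star_apply, Finset.sum_apply, Finset.sum_apply, star_sum,
        Finset.sum_mul_sum]
      refine Finset.sum_congr rfl fun w _ => Finset.sum_congr rfl fun w' _ => ?_
      rw [hfac, star_mul']
      split_ifs
      · rw [hfac]; ring
      · simp
    simp only [h1]
    rw [Finset.sum_comm]
    refine Finset.sum_congr rfl fun w _ => ?_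
    rw [Finset.sum_comm]
    simp only [← Finset.mul_sum, horth]
    simp only [mul_ite, mul_zero, Finset.sum_ite_eq, Finset.mem_univ, if_true, hku]
    split_ifs
    · ring
    · ring
  · rw [if_neg hxy, Finset.sum_eq_zero]
    intro w _
    rw [if_neg]
    rintro ⟨h1, h2⟩
    exact hxy (h1.symm.trans h2)

end Glue

section Ring

variable {N : ℕ}

lemma site_injective (s : ZMod N) {t t' : ℕ} (ht : t < N) (ht' : t' < N)
    (h : s + (t : ZMod N) = s + (t' : ZMod N)) : t = t' := by
  have h1 := (ZMod.natCast_eq_natCast_iff' t t' N).1 (add_left_cancel h)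
  rwa [Nat.mod_eq_of_lt ht, Nat.mod_eq_of_lt ht'] at h1

lemma exists_site [NeZero N] (s i : ZMod N) : ∃ t < N, i = s + (t : ZMod N) :=
  ⟨(i - s).val, ZMod.val_lt _, by rw [ZMod.natCast_zmod_val]; ring⟩

lemma mem_arc {s i : ZMod N} {n : ℕ} : i ∈ arc s n ↔ ∃ t < n, i = s + (t : ZMod N) := by
  simp [arc, eq_comm]

/-- Enumeration of the sites of `A`, of `B`, and of the other sites, which consist of `C` and the
remainder of the ring. -/
lemma exists_ring_partition (s : ZMod N) {a c b e : ℕ} (hN : N = a + c + b + e) [NeZero N]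
    {A B C : Finset (ZMod N)} (hA : A = arc s a) (hC : C = arc (s + (a : ZMod N)) c)
    (hB : B = arc (s + (a : ZMod N) + (c : ZMod N)) b) :
    ∃ (eA : Fin a ≃ A) (eB : Fin b ≃ B) (eZ : Fin c ⊕ Fin e ≃ {i // i ∉ A ∪ B}),
      (∀ t, (eA t : ZMod N) = s + ((t : ℕ) : ZMod N)) ∧
      (∀ t, (eB t : ZMod N) = s + ((a + c + t : ℕ) : ZMod N)) ∧
      (∀ t, (eZ (Sum.inl t) : ZMod N) = s + ((a + t : ℕ) : ZMod N)) ∧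
      (∀ t, (eZ (Sum.inr t) : ZMod N) = s + ((a + c + b + t : ℕ) : ZMod N)) ∧
      (∀ i, i ∈ C ↔ i ∈ Set.range fun t => (eZ (Sum.inl t) : ZMod N)) ∧
      Disjoint A B ∧ Disjoint A C ∧ Disjoint B C := by
  have hA' : ∀ i, i ∈ A ↔ ∃ t < a, i = s + (t : ZMod N) := fun i => by rw [hA, mem_arc]
  have hC' : ∀ i, i ∈ C ↔ ∃ t < c, i = s + ((a + t : ℕ) : ZMod N) := fun i => by
    rw [hC, mem_arc]; simp only [Nat.cast_add, add_assoc]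
  have hB' : ∀ i, i ∈ B ↔ ∃ t < b, i = s + ((a + c + t : ℕ) : ZMod N) := fun i => by
    rw [hB, mem_arc]; simp only [Nat.cast_add, add_assoc]
  have hinj := fun {t t' : ℕ} => site_injective s (t := t) (t' := t')
  have hAt : ∀ t < N, (s + (t : ZMod N) ∈ A ↔ t < a) := by
    intro t ht
    rw [hA']
    constructor
    · rintro ⟨t', ht', h⟩
      rw [hinj ht (by omega) h]; exact ht'
    · intro h; exact ⟨t, h, rfl⟩
  have hBt : ∀ t < N, (s + (t : ZMod N) ∈ B ↔ a + c ≤ t ∧ t < a + c + b) := by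
    intro t ht
    rw [hB']
    constructor
    · rintro ⟨t', ht', h⟩
      rw [hinj ht (by omega) h]; omega
    · rintro ⟨h, h'⟩
      exact ⟨t - (a + c), by omega, by rw [Nat.add_sub_cancel' h]⟩
  have hCt : ∀ t < N, (s + (t : ZMod N) ∈ C ↔ a ≤ t ∧ t < a + c) := by
    intro t ht
    rw [hC']
    constructor
    · rintro ⟨t', ht', h⟩
      rw [hinj ht (by omega) h]; omega
    · rintro ⟨h, h'⟩
      exact ⟨t - a, by omega, by rw [Nat.add_sub_cancel' h]⟩
  let fA : Fin a → A := fun t => ⟨s + ((t : ℕ) : ZMod N), (hAt _ (by omega)).2 t.2⟩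
  let fB : Fin b → B := fun t => ⟨s + ((a + c + t : ℕ) : ZMod N), (hBt _ (by omega)).2 (by omega)⟩
  let fZ : Fin c ⊕ Fin e → {i // i ∉ A ∪ B} := Sum.elim
    (fun t => ⟨s + ((a + t : ℕ) : ZMod N), by
      rw [Finset.mem_union, hAt _ (by omega), hBt _ (by omega)]; omega⟩)
    (fun t => ⟨s + ((a + c + b + t : ℕ) : ZMod N), by
      rw [Finset.mem_union, hAt _ (by omega), hBt _ (by omega)]; omega⟩)
  have hfA : Function.Bijective fA := by
    constructor
    · intro t t' h
      exact Fin.ext (hinj (by omega) (by omega) (congrArg Subtype.val h))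
    · rintro ⟨i, hi⟩
      obtain ⟨t, ht, rfl⟩ := (hA' i).1 hi
      exact ⟨⟨t, ht⟩, rfl⟩
  have hfB : Function.Bijective fB := by
    constructor
    · intro t t' h
      have := hinj (by omega) (by omega) (congrArg Subtype.val h)
      exact Fin.ext (by omega)
    · rintro ⟨i, hi⟩
      obtain ⟨t, ht, rfl⟩ := (hB' i).1 hi
      exact ⟨⟨t, ht⟩, rfl⟩
  have hfZ : Function.Bijective fZ := by
    constructor
    · rintro (t | t) (t' | t') h
      all_goals
        have := hinj (by omega) (by omega) (congrArg Subtype.val h)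
      · exact congrArg Sum.inl (Fin.ext (by omega))
      · omega
      · omega
      · exact congrArg Sum.inr (Fin.ext (by omega))
    · rintro ⟨i, hi⟩
      obtain ⟨t, ht, rfl⟩ := exists_site s i
      have hi' := hi
      rw [Finset.mem_union, hAt _ ht, hBt _ ht] at hi'
      by_cases htc : t < a + c
      · refine ⟨Sum.inl ⟨t - a, by omega⟩, Subtype.ext ?_⟩
        change s + ((a + (t - a) : ℕ) : ZMod N) = _
        rw [show a + (t - a) = t by omega]
      · refine ⟨Sum.inr ⟨t - (a + c + b), by omega⟩, Subtype.ext ?_⟩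
        change s + ((a + c + b + (t - (a + c + b)) : ℕ) : ZMod N) = _
        rw [show a + c + b + (t - (a + c + b)) = t by omega]
  refine ⟨Equiv.ofBijective fA hfA, Equiv.ofBijective fB hfB, Equiv.ofBijective fZ hfZ,
    fun _ => rfl, fun _ => rfl, fun _ => rfl, fun _ => rfl, fun i => ?_, ?_, ?_, ?_⟩
  · rw [hC']
    constructor
    · rintro ⟨t, ht, rfl⟩
      exact ⟨⟨t, ht⟩, rfl⟩
    · rintro ⟨t, rfl⟩
      exact ⟨t, t.2, rfl⟩
  all_goals
    rw [Finset.disjoint_left]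
    intro i h h'
    obtain ⟨t, ht, rfl⟩ := exists_site s i
    simp only [hAt _ ht, hBt _ ht, hCt _ ht] at h h'
    omega

/-- The trace over the other sites factors into `C` and the remainder of the ring. -/
lemma sum_rest_mul {ι₁ ι₂ : Type} [Fintype ι₁] [Fintype ι₂] [DecidableEq ι₁] [DecidableEq ι₂]
    {κ m : Type} [Fintype κ] [DecidableEq κ] [Fintype m] (e : ι₁ ⊕ ι₂ ≃ κ) (F : (ι₁ → m) → ℂ)
    (H : (ι₂ → m) → ℂ) :
    ∑ z : κ → m, F (fun t => z (e (Sum.inl t))) * H (fun t => z (e (Sum.inr t)))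
      = (∑ u, F u) * ∑ u, H u := by
  rw [← (Equiv.arrowCongr e (Equiv.refl m)).sum_comp,
    ← (Equiv.sumArrowEquivProdArrow ι₁ ι₂ m).symm.sum_comp, Fintype.sum_prod_type,
    Finset.sum_mul_sum]
  simp [Equiv.arrowCongr, Equiv.sumArrowEquivProdArrow]

end Ring

section Expansion

variable {D d n M p : ℕ} {lam : Fin D → ℝ} {I : Fin n → Matrix (Fin D) (Fin d) ℂ} {l : Fin n → ℂ}
  {O : Fin M → Matrix (Fin d) (Fin d) ℂ}

lemma bondMatrix_mul_map_star (hL : ∀ j, bondMatrix lam * I j = l j • I j) (j : Fin n) :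
    bondMatrix lam * (I j).map star = star (l j) • (I j).map star := by
  ext i a
  have h := congrArg star (congrFun (congrFun (hL j) i) a)
  simpa [bondMatrix, Matrix.diagonal_mul] using h

lemma transpose_mul_bondMatrix (hL : ∀ j, bondMatrix lam * I j = l j • I j) (j : Fin n) :
    (I j)ᵀ * bondMatrix lam = l j • (I j)ᵀ := by
  have h := congrArg Matrix.transpose (hL j)
  rwa [Matrix.transpose_mul, Matrix.transpose_smul, bondMatrix, Matrix.diagonal_transpose] at h

/-- The amplitude of a ring of four blocks, for the block tensors `BA`, `BC`, `BB` and `BE` in this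
order. The tensor `BC` is expanded in the basis `I j * O μ * (I k)ᴴ`, and the bonds next to it
contribute the factors `star (l j)` and `l k`, as `I j` maps to an eigenspace of the bond matrix. The
indices `a` and `b` of the bonds next to `BE` are summed explicitly. -/
lemma trace_ring_expansion (hd : (d : ℂ) ≠ 0) (hI : ∑ j, I j * (I j)ᴴ = 1)
    (hO : ∀ i j i' j', ∑ μ, O μ i j * star (O μ i' j') = if i = i' ∧ j = j' then (d : ℂ) else 0)
    (hL : ∀ j, bondMatrix lam * I j = l j • I j) (BA BC BB BE : Matrix (Fin D) (Fin D) ℂ) :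
    (BA * bondMatrix lam * (BC * bondMatrix lam) * (BB * bondMatrix lam) *
        (BE * bondMatrix lam)).trace
      = ∑ w : Fin n × Fin n × Fin M × Fin D × Fin D,
        (BCᵀ * (I w.1 * O w.2.2.1 * (I w.2.1)ᴴ)).trace *
        (((d : ℂ)⁻¹ * star (l w.1) * l w.2.1 * lam w.2.2.2.1 * lam w.2.2.2.2) *
          BE w.2.2.2.2 w.2.2.2.1 *
        (BA * (I w.1).map star * (O w.2.2.1).map star * ((I w.2.1)ᵀ * BB)) w.2.2.2.1
          w.2.2.2.2) := by
  have hBC : BC = (d : ℂ)⁻¹ • ∑ j, ∑ k, ∑ μ, (BCᵀ * (I j * O μ * (I k)ᴴ)).trace •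
      ((I j).map star * (O μ).map star * (I k)ᵀ) := by
    rw [← smul_eq_sum_trace_smul hI hO, smul_smul, inv_mul_cancel₀ hd, one_smul]
  have h1 : ∀ Z : Matrix (Fin D) (Fin D) ℂ, BA * bondMatrix lam * (Z * bondMatrix lam) *
      (BB * bondMatrix lam) * (BE * bondMatrix lam)
      = BA * bondMatrix lam * Z * (bondMatrix lam * BB * bondMatrix lam * BE * bondMatrix lam) := by
    intro Z
    simp only [Matrix.mul_assoc]
  have h2 : ∀ j k μ, (BA * bondMatrix lam * ((I j).map star * (O μ).map star * (I k)ᵀ) *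
      (bondMatrix lam * BB * bondMatrix lam * BE * bondMatrix lam)).trace
      = ∑ a, ∑ b, star (l j) * l k * lam a * lam b * BE b a *
        (BA * (I j).map star * (O μ).map star * ((I k)ᵀ * BB)) a b := by
    intro j k μ
    have h3 : BA * bondMatrix lam * ((I j).map star * (O μ).map star * (I k)ᵀ) *
      (bondMatrix lam * BB * bondMatrix lam * BE * bondMatrix lam)
        = (star (l j) * l k) • ((BA * (I j).map star * (O μ).map star * ((I k)ᵀ * BB)) *
          (bondMatrix lam * BE * bondMatrix lam)) := by
      calc _ = BA * (bondMatrix lam * (I j).map star) * (O μ).map star *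
            ((I k)ᵀ * bondMatrix lam) * (BB * bondMatrix lam * BE * bondMatrix lam) := by
            simp only [Matrix.mul_assoc]
        _ = _ := by
            rw [bondMatrix_mul_map_star hL, transpose_mul_bondMatrix hL]
            simp only [Matrix.mul_smul, Matrix.smul_mul, smul_smul, Matrix.mul_assoc]
            rw [mul_comm]
    have h4 : ∀ a b, (bondMatrix lam * BE * bondMatrix lam) b a = lam b * BE b a * lam a := by
      intro a b
      rw [bondMatrix, Matrix.mul_diagonal, Matrix.diagonal_mul]
    have h5 : ∀ X : Matrix (Fin D) (Fin D) ℂ, (X * (bondMatrix lam * BE * bondMatrix lam)).trace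
        = ∑ a, ∑ b, X a b * (lam b * BE b a * lam a) := fun X => by
      simp only [Matrix.trace, Matrix.diag, Matrix.mul_apply (M := X), h4]
    rw [h3, Matrix.trace_smul, h5, smul_eq_mul, Finset.mul_sum]
    refine Finset.sum_congr rfl fun a _ => ?_
    rw [Finset.mul_sum]
    exact Finset.sum_congr rfl fun b _ => by ring
  rw [h1]
  conv_lhs => rw [hBC]
  simp only [Matrix.mul_smul, Matrix.smul_mul, Matrix.sum_mul, Matrix.trace_smul,
    Matrix.trace_sum, h2, smul_eq_mul, Fintype.sum_prod_type, Finset.mul_sum]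
  refine Finset.sum_congr rfl fun j _ => Finset.sum_congr rfl fun k _ =>
    Finset.sum_congr rfl fun μ _ => Finset.sum_congr rfl fun a _ =>
    Finset.sum_congr rfl fun b _ => by ring

variable {S : Matrix (Fin p) (Fin D × Fin D) ℂ}

/-- Cut off from the remainder of the ring at a virtual site in the state `a`, and with its other
virtual site restricted to the range of `I j`, the block `A` yields an isometry for each pair
`(a, j)`; these isometries have orthogonal ranges. -/
lemma leftBlock_orthonormal (hS : Sᴴ * S = 1) (hpos : ∀ k, 0 < lam k)
    (hlam : ∑ k, lam k ^ 2 = 1) (hI : ∀ j j', (I j)ᴴ * I j' = if j = j' then 1 else 0)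
    {A : Type} [Fintype A] [DecidableEq A] {a : ℕ} (ha : 0 < a) (eA : Fin a ≃ A)
    (y y' : Fin D × Fin n) :
    (Matrix.of fun (u : A → Fin p) i =>
        (blockTensor S lam (fun t => u (eA t)) * (I y.2).map star) y.1 i)ᴴ *
      (Matrix.of fun (u : A → Fin p) i =>
        (blockTensor S lam (fun t => u (eA t)) * (I y'.2).map star) y'.1 i)
      = if y = y' then 1 else 0 := by
  ext i i'
  have h := congrFun (congrFun (hI y'.2 y.2) i') i
  rw [Matrix.mul_apply, ← (Equiv.arrowCongr eA (Equiv.refl (Fin p))).sum_comp]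
  have h1 : ∀ u : Fin a → Fin p, star ((blockTensor S lam u * (I y.2).map star) y.1 i) *
      (blockTensor S lam u * (I y'.2).map star) y'.1 i'
      = ∑ q, ∑ q', (I y.2 q i * star (I y'.2 q' i')) *
        (star (blockTensor S lam u y.1 q) * blockTensor S lam u y'.1 q') := by
    intro u
    rw [Matrix.mul_apply, Matrix.mul_apply, star_sum, Finset.sum_mul_sum]
    refine Finset.sum_congr rfl fun q _ => Finset.sum_congr rfl fun q' _ => ?_
    rw [star_mul', Matrix.map_apply, Matrix.map_apply, star_star]
    ring
  have h2 : ∑ u : Fin a → Fin p, star ((blockTensor S lam u * (I y.2).map star) y.1 i) *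
      (blockTensor S lam u * (I y'.2).map star) y'.1 i' = (if y = y' then 1 else 0 :
        Matrix (Fin d) (Fin d) ℂ) i i' := by
    simp only [h1]
    rw [Finset.sum_comm]
    have h3 : ∀ q, ∑ u : Fin a → Fin p, ∑ q', (I y.2 q i * star (I y'.2 q' i')) *
        (star (blockTensor S lam u y.1 q) * blockTensor S lam u y'.1 q')
        = if y.1 = y'.1 then star (I y'.2 q i') * I y.2 q i else 0 := by
      intro q
      rw [Finset.sum_comm]
      simp only [← Finset.mul_sum, sum_star_blockTensor hS hpos hlam ha, ite_and]
      by_cases hy : y.1 = y'.1 <;> simp [hy, mul_comm]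
    simp only [h3]
    by_cases hy : y.1 = y'.1
    · have h4 : ∑ q, star (I y'.2 q i') * I y.2 q i
          = (if y'.2 = y.2 then 1 else 0 : Matrix (Fin d) (Fin d) ℂ) i' i := by
        rw [← h, Matrix.mul_apply]
        rfl
      rw [Finset.sum_congr rfl fun q _ => if_pos hy, h4]
      simp only [Prod.ext_iff, hy, true_and]
      by_cases hy2 : y.2 = y'.2
      · rw [if_pos hy2, if_pos hy2.symm, Matrix.one_apply, Matrix.one_apply]
        simp only [eq_comm]
      · rw [if_neg hy2, if_neg (Ne.symm hy2)]
        rfl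
    · have : y ≠ y' := fun h => hy (congrArg Prod.fst h)
      simp [hy, this]
  rw [← h2]
  refine Finset.sum_congr rfl fun u _ => ?_
  simp [Equiv.arrowCongr]

/-- The analogue of `leftBlock_orthonormal` for the block `B`. -/
lemma rightBlock_orthonormal (hS : Sᴴ * S = 1) (hpos : ∀ k, 0 < lam k)
    (hlam : ∑ k, lam k ^ 2 = 1) (hI : ∀ j j', (I j)ᴴ * I j' = if j = j' then 1 else 0)
    {B : Type} [Fintype B] [DecidableEq B] {b : ℕ} (hb : 0 < b) (eB : Fin b ≃ B)
    (y y' : Fin D × Fin n) :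
    (Matrix.of fun (u : B → Fin p) i =>
        ((I y.2)ᵀ * blockTensor S lam (fun t => u (eB t))) i y.1)ᴴ *
      (Matrix.of fun (u : B → Fin p) i =>
        ((I y'.2)ᵀ * blockTensor S lam (fun t => u (eB t))) i y'.1)
      = if y = y' then 1 else 0 := by
  ext i i'
  have h := congrFun (congrFun (hI y.2 y'.2) i) i'
  rw [Matrix.mul_apply, ← (Equiv.arrowCongr eB (Equiv.refl (Fin p))).sum_comp]
  have h1 : ∀ u : Fin b → Fin p, star (((I y.2)ᵀ * blockTensor S lam u) i y.1) *
      ((I y'.2)ᵀ * blockTensor S lam u) i' y'.1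
      = ∑ q, ∑ q', (star (I y.2 q i) * I y'.2 q' i') *
        (star (blockTensor S lam u q y.1) * blockTensor S lam u q' y'.1) := by
    intro u
    rw [Matrix.mul_apply, Matrix.mul_apply, star_sum, Finset.sum_mul_sum]
    refine Finset.sum_congr rfl fun q _ => Finset.sum_congr rfl fun q' _ => ?_
    rw [star_mul', Matrix.transpose_apply, Matrix.transpose_apply]
    ring
  have h2 : ∑ u : Fin b → Fin p, star (((I y.2)ᵀ * blockTensor S lam u) i y.1) *
      ((I y'.2)ᵀ * blockTensor S lam u) i' y'.1 = (if y = y' then 1 else 0 :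
        Matrix (Fin d) (Fin d) ℂ) i i' := by
    simp only [h1]
    rw [Finset.sum_comm]
    have h3 : ∀ q, ∑ u : Fin b → Fin p, ∑ q', (star (I y.2 q i) * I y'.2 q' i') *
        (star (blockTensor S lam u q y.1) * blockTensor S lam u q' y'.1)
        = if y.1 = y'.1 then star (I y.2 q i) * I y'.2 q i' else 0 := by
      intro q
      rw [Finset.sum_comm]
      simp only [← Finset.mul_sum, sum_star_blockTensor hS hpos hlam hb, ite_and]
      by_cases hy : y.1 = y'.1 <;> simp [hy]
    simp only [h3]
    by_cases hy : y.1 = y'.1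
    · have h4 : ∑ q, star (I y.2 q i) * I y'.2 q i'
          = (if y.2 = y'.2 then 1 else 0 : Matrix (Fin d) (Fin d) ℂ) i i' := by
        rw [← h, Matrix.mul_apply]
        rfl
      rw [Finset.sum_congr rfl fun q _ => if_pos hy, h4]
      simp only [Prod.ext_iff, hy, true_and]
    · have : y ≠ y' := fun h => hy (congrArg Prod.fst h)
      simp [hy, this]
  rw [← h2]
  refine Finset.sum_congr rfl fun u _ => ?_
  simp [Equiv.arrowCongr]

end Expansion

/-! ### Entanglement between `A` and `B` given the charge of `C` -/

section Weights

variable {D d n M : ℕ} {lam : Fin D → ℝ} {I : Fin n → Matrix (Fin D) (Fin d) ℂ} {l : Fin n → ℂ}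
  {O : Fin M → Matrix (Fin d) (Fin d) ℂ}

/-- The squared Schmidt coefficients of a bond, each of which occurs `d` times in a copy of the
irrep, sum to one. -/
lemma sum_normSq_schmidt (hlam : ∑ k, lam k ^ 2 = 1)
    (hI : ∀ j j', (I j)ᴴ * I j' = if j = j' then 1 else 0) (hI1 : ∑ j, I j * (I j)ᴴ = 1)
    (hL : ∀ j, bondMatrix lam * I j = l j • I j) :
    (∑ j, Complex.normSq (l j)) * d = 1 := by
  have h1 : bondMatrix lam * bondMatrix lam
      = ∑ j, (bondMatrix lam * I j) * (bondMatrix lam * I j)ᴴ := by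
    simp only [Matrix.conjTranspose_mul, bondMatrix_conjTranspose, ← Matrix.mul_assoc]
    rw [← Matrix.sum_mul]
    simp only [Matrix.mul_assoc (bondMatrix lam)]
    rw [← Matrix.mul_sum, hI1, Matrix.mul_one]
  have h2 := trace_bondMatrix_sq hlam
  rw [h1, Matrix.trace_sum] at h2
  have h3 : ∀ j, ((bondMatrix lam * I j) * (bondMatrix lam * I j)ᴴ).trace
      = ((Complex.normSq (l j) * d : ℝ) : ℂ) := by
    intro j
    rw [hL, Matrix.conjTranspose_smul, Matrix.smul_mul, Matrix.mul_smul, smul_smul,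
      Matrix.trace_smul, Matrix.trace_mul_comm, hI, if_pos rfl, Matrix.trace_one, Fintype.card_fin,
      Complex.star_def, Complex.mul_conj, smul_eq_mul]
    push_cast
    rfl
  simp only [h3] at h2
  rw [Finset.sum_mul]
  exact_mod_cast h2

/-- An orthogonal basis of the `d × d` matrices has `d²` elements: `∑ μ, tr((O μ)ᴴ O μ)` is evaluated
by orthogonality and by completeness. -/
lemma card_adjoint_eigenbasis (hd : (d : ℂ) ≠ 0)
    (hO : ∀ μ ν, ∑ i, ∑ j, star (O μ i j) * O ν i j = if μ = ν then (d : ℂ) else 0)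
    (hO1 : ∀ i j i' j', ∑ μ, O μ i j * star (O μ i' j') = if i = i' ∧ j = j' then (d : ℂ) else 0) :
    M = d * d := by
  have h1 : ∑ μ, ∑ i, ∑ j, star (O μ i j) * O μ i j = (M : ℂ) * d := by
    simp only [hO]
    simp
  have h2 : ∑ μ, ∑ i, ∑ j, star (O μ i j) * O μ i j = (d : ℂ) * d * d := by
    rw [Finset.sum_comm]
    have h3 : ∀ i, ∑ μ, ∑ j, star (O μ i j) * O μ i j = (d : ℂ) * d := by
      intro i
      rw [Finset.sum_comm]
      simp only [mul_comm (star _), hO1]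
      simp
    simp only [h3]
    simp [mul_assoc]
  have h4 := mul_right_cancel₀ hd (h1.symm.trans h2)
  exact_mod_cast h4

lemma sum_weights (hd : (d : ℂ) ≠ 0) (hlam : ∑ k, lam k ^ 2 = 1)
    (hI : ∀ j j', (I j)ᴴ * I j' = if j = j' then 1 else 0) (hI1 : ∑ j, I j * (I j)ᴴ = 1)
    (hL : ∀ j, bondMatrix lam * I j = l j • I j)
    (hO : ∀ μ ν, ∑ i, ∑ j, star (O μ i j) * O ν i j = if μ = ν then (d : ℂ) else 0)
    (hO1 : ∀ i j i' j', ∑ μ, O μ i j * star (O μ i' j') = if i = i' ∧ j = j' then (d : ℂ) else 0) :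
    ∑ w : Fin n × Fin n × Fin M × Fin D × Fin D, Complex.normSq (l w.1) *
      Complex.normSq (l w.2.1) * (lam w.2.2.2.1 ^ 2 * lam w.2.2.2.2 ^ 2) = 1 := by
  have h1 := sum_normSq_schmidt hlam hI hI1 hL
  have h2 := card_adjoint_eigenbasis hd hO hO1
  simp only [Fintype.sum_prod_type, ← Finset.mul_sum, hlam, mul_one, Finset.sum_const,
    Finset.card_univ, Fintype.card_fin, nsmul_eq_mul, h2, ← Finset.sum_mul]
  push_cast
  linear_combination ((∑ j, Complex.normSq (l j)) * d + 1) * h1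

end Weights

section Sectors

variable {D d n M p : ℕ} {G : Type*} [CommGroup G] {ω : G → G → Circle}
  {V : G → Matrix.unitaryGroup (Fin D) ℂ} {T : G → Matrix.unitaryGroup (Fin d) ℂ}

/-- The matrices `I j * O μ * (I k)ᴴ` are eigenvectors of `X ↦ V(g) X V(g)ᴴ`. -/
lemma mul_basis_eq_smul (hT : IsProjRep ω T) (hV : IsProjRep ω V)
    {I J : Matrix (Fin D) (Fin d) ℂ} {O : Matrix (Fin d) (Fin d) ℂ} {θ η κ : G →* Circle}
    (hI : ∀ g, (V g : Matrix (Fin D) (Fin D) ℂ) * I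
      = (θ g : ℂ) • (I * (T g : Matrix (Fin d) (Fin d) ℂ)))
    (hJ : ∀ g, (V g : Matrix (Fin D) (Fin D) ℂ) * J
      = (η g : ℂ) • (J * (T g : Matrix (Fin d) (Fin d) ℂ)))
    (hO : ∀ g, (T g : Matrix (Fin d) (Fin d) ℂ) * O
      = (κ g : ℂ) • (O * (T g : Matrix (Fin d) (Fin d) ℂ))) (g : G) :
    (V g : Matrix (Fin D) (Fin D) ℂ) * (I * O * Jᴴ)
      = ((θ * η⁻¹ * κ) g : ℂ) • (I * O * Jᴴ * (V g : Matrix (Fin D) (Fin D) ℂ)) := by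
  have hVu := hV.isProjUnitary
  have hTu := hT.isProjUnitary
  have hJ' := hVu.mul_conjTranspose hTu (hJ g)
  have h3 : ((θ * η⁻¹ * κ) g : ℂ) = θ g * star (η g : ℂ) * κ g := by
    simp only [MonoidHom.mul_apply, MonoidHom.inv_apply, Circle.coe_mul, Circle.coe_inv_eq_conj,
      Complex.star_def]
  calc (V g : Matrix (Fin D) (Fin D) ℂ) * (I * O * Jᴴ)
      = (V g : Matrix (Fin D) (Fin D) ℂ) * I * O * Jᴴ := by simp only [Matrix.mul_assoc]
    _ = (θ g : ℂ) • (I * ((T g : Matrix (Fin d) (Fin d) ℂ) * O) * Jᴴ) := by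
        rw [hI]; simp only [Matrix.mul_assoc, Matrix.smul_mul]
    _ = ((θ g : ℂ) * κ g) • (I * O * ((T g : Matrix (Fin d) (Fin d) ℂ) * Jᴴ)) := by
        rw [hO]; simp only [Matrix.mul_assoc, Matrix.smul_mul, Matrix.mul_smul, smul_smul]
    _ = _ := by
        rw [hJ', h3, Matrix.mul_smul, smul_smul]
        simp only [Matrix.mul_assoc]
        congr 1
        ring

/-- In the presence of a virtual representation with factor system `ω`, the state `Ω` is
LOCC-equivalent to a maximally entangled state whose local dimension is that of the irreps with
factor system `ω`. The remaining `e` sites of the ring lie between `B` and `A`. The amplitude of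
`Ψ` is a sum of terms labelled by `w = (j, k, μ, a, b)`: the copies `j` and `k` of the irrep on the
bonds `AC` and `CB`, the element `μ` of the adjoint eigenbasis transmitted by `C`, and the states `a`
and `b` of the outer virtual sites of `A` and `B`. Each term has a definite charge on `C`, and is
on `AB` a maximally entangled state twisted by the unitary `O μ`. The local labels `(a, j)` and
`(b, k)` can be measured locally, and together with the charge they determine `μ`. -/
theorem loccEquivalent_sptOmega {N : ℕ} [NeZero N] {lam : Fin D → ℝ} (hpos : ∀ k, 0 < lam k)
    (hlam : ∑ k, lam k ^ 2 = 1) {S : Matrix (Fin p) (Fin D × Fin D) ℂ} (hS : Sᴴ * S = 1)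
    {U : G →* Matrix.unitaryGroup (Fin p) ℂ} {χ : G →* Circle} (hV : IsVirtualRep U S lam χ ω V)
    (hT : IsProjRep ω T) (hTi : IsIrred T) (s : ZMod N) {a c b e : ℕ} (ha : 0 < a) (hc : 0 < c)
    (hb : 0 < b) (he : 0 < e) (hN : N = a + c + b + e) {A B C : Finset (ZMod N)}
    (hA : A = arc s a) (hC : C = arc (s + (a : ZMod N)) c)
    (hB : B = arc (s + (a : ZMod N) + (c : ZMod N)) b) {K : Type} [Fintype K] [DecidableEq K]
    (reg : ChargeRegister (fun g => regionOp C (U g : Matrix (Fin p) (Fin p) ℂ)) K) :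
    LOCCEquivalent (registerWithAlice (sptOmega U A B C reg (pureState (fixedPointState N S lam))))
        (maxEntangled d) ∧
      LOCCEquivalent (registerWithBob (sptOmega U A B C reg (pureState (fixedPointState N S lam))))
        (maxEntangled d) := by
  have : NeZero d := ⟨hTi.1.ne'⟩
  have hd : (d : ℂ) ≠ 0 := by exact_mod_cast hTi.1.ne'
  obtain ⟨n, I, θ, l, hI, hI1, hIV, hL⟩ := exists_isotypic_decomposition
    hV.projRep.isProjUnitary hT hTi (bondMatrix_conjTranspose lam) hV.commute
  obtain ⟨M, O, κ, hκ, hOu, hO, hO1, hOT⟩ := exists_adjoint_eigenbasis hT hTi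
  obtain ⟨eA, eB, eZ, heA, heB, heC, heE, hCr, hAB, hAC, hBC⟩ :=
    exists_ring_partition s hN hA hC hB
  let W := Fin n × Fin n × Fin M × Fin D × Fin D
  -- The component `w` of the tensor of `C` has its contraction with `Z w` as coefficient.
  let Z : W → Matrix (Fin D) (Fin D) ℂ := fun w => I w.1 * O w.2.2.1 * (I w.2.1)ᴴ
  let coef : W → ℂ := fun w =>
    (d : ℂ)⁻¹ * star (l w.1) * l w.2.1 * lam w.2.2.2.1 * lam w.2.2.2.2
  let P : Fin D × Fin n → Matrix (A → Fin p) (Fin d) ℂ := fun y => Matrix.of fun u i =>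
    (blockTensor S lam (fun t => u (eA t)) * (I y.2).map star) y.1 i
  let Q : Fin D × Fin n → Matrix (B → Fin p) (Fin d) ℂ := fun y => Matrix.of fun u i =>
    ((I y.2)ᵀ * blockTensor S lam (fun t => u (eB t))) i y.1
  let f : W → Fin D × Fin n := fun w => (w.2.2.2.1, w.1)
  let g : W → Fin D × Fin n := fun w => (w.2.2.2.2, w.2.1)
  -- `v w = ε w * φ w` is the term `w` of the amplitude of `Ψ`, where `φ w` belongs to `AB` and
  -- `ε w` to the other sites; `q w` is its charge on `C` and `wt w` its probability.
  let φ : W → (A → Fin p) → (B → Fin p) → ℂ := fun w u u' =>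
    (P (f w) * (Q (g w) * (O w.2.2.1)ᴴ)ᵀ) u u'
  let ε : W → ({i // i ∉ A ∪ B} → Fin p) → ℂ := fun w z =>
    ((blockTensor S lam fun t => z (eZ (Sum.inl t)))ᵀ * Z w).trace *
      (coef w * blockTensor S lam (fun t => z (eZ (Sum.inr t))) w.2.2.2.2 w.2.2.2.1)
  let v : W → (ZMod N → Fin p) → ℂ := fun w x =>
    ε w (fun i => x i) * φ w (fun i => x i) (fun i => x i)
  let q : W → (G →* Circle) := fun w => χ ^ c * (θ w.1 * (θ w.2.1)⁻¹ * κ w.2.2.1)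
  let wt : W → ℝ := fun w => Complex.normSq (l w.1) *
      Complex.normSq (l w.2.1) * (lam w.2.2.2.1 ^ 2 * lam w.2.2.2.2 ^ 2)
  have hφ : ∀ w u u', φ w u u' = (blockTensor S lam (fun t => u (eA t)) * (I w.1).map star *
      (O w.2.2.1).map star * ((I w.2.1)ᵀ * blockTensor S lam (fun t => u' (eB t))))
        w.2.2.2.1 w.2.2.2.2 := by
    intro w u u'
    simp only [φ, P, Q, f, g]
    rw [Matrix.transpose_mul, ← Matrix.mul_assoc, Matrix.mul_apply, Matrix.mul_apply]
    refine Finset.sum_congr rfl fun i _ => ?_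
    congr 1
  have hfac : ∀ w u u' z, v w (glue A B u u' z) = ε w z * φ w u u' := by
    intro w u u' z
    simp only [v, glue_left, glue_right hAB, glue_rest]
  have hΨ : fixedPointState N S lam = ∑ w, v w := by
    funext x
    subst hN
    rw [fixedPointState_eq_trace S lam s, chainProd_add, chainProd_add, chainProd_add]
    simp only [Fin.val_castAdd, Fin.val_natAdd, ← heA, ← heB, ← heC, ← heE]
    rw [chainProd_eq_blockTensor_mul hpos (fun t => x (eA t)),
      chainProd_eq_blockTensor_mul hpos (fun t => x (eB t)),
      chainProd_eq_blockTensor_mul hpos (fun t => x (eZ (Sum.inl t))),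
      chainProd_eq_blockTensor_mul hpos (fun t => x (eZ (Sum.inr t))),
      trace_ring_expansion hd hI1 hO1 hL, Finset.sum_apply]
    refine Finset.sum_congr rfl fun w _ => ?_
    simp only [v, ε, hφ, coef, Z, mul_assoc]
  have hZ : ∀ w g, (V g : Matrix (Fin D) (Fin D) ℂ) * Z w
      = ((θ w.1 * (θ w.2.1)⁻¹ * κ w.2.2.1) g : ℂ) • (Z w * (V g : Matrix (Fin D) (Fin D) ℂ)) :=
    fun w g => mul_basis_eq_smul hT hV.projRep (hIV w.1) (hIV w.2.1) (hOT w.2.2.1) g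
  have hCinj : Function.Injective fun t => (eZ (Sum.inl t) : ZMod N) := fun t t' h =>
    Sum.inl_injective (eZ.injective (Subtype.ext h))
  have hreg : ∀ w (h : (ZMod N → Fin p) → ℂ), (∀ x y, (∀ i ∉ C, x i = y i) → h x = h y) →
      ∀ g, regionOp C (U g : Matrix (Fin p) (Fin p) ℂ) *ᵥ (fun x =>
        ((blockTensor S lam fun t => x (eZ (Sum.inl t)))ᵀ * Z w).trace * h x)
        = (q w g : ℂ) • fun x =>
          ((blockTensor S lam fun t => x (eZ (Sum.inl t)))ᵀ * Z w).trace * h x := by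
    intro w h hh g
    funext x
    rw [regionOp_mulVec hCinj hCr (U g : Matrix (Fin p) (Fin p) ℂ)
      (fun u => ((blockTensor S lam u)ᵀ * Z w).trace) h hh x,
      hV.sum_trace_blockTensor hpos g (hZ w g), Pi.smul_apply, smul_eq_mul]
    simp only [q, MonoidHom.mul_apply, MonoidHom.pow_apply, Circle.coe_mul, Circle.coe_pow]
    ring
  have hv : ∀ w g, regionOp C (U g : Matrix (Fin p) (Fin p) ℂ) *ᵥ v w = (q w g : ℂ) • v w := by
    intro w g
    have h := hreg w (fun x => coef w * blockTensor S lam (fun t => x (eZ (Sum.inr t)))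
      w.2.2.2.2 w.2.2.2.1 * φ w (fun i => x i) (fun i => x i)) ?_ g
    · simpa only [v, ε, mul_assoc] using h
    · intro x y hxy
      have h1 : (fun i : A => x i) = fun i : A => y i :=
        funext fun i => hxy i (Finset.disjoint_left.1 hAC i.2)
      have h2 : (fun i : B => x i) = fun i : B => y i :=
        funext fun i => hxy i (Finset.disjoint_left.1 hBC i.2)
      have h3 : (fun t => x (eZ (Sum.inr t))) = fun t => y (eZ (Sum.inr t)) := by
        refine funext fun t => hxy _ fun ht => ?_
        obtain ⟨t', ht'⟩ := (hCr _).1 ht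
        exact Sum.inl_ne_inr (eZ.injective (Subtype.ext ht'))
      simp only [h1, h2, h3]
  have htr : ∀ w w', ((Z w')ᴴ * Z w).trace
      = if w'.1 = w.1 ∧ w'.2.1 = w.2.1 ∧ w'.2.2.1 = w.2.2.1 then (d : ℂ) else 0 :=
    fun w w' => trace_basis_orthogonal hI hO _ _ _ _ _ _
  -- The charge of `v w` occurs even if `v w` vanishes: the tensor of `C` contracted with `Z w` has
  -- squared norm `tr((Z w)ᴴ Z w) = d`.
  have hqr : ∀ w, q w ∈ Set.range reg.charge := by
    intro w
    refine mem_range_charge reg (v := fun x : ZMod N → Fin p =>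
      ((blockTensor S lam fun t => x (eZ (Sum.inl t)))ᵀ * Z w).trace * 1) ?_
      (hreg w (fun _ => 1) fun _ _ _ => rfl)
    intro h0
    have h1 := sum_trace_blockTensor hS hpos hlam hc (Z w) (Z w)
    rw [htr, if_pos ⟨rfl, rfl, rfl⟩, Finset.sum_eq_zero] at h1
    · exact hd h1.symm
    · intro u _
      have h2 := congrFun h0 (Function.extend (fun t => (eZ (Sum.inl t) : ZMod N)) u
        fun _ => u ⟨0, hc⟩)
      simp only [hCinj.extend_apply, mul_one, Pi.zero_apply] at h2
      rw [h2, zero_mul]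
  choose k hk using hqr
  have horth : ∀ w w', ∑ z, ε w z * star (ε w' z)
      = if w = w' then (wt w : ℂ) * (d : ℂ)⁻¹ else 0 := by
    intro w w'
    have h1 := sum_rest_mul eZ
      (fun u : Fin c → Fin p => ((blockTensor S lam u)ᵀ * Z w).trace *
        star ((blockTensor S lam u)ᵀ * Z w').trace)
      (fun u : Fin e → Fin p => coef w * star (coef w') *
        (star (blockTensor S lam u w'.2.2.2.2 w'.2.2.2.1) *
          blockTensor S lam u w.2.2.2.2 w.2.2.2.1))
    rw [← Finset.mul_sum, sum_star_blockTensor hS hpos hlam he,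
      sum_trace_blockTensor hS hpos hlam hc, htr] at h1
    refine Eq.trans (Finset.sum_congr rfl fun z _ => ?_) (h1.trans ?_)
    · simp only [ε, star_mul']
      ring
    · by_cases hw : w = w'
      · subst hw
        rw [if_pos ⟨rfl, rfl, rfl⟩, if_pos ⟨rfl, rfl⟩, if_pos rfl]
        simp only [coef, wt, star_mul', Complex.star_def, Complex.conj_conj, Complex.conj_ofReal,
          map_inv₀, Complex.conj_natCast, Complex.ofReal_mul, Complex.ofReal_pow,
          Complex.normSq_eq_conj_mul_self]
        field_simp
      · rw [if_neg hw]
        split_ifs with h2 h3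
        · exact absurd (Prod.ext h2.1.symm (Prod.ext h2.2.1.symm (Prod.ext h2.2.2.symm
            (Prod.ext h3.2.symm h3.1.symm)))) hw
        all_goals simp
  have hsum : ∑ w, wt w = 1 := sum_weights hd hlam hI hI1 hL hO hO1
  refine loccEquivalent_register (leftBlock_orthonormal hS hpos hlam hI ha eA)
    (rightBlock_orthonormal hS hpos hlam hI hb eB) (fun w : W => (O w.2.2.1)ᴴ) (fun w => ?_) wt
    (fun w => ?_) hsum f g k (fun w w' hf hg hkk => ?_) _ fun x y => ?_
  · rw [Matrix.conjTranspose_conjTranspose]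
    exact mul_eq_one_comm.1 (hOu _)
  · exact mul_nonneg (mul_nonneg (Complex.normSq_nonneg _) (Complex.normSq_nonneg _))
      (by positivity)
  · obtain ⟨j, k₁, μ, a₁, b₁⟩ := w
    obtain ⟨j', k₁', μ', a₁', b₁'⟩ := w'
    simp only [f, g, Prod.mk.injEq] at hf hg
    obtain ⟨rfl, rfl⟩ := hf
    obtain ⟨rfl, rfl⟩ := hg
    have h1 := congrArg reg.charge hkk
    rw [hk, hk] at h1
    have h2 : μ = μ' := hκ (mul_left_cancel (mul_left_cancel h1))
    rw [h2]
  · rw [hΨ, sptOmega_apply reg v q hv k hk ε φ hfac _ horth]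
    refine Finset.sum_congr rfl fun w _ => ?_
    split_ifs
    · simp only [φ, P, Q, mul_assoc]
    · rfl

end Sectors

end SPTEnt

end

theorem mainTheorem4 {G : Type*} [CommGroup G] {D p N : ℕ} [NeZero N]
    (lam : Fin D → ℝ) (hlam_pos : ∀ k, 0 < lam k) (hlam_norm : ∑ k, lam k ^ 2 = 1)
    (S : Matrix (Fin p) (Fin D × Fin D) ℂ) (hS : Sᴴ * S = 1)
    (U : G →* Matrix.unitaryGroup (Fin p) ℂ)
    (hsymm : ∀ g, SPTEnt.tensorPow (ZMod N) (U g : Matrix (Fin p) (Fin p) ℂ) *ᵥ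
      SPTEnt.fixedPointState N S lam = SPTEnt.fixedPointState N S lam)
    (s : ZMod N) (a c b : ℕ) (ha : 0 < a) (hc : 0 < c) (hb : 0 < b) (hN : a + c + b < N)
    (A B C : Finset (ZMod N)) (hA : A = SPTEnt.arc s a) (hC : C = SPTEnt.arc (s + (a : ZMod N)) c)
    (hB : B = SPTEnt.arc (s + (a : ZMod N) + (c : ZMod N)) b) :
    (∃ (χ : G →* Circle) (ω : G → G → Circle) (V : G → Matrix.unitaryGroup (Fin D) ℂ),
      SPTEnt.IsVirtualRep U S lam χ ω V) ∧
    ∀ (χ : G →* Circle) (ω : G → G → Circle) (V : G → Matrix.unitaryGroup (Fin D) ℂ),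
      SPTEnt.IsVirtualRep U S lam χ ω V →
      ∃ d : ℕ, SPTEnt.irrepDims ω = {d} ∧
        ∀ (K : Type) [Fintype K] [DecidableEq K]
          (reg : SPTEnt.ChargeRegister
            (fun g => SPTEnt.regionOp C (U g : Matrix (Fin p) (Fin p) ℂ)) K),
          SPTEnt.LOCCEquivalent
            (SPTEnt.registerWithAlice (SPTEnt.sptOmega U A B C reg
              (SPTEnt.pureState (SPTEnt.fixedPointState N S lam))))
            (SPTEnt.maxEntangled d) ∧
          SPTEnt.LOCCEquivalent
            (SPTEnt.registerWithBob (SPTEnt.sptOmega U A B C reg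
              (SPTEnt.pureState (SPTEnt.fixedPointState N S lam))))
            (SPTEnt.maxEntangled d) := by
  have hD : 0 < D := by
    rcases Nat.eq_zero_or_pos D with rfl | h
    · simp at hlam_norm
    · exact h
  refine ⟨SPTEnt.exists_isVirtualRep hS hlam_pos hlam_norm (by omega) U hsymm,
    fun χ ω V hV => ?_⟩
  obtain ⟨d, T, hT, hTi⟩ := SPTEnt.exists_irred hD hV.projRep
  refine ⟨d, SPTEnt.irrepDims_eq_singleton hT hTi, fun K _ _ reg => ?_⟩
  exact SPTEnt.loccEquivalent_sptOmega hlam_pos hlam_norm hS hV hT hTi s ha hc hb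
    (e := N - (a + c + b)) (by omega) (by omega) hA hC hB reg
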